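/- Let $d\ge 3$ and let $A,B\in\mathbb C[x,y]$ be homogeneous polynomials of degree $d$ with $\gcd(A,B)=1$; let $\mathcal H$ be the homogeneous foliation of degree $d$ on $\mathbb P^2_{\mathbb C}$ defined by $\omega=A(x,y)\,dx+B(x,y)\,dy$. Let $(p,q)$ be the affine chart of the dual plane $\check{\mathbb P}^2_{\mathbb C}$ corresponding to the line $\{y=px-q\}$. The Legendre transform $\mathrm{Leg}\,\mathcal H$ is the $d$-web given in this chart by the implicit differential equation $A(x,px-q)+p\,B(x,px-q)=0$ with $x=\frac{dq}{dp}$, that is, by the symmetric form $A(dq,\,p\,dq-q\,dp)+p\,B(dq,\,p\,dq-q\,dp)$ of degree $d$; its discriminant $\Delta(\mathrm{Leg}\,\mathcal H)$ is the set of points where this form is not a product of $d$ pairwise linearly independent linear forms. The curvature $K(\mathrm{Leg}\,\mathcal H)$ is the $2$-form given off $\Delta(\mathrm{Leg}\,\mathcal H)$ as follows: locally the web is defined by $d$ pairwise transverse holomorphic $1$-forms $\omega_1,\dots,\omega_d$ whose product is the symmetric form above, and $K=d\eta$ with $\eta=\sum_{r<s<t}\eta_{rst}$, where, writing $\omega_i\wedge\omega_j=\delta_{ij}\,dp\wedge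 dq$, $\eta_{rst}$ is the unique $1$-form such that $d(\delta_{st}\omega_r)=\eta_{rst}\wedge\delta_{st}\omega_r$, $d(\delta_{tr}\omega_s)=\eta_{rst}\wedge\delta_{tr}\omega_s$ and $d(\delta_{rs}\omega_t)=\eta_{rst}\wedge\delta_{rs}\omega_t$. It is holomorphic on a curve $D$ if it extends holomorphically near every point of $D$ outside a finite set. Let $D=\{p=p_0\}$, $p_0\in\mathbb C$, be an irreducible component of $\Delta(\mathrm{Leg}\,\mathcal H)$ (hence different from the line $\{q=0\}$ dual to the origin). Let $\underline{\mathcal G}_{\mathcal H}:\mathbb P^1_{\mathbb C}\to\mathbb P^1_{\mathbb C}$ be the map $[y:x]\mapsto[-A(x,y):B(x,y)]$, write $\underline{\mathcal G}_{\mathcal H}^{-1}([p_0:1])=\{[a_1:b_1],\dots,[a_n:b_n]\}$ with these $n$ points distinct, and let $\nu_i$ be the ramification index of $\underline{\mathcal G}_{\mathcal H}$ at $[a_i:b_i]$. Then, for every $i$, $1\le\nu_i\le d$, $(b_iy-a_ix)^{\nu_i}$ divides $A(x,y)B(b_i,a_i)-A(b_i,a_i)B(x,y)$, and the polynomials $$P_i(x,y)=\frac{A(x,y)\,B(b_i,a_i)-A(b_i,a_i)\,B(x,y)}{(b_iy-a_ix)^{\nu_i}},$$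 $$Q_i(x,y)=(\nu_i-2)\Big(\frac{\partial B}{\partial x}-\frac{\partial A}{\partial y}\Big)P_i+2(\nu_i+1)\Big(\frac{\partial P_i}{\partial x}\,B-\frac{\partial P_i}{\partial y}\,A\Big)$$ are homogeneous of degree $d-\nu_i$ and $2d-\nu_i-1$ respectively, with $P_i(b_i,a_i)\ne0$ and $B(b_i,a_i)\neq 0$. Moreover, the curvature of $\mathrm{Leg}\,\mathcal H$ is holomorphic on $D$ if and only if $$\sum_{i=1}^n\Big(1-\frac1{\nu_i}\Big)\frac{(p_0b_i-a_i)\,Q_i(b_i,a_i)}{P_i(b_i,a_i)\,B(b_i,a_i)}=0.$$ -/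

import Mathlib

open MvPolynomial

namespace HomogeneousWeb

/-! ### One-forms in two complex variables

Points of `ℂ × ℂ` have coordinates `(p, q)`. A differential `1`-form `α dp + β dq` is given by the
pair of functions `(α, β)`, and a `2`-form `k dp ∧ dq` by the function `k`. -/

/-- A `1`-form `α dp + β dq` on (a subset of) `ℂ²`. -/
abbrev OneForm := ℂ × ℂ → ℂ × ℂ

/-- `(α₁ dp + α₂ dq) ∧ (β₁ dp + β₂ dq) = wedge α β • dp ∧ dq`. -/
def wedge (α β : ℂ × ℂ) : ℂ := α.1 * β.2 - α.2 * β.1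

/-- The value of the covector `α₁ dp + α₂ dq` on the tangent vector `v = (dp, dq)`. -/
def pairing (α v : ℂ × ℂ) : ℂ := α.1 * v.1 + α.2 * v.2

/-- Exterior derivative: `d(α dp + β dq) = (∂β/∂p - ∂α/∂q) dp ∧ dq`. -/
noncomputable def extD (η : OneForm) (m : ℂ × ℂ) : ℂ :=
  fderiv ℂ (fun z => (η z).2) m (1, 0) - fderiv ℂ (fun z => (η z).1) m (0, 1)

/-! ### Webs, discriminant, fundamental form, curvature -/

/-- A symmetric form on `ℂ²`, given through its values `F m v` on tangent vectors `v` at `m`.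
For a symmetric form of degree `d`, `F m` is a binary form of degree `d`; it defines a `d`-web. -/
abbrev SymForm := ℂ × ℂ → ℂ × ℂ → ℂ

/-- The support of the discriminant of the `d`-web given by `F`: the points at which `F` does not
factor as a product of `d` pairwise linearly independent linear forms. -/
def discriminantLocus (d : ℕ) (F : SymForm) : Set (ℂ × ℂ) :=
  {m | ¬ ∃ l : Fin d → ℂ × ℂ,
      (∀ i j, i ≠ j → wedge (l i) (l j) ≠ 0) ∧ ∀ v, F m v = ∏ i, pairing (l i) v}

/-- On the set `U`, the web given by `F` is the superposition of the `d` pairwise transverse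
holomorphic foliations defined by the `1`-forms `ω 0, …, ω (d - 1)`. -/
structure IsDecomposition (d : ℕ) (F : SymForm) (U : Set (ℂ × ℂ)) (ω : Fin d → OneForm) :
    Prop where
  analytic : ∀ i, AnalyticOnNhd ℂ (ω i) U
  transverse : ∀ z ∈ U, ∀ i j, i ≠ j → wedge (ω i z) (ω j z) ≠ 0
  factor : ∀ z ∈ U, ∀ v, F z v = ∏ i, pairing (ω i z) v

/-- The equations that characterize the fundamental form `η` of the `3`-web given by the `1`-forms
`ω₁, ω₂, ω₃` on an open set `U`: with `ωᵢ ∧ ωⱼ = δᵢⱼ dp ∧ dq`,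
`d(δ₂₃ ω₁) = η ∧ δ₂₃ ω₁`, `d(δ₃₁ ω₂) = η ∧ δ₃₁ ω₂`, `d(δ₁₂ ω₃) = η ∧ δ₁₂ ω₃`. -/
def IsTripleForm (U : Set (ℂ × ℂ)) (ω₁ ω₂ ω₃ η : OneForm) : Prop :=
  ∀ z ∈ U,
    extD (fun w => wedge (ω₂ w) (ω₃ w) • ω₁ w) z
        = wedge (η z) (wedge (ω₂ z) (ω₃ z) • ω₁ z) ∧
    extD (fun w => wedge (ω₃ w) (ω₁ w) • ω₂ w) z
        = wedge (η z) (wedge (ω₃ z) (ω₁ z) • ω₂ z) ∧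
    extD (fun w => wedge (ω₁ w) (ω₂ w) • ω₃ w) z
        = wedge (η z) (wedge (ω₁ z) (ω₂ z) • ω₃ z)

/-- `η` is, on the open set `U`, the fundamental form of the completely decomposable web given by
the `1`-forms `ω 0, …, ω (d - 1)`: the sum over `r < s < t` of the fundamental forms of the
`3`-subwebs `ω r, ω s, ω t`. -/
def IsFundamentalForm (d : ℕ) (U : Set (ℂ × ℂ)) (ω : Fin d → OneForm) (η : OneForm) : Prop :=
  ∃ θ : Fin d → Fin d → Fin d → OneForm,
    (∀ r s t, r < s → s < t → IsTripleForm U (ω r) (ω s) (ω t) (θ r s t)) ∧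
    ∀ z ∈ U, η z = ∑ r, ∑ s ∈ Finset.Ioi r, ∑ t ∈ Finset.Ioi s, θ r s t z

/-- The curvature `K = dη` of the `d`-web given by `F` takes the value `k dp ∧ dq` at the point `m`
(a point outside the discriminant, where the web is locally completely decomposable). -/
def IsCurvatureAt (d : ℕ) (F : SymForm) (m : ℂ × ℂ) (k : ℂ) : Prop :=
  ∃ U : Set (ℂ × ℂ), IsOpen U ∧ m ∈ U ∧
    ∃ (ω : Fin d → OneForm) (η : OneForm),
      IsDecomposition d F U ω ∧ IsFundamentalForm d U ω η ∧ k = extD η m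

/-- Near `m`, the curvature, defined outside the discriminant, is the restriction of a
holomorphic `2`-form `g dp ∧ dq`. -/
def CurvatureHolomorphicAt (d : ℕ) (F : SymForm) (m : ℂ × ℂ) : Prop :=
  ∃ N : Set (ℂ × ℂ), IsOpen N ∧ m ∈ N ∧
    ∃ g : ℂ × ℂ → ℂ, AnalyticOnNhd ℂ g N ∧
      ∀ z ∈ N \ discriminantLocus d F, IsCurvatureAt d F z (g z)

/-- The curvature is holomorphic along the algebraic curve `D`: it is holomorphic at the generic
points of `D`, that is, at all but finitely many points of `D`. -/
def CurvatureHolomorphicAlong (d : ℕ) (F : SymForm) (D : Set (ℂ × ℂ)) : Prop :=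
  {m ∈ D | ¬ CurvatureHolomorphicAt d F m}.Finite

/-! ### Legendre transform of a homogeneous foliation

In `MvPolynomial (Fin 2) ℂ` the variables are `x = X 0` and `y = X 1`. -/

/-- The Legendre transform of the foliation defined by `A dx + B dy`, in the affine chart `(p, q)`
of the dual plane that corresponds to the line `{y = p x - q}`. The implicit differential equation
`A(x, p x - q) + p B(x, p x - q) = 0`, `x = dq / dp`, is written as the symmetric form of degree `d`
`A(dq, p dq - q dp) + p B(dq, p dq - q dp)` (where `A`, `B` are homogeneous of degree `d`). -/
noncomputable def legForm (A B : MvPolynomial (Fin 2) ℂ) : SymForm := fun m v =>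
  eval ![v.2, m.1 * v.2 - m.2 * v.1] A + m.1 * eval ![v.2, m.1 * v.2 - m.2 * v.1] B

/-! ### The projective line and ramification -/

/-- The complex projective line. -/
abbrev P1 := Projectivization ℂ (Fin 2 → ℂ)

lemma vec_left_ne (t : ℂ) : ![t, (1 : ℂ)] ≠ 0 := fun h => by simpa using congrFun h 1

lemma vec_right_ne (t : ℂ) : ![(1 : ℂ), t] ≠ 0 := fun h => by simpa using congrFun h 0

/-- The point `[t : 1]`. -/
noncomputable def P1.ofAffine (t : ℂ) : P1 := Projectivization.mk ℂ ![t, 1] (vec_left_ne t)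

open Classical in
/-- The inverse of the standard affine chart around `P`: `t ↦ [t : 1]` unless `P = [1 : 0]`, and
`t ↦ [1 : t]` for `P = [1 : 0]`. -/
noncomputable def P1.param (P : P1) (t : ℂ) : P1 :=
  if P.rep 1 = 0 then Projectivization.mk ℂ ![1, t] (vec_right_ne t) else P1.ofAffine t

open Classical in
/-- The standard affine coordinate around `P`, evaluated at `R`: `[a : b] ↦ a / b` unless
`P = [1 : 0]`, and `[a : b] ↦ b / a` for `P = [1 : 0]`. -/
noncomputable def P1.coord (P R : P1) : ℂ :=
  if P.rep 1 = 0 then R.rep 1 / R.rep 0 else R.rep 0 / R.rep 1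

/-- The ramification index at `P` of a nonconstant holomorphic map `f : ℙ¹ → ℙ¹`: the order of
vanishing at `P` of `f - f P`, in affine coordinates around `P` and `f P`. -/
noncomputable def ramificationIndex (f : P1 → P1) (P : P1) : ℕ :=
  analyticOrderNatAt
    (fun t => P1.coord (f P) (f (P1.param P t)) - P1.coord (f P) (f P)) (P1.coord P P)

open Classical in
/-- The map `[y : x] ↦ [-A(x, y) : B(x, y)]` associated to the foliation `A dx + B dy`; here `A`
and `B` are homogeneous of the same degree without common factor, so that they have no common zero
and the second branch is never used. -/
noncomputable def gMap (A B : MvPolynomial (Fin 2) ℂ) (P : P1) : P1 :=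
  if h : ![-eval ![P.rep 1, P.rep 0] A, eval ![P.rep 1, P.rep 0] B] ≠ 0 then
    Projectivization.mk ℂ _ h
  else P

/-! ### The polynomials of the criterion -/

/-- The determinant `A(x, y) B(b, a) - A(b, a) B(x, y)`. -/
noncomputable def numP (A B : MvPolynomial (Fin 2) ℂ) (a b : ℂ) : MvPolynomial (Fin 2) ℂ :=
  Matrix.det !![A, C (eval ![b, a] A); B, C (eval ![b, a] B)]

/-- The linear form `b y - a x`. -/
noncomputable def lineForm (a b : ℂ) : MvPolynomial (Fin 2) ℂ := C b * X 1 - C a * X 0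

open Classical in
/-- The quotient of `A(x, y) B(b, a) - A(b, a) B(x, y)` by `(b y - a x) ^ ν`
(with value `0` if the division is not exact). -/
noncomputable def polyP (A B : MvPolynomial (Fin 2) ℂ) (a b : ℂ) (ν : ℕ) :
    MvPolynomial (Fin 2) ℂ :=
  if h : lineForm a b ^ ν ∣ numP A B a b then h.choose else 0

/-- `(ν - 2) (∂B/∂x - ∂A/∂y) P + 2 (ν + 1) det (∂P/∂x, A; ∂P/∂y, B)`. -/
noncomputable def polyQ (A B : MvPolynomial (Fin 2) ℂ) (a b : ℂ) (ν : ℕ) :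
    MvPolynomial (Fin 2) ℂ :=
  C ((ν : ℂ) - 2) * (pderiv 0 B - pderiv 1 A) * polyP A B a b ν +
    C (2 * ((ν : ℂ) + 1)) *
      Matrix.det !![pderiv 0 (polyP A B a b ν), A; pderiv 1 (polyP A B a b ν), B]

end HomogeneousWeb

/-! Use an affine chart `τ ↦ (1 - κ τ, τ)` of ℙ¹ whose point at infinity is not in the fibre over
`p₀`, and let `f_p = 𝓐 + p 𝓑` be the dehomogenization of `A + p B`. Where the roots `τ_i(p)` of
`f_p` are simple, the web is given, up to factors, by the forms `liftForm κ τ_i`. It is invariant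
under scaling of `q`, so for these forms the fundamental form is `F(p) dp + H(p) dq / q`.
Multiplying the forms by functions adds a multiple of the logarithmic differential of their product,
and that product is the leading coefficient of `f_p`, a function of `p` alone. Hence every
decomposition gives `K = H'(p) / q dp ∧ dq` (`tripleAt_liftForm`,
`extD_eq_deriv_branchSum_of_forall_wedge`).

The function `H` is a sum over triples of roots. Fixing one root and summing over the other two
leaves the second and third derivatives of `f_p` at that root, so `H` is a constant minus `rootSum`,
the sum over the roots `t` of `f_p` of `dt/dp = -𝓑(t) / f_p'(t)` times `rootTerm`
(`sum_sum_eq_rootTerm`, `IsBranches.branchSum_eq`).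

Near `p₀` the good coordinate is `t`, with `p = -𝓐(t) / 𝓑(t)`. At a fibre point `ρ` of multiplicity
`ν`, `rootTerm` is `α / (t - ρ)² + β / (t - ρ)` plus a bounded term, with `β = polarCoeff` and `α =
0` if `ν = 1` (`exists_rootTerm_eq`). Weighted by `-𝓑 / f_p'` and summed over all the roots, the
polar parts are evaluated exactly by the partial fractions of `𝓑 / f_p` at `ρ`: the simple pole
gives `β / (p - p₀)` plus a bounded term, and the double pole gives zero if `ν ≥ 2`. The bounded
terms contribute `o(1 / (p - p₀))`. So `rootSum` has at most a simple pole, with residue `∑ β_i`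
(`IsFibre.tendsto_sub_mul_rootSum`), and `K` extends across the line exactly when this residue
vanishes (`curvatureHolomorphicAlong_iff`). Euler's relation turns `6 β_i` into the `i`-th summand
of the criterion (`term_eq_polarCoeff`). -/

namespace HomogeneousWeb

/-! ### Binary forms -/

section BinaryForms

variable {A B G : MvPolynomial (Fin 2) ℂ} {d : ℕ}

/-- The values lie in an arbitrary algebra because the identity is needed in the quotient of the
polynomial ring by a linear form. -/
lemma aeval_mul_of_isHomogeneous {R : Type*} [CommRing R] [Algebra ℂ R] (hG : G.IsHomogeneous d)
    (c x y : R) : aeval ![c * x, c * y] G = c ^ d * aeval ![x, y] G := by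
  simp only [aeval_def, eval₂_eq', Finset.mul_sum, Fin.prod_univ_two]
  refine Finset.sum_congr rfl fun m hm => ?_
  have h := hG.degree_eq_sum_deg_support hm
  have h2 : d = m 0 + m 1 := by
    rw [h, Finset.sum_subset (Finset.subset_univ _), Fin.sum_univ_two]
    intro i _ hi
    simpa using hi
  simp only [Matrix.cons_val_zero, Matrix.cons_val_one, mul_pow, h2, pow_add]
  ring

lemma eval_mul_of_isHomogeneous (hG : G.IsHomogeneous d) (c x y : ℂ) :
    eval ![c * x, c * y] G = c ^ d * eval ![x, y] G := by
  simpa [aeval_eq_eval] using aeval_mul_of_isHomogeneous hG c x y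

lemma eval_lineForm (a b x y : ℂ) : eval ![x, y] (lineForm a b) = b * y - a * x := by
  simp [lineForm]

lemma lineForm_isHomogeneous (a b : ℂ) : (lineForm a b).IsHomogeneous 1 :=
  (isHomogeneous_C_mul_X _ _).sub (isHomogeneous_C_mul_X _ _)

lemma lineForm_ne_zero {a b : ℂ} (h : ![a, b] ≠ 0) : lineForm a b ≠ 0 := by
  intro h0
  apply h
  have h1 := eval_lineForm a b 1 0
  have h2 := eval_lineForm a b 0 1
  rw [h0] at h1 h2
  ext i
  fin_cases i
  · simpa using h1.symm
  · simpa using h2.symm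

/-- Modulo `b y - a x`, a nonzero multiple `(c x, c y)` with `c = a` or `c = b` equals `(u b, u a)`,
so `c ^ d G = u ^ d G(b, a) = 0` in the quotient, where `c` is invertible. -/
lemma lineForm_dvd_of_eval_eq_zero (hG : G.IsHomogeneous d) {a b : ℂ} (hab : ![a, b] ≠ 0)
    (h : eval ![b, a] G = 0) : lineForm a b ∣ G := by
  set I := Ideal.span {lineForm a b}
  set φ := Ideal.Quotient.mkₐ ℂ I
  rw [← Ideal.mem_span_singleton, ← Ideal.Quotient.eq_zero_iff_mem]
  change φ G = 0
  have key : algebraMap ℂ _ b * φ (X 1) = algebraMap ℂ _ a * φ (X 0) := by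
    have : φ (lineForm a b) = 0 :=
      Ideal.Quotient.eq_zero_iff_mem.2 (Ideal.mem_span_singleton_self _)
    rw [lineForm, map_sub, map_mul, map_mul, sub_eq_zero] at this
    exact this
  have hφ : φ G = aeval ![φ (X 0), φ (X 1)] G := by
    have : φ = aeval ![φ (X 0), φ (X 1)] := by
      refine MvPolynomial.algHom_ext fun i => ?_
      fin_cases i <;> simp
    exact DFunLike.congr_fun this G
  have hz (s t : ℂ) (u : MvPolynomial (Fin 2) ℂ ⧸ I) (hst : eval ![s, t] G = 0) :
      aeval ![u * algebraMap ℂ _ s, u * algebraMap ℂ _ t] G = 0 := by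
    rw [aeval_mul_of_isHomogeneous hG]
    have : aeval ![algebraMap ℂ (MvPolynomial (Fin 2) ℂ ⧸ I) s, algebraMap ℂ _ t] G
        = algebraMap ℂ _ (aeval ![s, t] G) := by
      rw [← aeval_algebraMap_apply]
      congr 2
      ext i
      fin_cases i <;> simp
    rw [this, aeval_eq_eval]
    simp [hst]
  have hcancel (c : ℂ) (hc : c ≠ 0) (w : MvPolynomial (Fin 2) ℂ ⧸ I)
      (hw : algebraMap ℂ _ c ^ d * w = 0) : w = 0 := by
    have h1 : algebraMap ℂ (MvPolynomial (Fin 2) ℂ ⧸ I) c⁻¹ ^ d * (algebraMap ℂ _ c ^ d * w) = w := by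
      rw [← mul_assoc, ← mul_pow, ← map_mul, inv_mul_cancel₀ hc, map_one, one_pow, one_mul]
    rw [← h1, hw, mul_zero]
  rw [hφ]
  by_cases hb : b = 0
  · have ha : a ≠ 0 := by
      rintro rfl
      apply hab
      simp [hb]
    apply hcancel a ha
    rw [← aeval_mul_of_isHomogeneous hG, ← key, mul_comm (algebraMap ℂ _ b),
      mul_comm (algebraMap ℂ _ a)]
    exact hz _ _ _ h
  · apply hcancel b hb
    rw [← aeval_mul_of_isHomogeneous hG, key, mul_comm (algebraMap ℂ _ b),
      mul_comm (algebraMap ℂ _ a)]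
    exact hz _ _ _ h

/-- The component of `L P` in degree `k + m` is `L` times the component of `P` in degree `m`;
cancelling `L` shows that `P` is its own component. -/
lemma isHomogeneous_of_mul_left {L P : MvPolynomial (Fin 2) ℂ} {k m : ℕ} (hL : L.IsHomogeneous k)
    (hL0 : L ≠ 0) (h : (L * P).IsHomogeneous (k + m)) : P.IsHomogeneous m := by
  let _ : GradedAlgebra (homogeneousSubmodule (Fin 2) ℂ) := MvPolynomial.gradedAlgebra
  have h1 := DirectSum.coe_decompose_mul_add_of_left_mem
    (𝒜 := homogeneousSubmodule (Fin 2) ℂ) (i := k) (j := m) (b := P) hL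
  rw [DirectSum.decompose_of_mem_same _ h] at h1
  rw [mul_left_cancel₀ hL0 h1]
  exact (DirectSum.decompose (homogeneousSubmodule (Fin 2) ℂ) P m).2

lemma exists_eq_lineForm_pow_mul (hG : G.IsHomogeneous d) (hG0 : G ≠ 0) {a b : ℂ}
    (hab : ![a, b] ≠ 0) : ∃ m ≤ d, ∃ P : MvPolynomial (Fin 2) ℂ, P.IsHomogeneous (d - m) ∧
      G = lineForm a b ^ m * P ∧ eval ![b, a] P ≠ 0 := by
  induction d generalizing G with
  | zero =>
    refine ⟨0, le_rfl, G, hG, by simp, fun h => ?_⟩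
    rw [← totalDegree_zero_iff_isHomogeneous, totalDegree_eq_zero_iff_eq_C] at hG
    rw [hG, eval_C] at h
    rw [h, C_0] at hG
    exact hG0 hG
  | succ d ih =>
    by_cases h : eval ![b, a] G = 0
    · obtain ⟨G', rfl⟩ := lineForm_dvd_of_eval_eq_zero hG hab h
      have hG' : G'.IsHomogeneous d :=
        isHomogeneous_of_mul_left (lineForm_isHomogeneous a b) (lineForm_ne_zero hab)
          (by rwa [add_comm])
      obtain ⟨m, hm, P, hP, rfl, hP0⟩ := ih hG' (right_ne_zero_of_mul hG0)
      exact ⟨m + 1, by omega, P, by simpa using hP, by ring, hP0⟩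
    · exact ⟨0, by omega, G, hG, by simp, h⟩

lemma not_common_zero (hA : A.IsHomogeneous d) (hB : B.IsHomogeneous d) (hAB : IsRelPrime A B)
    {a b : ℂ} (hab : ![a, b] ≠ 0) (h1 : eval ![b, a] A = 0) (h2 : eval ![b, a] B = 0) : False := by
  have hu := hAB (lineForm_dvd_of_eval_eq_zero hA hab h1) (lineForm_dvd_of_eval_eq_zero hB hab h2)
  have := hu.map (eval ![b, a])
  rw [eval_lineForm] at this
  exact this.ne_zero (by ring)

lemma add_C_mul_ne_zero (hd : 0 < d) (hB : B.IsHomogeneous d) (hAB : IsRelPrime A B) (p : ℂ) :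
    A + C p * B ≠ 0 := by
  intro h
  have hu : IsUnit B := hAB (by rw [eq_neg_of_add_eq_zero_left h]; exact (Dvd.intro_left _ rfl).neg_right)
    dvd_rfl
  have h0 : eval ![(0 : ℂ), 0] B = 0 := by
    have := eval_mul_of_isHomogeneous hB 0 0 0
    simpa [hd.ne'] using this
  exact (hu.map (eval ![(0 : ℂ), 0])).ne_zero h0

end BinaryForms

/-! ### The fibre of `gMap` and the ramification indices -/

section Fibre

variable {A B : MvPolynomial (Fin 2) ℂ} {d : ℕ}

lemma exists_rep_eq (v : Fin 2 → ℂ) (hv : v ≠ 0) :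
    ∃ c : ℂ, c ≠ 0 ∧ ∀ i, (Projectivization.mk ℂ v hv).rep i = c * v i := by
  obtain ⟨c, hc⟩ := Projectivization.exists_smul_eq_mk_rep ℂ v hv
  refine ⟨c, c.ne_zero, fun i => ?_⟩
  rw [← hc]
  rfl

lemma rep_div_rep (v : Fin 2 → ℂ) (hv : v ≠ 0) :
    (Projectivization.mk ℂ v hv).rep 0 / (Projectivization.mk ℂ v hv).rep 1 = v 0 / v 1 := by
  obtain ⟨c, hc, h⟩ := exists_rep_eq v hv
  rw [h, h, mul_div_mul_left _ _ hc]

lemma rep_div_rep' (v : Fin 2 → ℂ) (hv : v ≠ 0) :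
    (Projectivization.mk ℂ v hv).rep 1 / (Projectivization.mk ℂ v hv).rep 0 = v 1 / v 0 := by
  obtain ⟨c, hc, h⟩ := exists_rep_eq v hv
  rw [h, h, mul_div_mul_left _ _ hc]

lemma rep_one_eq_zero_iff (v : Fin 2 → ℂ) (hv : v ≠ 0) :
    (Projectivization.mk ℂ v hv).rep 1 = 0 ↔ v 1 = 0 := by
  obtain ⟨c, hc, h⟩ := exists_rep_eq v hv
  rw [h, mul_eq_zero, or_iff_right hc]

lemma gMap_vec_ne (hA : A.IsHomogeneous d) (hB : B.IsHomogeneous d) (hAB : IsRelPrime A B)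
    {a b : ℂ} (hab : ![a, b] ≠ 0) : ![-eval ![b, a] A, eval ![b, a] B] ≠ 0 := by
  intro h
  refine not_common_zero hA hB hAB hab ?_ ?_
  · simpa using congrFun h 0
  · simpa using congrFun h 1

lemma gMap_mk (hA : A.IsHomogeneous d) (hB : B.IsHomogeneous d) (hAB : IsRelPrime A B)
    {a b : ℂ} (hab : ![a, b] ≠ 0) :
    gMap A B (Projectivization.mk ℂ ![a, b] hab) =
      Projectivization.mk ℂ ![-eval ![b, a] A, eval ![b, a] B] (gMap_vec_ne hA hB hAB hab) := by
  obtain ⟨c, hc, h⟩ := exists_rep_eq ![a, b] hab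
  have h0 := h 0
  have h1 := h 1
  simp only [Matrix.cons_val_zero, Matrix.cons_val_one] at h0 h1
  have hA' := eval_mul_of_isHomogeneous hA c b a
  have hB' := eval_mul_of_isHomogeneous hB c b a
  have hne := gMap_vec_ne hA hB hAB hab
  have hcd : c ^ d ≠ 0 := pow_ne_zero _ hc
  have heq : ![-(c ^ d * eval ![b, a] A), c ^ d * eval ![b, a] B]
      = c ^ d • ![-eval ![b, a] A, eval ![b, a] B] := by
    simp
  have hne' : ![-(c ^ d * eval ![b, a] A), c ^ d * eval ![b, a] B] ≠ 0 := by
    rw [heq]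
    exact smul_ne_zero hcd hne
  unfold gMap
  simp only [h0, h1, hA', hB']
  rw [dif_pos hne', Projectivization.mk_eq_mk_iff']
  exact ⟨c ^ d, heq.symm⟩

lemma gMap_eq_ofAffine_iff (hA : A.IsHomogeneous d) (hB : B.IsHomogeneous d)
    (hAB : IsRelPrime A B) {a b : ℂ} (hab : ![a, b] ≠ 0) (p : ℂ) :
    gMap A B (Projectivization.mk ℂ ![a, b] hab) = P1.ofAffine p ↔
      eval ![b, a] (A + C p * B) = 0 := by
  rw [gMap_mk hA hB hAB hab, P1.ofAffine, Projectivization.mk_eq_mk_iff']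
  simp only [map_add, map_mul, eval_C]
  constructor
  · rintro ⟨c, hc⟩
    have h0 := congrFun hc 0
    have h1 := congrFun hc 1
    simp at h0 h1
    linear_combination h0 - p * h1
  · intro h
    refine ⟨eval ![b, a] B, ?_⟩
    ext i
    fin_cases i
    · simp
      linear_combination h
    · simp

lemma coord_gMap (hA : A.IsHomogeneous d) (hB : B.IsHomogeneous d)
    (hAB : IsRelPrime A B) {a b : ℂ} (hab : ![a, b] ≠ 0) (p : ℂ) :
    P1.coord (P1.ofAffine p) (gMap A B (Projectivization.mk ℂ ![a, b] hab)) =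
      -eval ![b, a] A / eval ![b, a] B := by
  unfold P1.coord
  rw [if_neg, gMap_mk hA hB hAB, rep_div_rep]
  · simp
  · rw [P1.ofAffine, rep_one_eq_zero_iff]
    simp

lemma coord_ofAffine (p : ℂ) : P1.coord (P1.ofAffine p) (P1.ofAffine p) = p := by
  unfold P1.coord
  rw [if_neg, P1.ofAffine, rep_div_rep]
  · simp
  · rw [P1.ofAffine, rep_one_eq_zero_iff]
    simp

lemma analyticAt_eval {f g : ℂ → ℂ} {t : ℂ} (hf : AnalyticAt ℂ f t) (hg : AnalyticAt ℂ g t)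
    (P : MvPolynomial (Fin 2) ℂ) : AnalyticAt ℂ (fun t => eval ![f t, g t] P) t := by
  induction P using MvPolynomial.induction_on with
  | C c => simpa using analyticAt_const
  | add p q hp hq =>
    simp only [map_add]
    exact hp.add hq
  | mul_X p i hp =>
    simp only [map_mul, eval_X]
    refine hp.mul ?_
    fin_cases i
    · simpa using hf
    · simpa using hg

/-- Since `-A / B - p = -(A + p B) / B`, the order of vanishing is the exponent of the linear form
in `A + p B`. The curve `(f, g)` stands for either of the two standard charts. -/
lemma analyticOrderNatAt_slope {f g : ℂ → ℂ} {t₀ p c a b : ℂ} {m : ℕ} {P : MvPolynomial (Fin 2) ℂ}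
    (hf : AnalyticAt ℂ f t₀) (hg : AnalyticAt ℂ g t₀) (hc : c ≠ 0)
    (hl : ∀ t, b * g t - a * f t = c * (t - t₀))
    (hP : A + C p * B = lineForm a b ^ m * P) (hP0 : eval ![f t₀, g t₀] P ≠ 0)
    (hB0 : eval ![f t₀, g t₀] B ≠ 0) :
    analyticOrderNatAt (fun t => -eval ![f t, g t] A / eval ![f t, g t] B - p) t₀ = m := by
  have hBan := analyticAt_eval hf hg B
  have hAan := analyticAt_eval hf hg A
  have hPan := analyticAt_eval hf hg P
  have h1 : AnalyticAt ℂ (fun t => -eval ![f t, g t] A / eval ![f t, g t] B - p) t₀ :=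
    (hAan.neg.div hBan hB0).sub analyticAt_const
  have : analyticOrderAt (fun t => -eval ![f t, g t] A / eval ![f t, g t] B - p) t₀ = (m : ℕ) := by
    rw [h1.analyticOrderAt_eq_natCast]
    refine ⟨fun t => -c ^ m * eval ![f t, g t] P / eval ![f t, g t] B,
      (analyticAt_const.mul hPan).div hBan hB0, ?_, ?_⟩
    · exact div_ne_zero (mul_ne_zero (neg_ne_zero.2 (pow_ne_zero _ hc)) hP0) hB0
    · filter_upwards [hBan.continuousAt.eventually_ne hB0] with t ht
      have h2 := congrArg (eval ![f t, g t]) hP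
      simp only [map_add, map_mul, eval_C, map_pow, eval_lineForm, hl, mul_pow] at h2
      rw [smul_eq_mul]
      field_simp
      linear_combination -h2
  rw [analyticOrderNatAt, this]
  rfl

lemma ramificationIndex_eq (hA : A.IsHomogeneous d) (hB : B.IsHomogeneous d)
    (hAB : IsRelPrime A B) {a b : ℂ} (hab : ![a, b] ≠ 0) {p : ℂ}
    (hp : gMap A B (Projectivization.mk ℂ ![a, b] hab) = P1.ofAffine p)
    (hB0 : eval ![b, a] B ≠ 0) {m k : ℕ}
    {P : MvPolynomial (Fin 2) ℂ} (hPh : P.IsHomogeneous k)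
    (hP : A + C p * B = lineForm a b ^ m * P) (hP0 : eval ![b, a] P ≠ 0) :
    ramificationIndex (gMap A B) (Projectivization.mk ℂ ![a, b] hab) = m := by
  unfold ramificationIndex
  rw [hp, coord_ofAffine]
  -- At `[1 : 0]` both `P1.param` and `P1.coord` switch to the other chart.
  by_cases hb : b = 0
  · have ha : a ≠ 0 := by
      rintro rfl
      apply hab
      simp [hb]
    have h0 : (Projectivization.mk ℂ ![a, b] hab).rep 1 = 0 := by
      rw [rep_one_eq_zero_iff]
      simpa using hb
    have h1 : P1.coord (Projectivization.mk ℂ ![a, b] hab) (Projectivization.mk ℂ ![a, b] hab)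
        = b / a := by
      rw [P1.coord, if_pos h0, rep_div_rep']
      simp
    simp only [h1, P1.param, if_pos h0, coord_gMap hA hB hAB]
    have hval : ∀ (Q : MvPolynomial (Fin 2) ℂ) {k : ℕ}, Q.IsHomogeneous k →
        eval ![b, a] Q ≠ 0 → eval ![b / a, 1] Q ≠ 0 := by
      intro Q k hQ h h'
      apply h
      rw [show b = a * (b / a) by field_simp, show ![a * (b / a), a] = ![a * (b / a), a * 1] by simp,
        eval_mul_of_isHomogeneous hQ, h', mul_zero]
    refine analyticOrderNatAt_slope (f := fun t => t) (g := fun _ => 1) (c := -a) (a := a) (b := b)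
      (P := P) analyticAt_id analyticAt_const
      (neg_ne_zero.2 ha) (fun t => ?_) hP ?_ ?_
    · simp [hb]
    · exact hval P hPh hP0
    · exact hval B hB hB0
  · have h0 : (Projectivization.mk ℂ ![a, b] hab).rep 1 ≠ 0 := by
      rw [Ne, rep_one_eq_zero_iff]
      simpa using hb
    have h1 : P1.coord (Projectivization.mk ℂ ![a, b] hab) (Projectivization.mk ℂ ![a, b] hab)
        = a / b := by
      rw [P1.coord, if_neg h0, rep_div_rep]
      simp
    have h2 (t : ℂ) : P1.coord (P1.ofAffine p) (gMap A B (P1.ofAffine t)) =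
        -eval ![1, t] A / eval ![1, t] B := coord_gMap hA hB hAB _ p
    simp only [h1, P1.param, if_neg h0, h2]
    have hval : ∀ (Q : MvPolynomial (Fin 2) ℂ) {k : ℕ}, Q.IsHomogeneous k →
        eval ![b, a] Q ≠ 0 → eval ![1, a / b] Q ≠ 0 := by
      intro Q k hQ h h'
      apply h
      rw [show a = b * (a / b) by field_simp, show ![b, b * (a / b)] = ![b * 1, b * (a / b)] by simp,
        eval_mul_of_isHomogeneous hQ, h', mul_zero]
    refine analyticOrderNatAt_slope (f := fun _ => 1) (g := fun t => t) (c := b) (a := a) (b := b)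
      (P := P) analyticAt_const analyticAt_id hb (fun t => ?_) hP ?_ ?_
    · simp
      field_simp
    · exact hval P hPh hP0
    · exact hval B hB hB0

end Fibre

/-! ### Dehomogenization

The affine chart `τ ↦ (1 - κ τ, τ)` of the projective line. -/

/-- The polynomial `G(1 - κ τ, τ)` in `τ`. -/
noncomputable def dehom (κ : ℂ) (G : MvPolynomial (Fin 2) ℂ) : Polynomial ℂ :=
  aeval ![1 - Polynomial.C κ * Polynomial.X, Polynomial.X] G

section Dehom

variable {G : MvPolynomial (Fin 2) ℂ} {d : ℕ} {κ : ℂ}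

@[simp] lemma dehom_C (κ c : ℂ) : dehom κ (C c) = Polynomial.C c := by
  simp [dehom]

@[simp] lemma dehom_add (κ : ℂ) (F G : MvPolynomial (Fin 2) ℂ) :
    dehom κ (F + G) = dehom κ F + dehom κ G := by
  simp [dehom]

@[simp] lemma dehom_mul (κ : ℂ) (F G : MvPolynomial (Fin 2) ℂ) :
    dehom κ (F * G) = dehom κ F * dehom κ G := by
  simp [dehom]

@[simp] lemma dehom_pow (κ : ℂ) (F : MvPolynomial (Fin 2) ℂ) (n : ℕ) :
    dehom κ (F ^ n) = dehom κ F ^ n := by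
  simp [dehom]

lemma dehom_lineForm (κ a b : ℂ) :
    dehom κ (lineForm a b) = Polynomial.C (b + κ * a) * Polynomial.X - Polynomial.C a := by
  simp only [dehom, lineForm, map_sub, map_mul, algHom_C, aeval_X, Matrix.cons_val_zero,
    Matrix.cons_val_one, map_add, Polynomial.algebraMap_eq]
  ring

lemma eval_dehom (κ τ : ℂ) (G : MvPolynomial (Fin 2) ℂ) :
    (dehom κ G).eval τ = eval ![1 - κ * τ, τ] G := by
  have h := MvPolynomial.comp_aeval_apply (f := ![1 - Polynomial.C κ * Polynomial.X, Polynomial.X])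
    (Polynomial.aeval τ : Polynomial ℂ →ₐ[ℂ] ℂ) G
  rw [← Polynomial.coe_aeval_eq_eval, dehom]
  refine h.trans ?_
  rw [aeval_eq_eval]
  congr 2
  ext i
  fin_cases i <;> simp

lemma dehom_eq_sum (κ : ℂ) (G : MvPolynomial (Fin 2) ℂ) :
    dehom κ G = ∑ m ∈ G.support, Polynomial.C (coeff m G) *
      ((1 - Polynomial.C κ * Polynomial.X) ^ m 0 * Polynomial.X ^ m 1) := by
  rw [dehom, aeval_def, eval₂_eq']
  simp [Fin.prod_univ_two]

lemma degree_eq_add_of_mem_support (hG : G.IsHomogeneous d) {m : Fin 2 →₀ ℕ} (hm : m ∈ G.support) :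
    d = m 0 + m 1 := by
  rw [hG.degree_eq_sum_deg_support hm, Finset.sum_subset (Finset.subset_univ _), Fin.sum_univ_two]
  intro i _ hi
  simpa using hi

lemma natDegree_one_sub_le (κ : ℂ) :
    (1 - Polynomial.C κ * Polynomial.X : Polynomial ℂ).natDegree ≤ 1 := by
  compute_degree

lemma natDegree_dehom_le (hG : G.IsHomogeneous d) : (dehom κ G).natDegree ≤ d := by
  rw [dehom_eq_sum]
  refine Polynomial.natDegree_sum_le_of_forall_le _ _ fun m hm => ?_
  refine (Polynomial.natDegree_C_mul_le _ _).trans ?_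
  rw [degree_eq_add_of_mem_support hG hm]
  refine Polynomial.natDegree_mul_le_of_le ?_ (Polynomial.natDegree_X_pow_le _)
  simpa using Polynomial.natDegree_pow_le_of_le (m 0) (natDegree_one_sub_le κ)

/-- The point `(-κ, 1)` is the one at infinity for the chart: the coefficient of degree `d` is
nonzero exactly when `G` has no zero there. -/
lemma coeff_dehom (hG : G.IsHomogeneous d) : (dehom κ G).coeff d = eval ![-κ, 1] G := by
  rw [dehom_eq_sum, Polynomial.finsetSum_coeff, eval_eq']
  refine Finset.sum_congr rfl fun m hm => ?_
  rw [Polynomial.coeff_C_mul, degree_eq_add_of_mem_support hG hm, Polynomial.coeff_mul_X_pow]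
  have h := Polynomial.coeff_pow_of_natDegree_le (n := 1) (m := m 0) (natDegree_one_sub_le κ)
  rw [mul_one] at h
  rw [h]
  simp [Fin.prod_univ_two, Polynomial.coeff_one]

lemma eval_eq_pow_mul_eval_dehom (hG : G.IsHomogeneous d) {x y : ℂ} (h : x + κ * y ≠ 0) :
    eval ![x, y] G = (x + κ * y) ^ d * (dehom κ G).eval (y / (x + κ * y)) := by
  rw [eval_dehom, ← eval_mul_of_isHomogeneous hG]
  congr 2
  ext i
  fin_cases i
  · simp
    field_simp
    ring
  · exact (mul_div_cancel₀ y h).symm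

/-- The homogeneous form of a factorization of the dehomogenized polynomial. -/
lemma eval_eq_mul_prod (hG : G.IsHomogeneous d) {c : ℂ} {τ : Fin d → ℂ}
    (h : dehom κ G = Polynomial.C c * ∏ s, (Polynomial.X - Polynomial.C (τ s))) (x y : ℂ) :
    eval ![x, y] G = c * ∏ s, ((1 - κ * τ s) * y - τ s * x) := by
  have hne {x y : ℂ} (hl : x + κ * y ≠ 0) :
      eval ![x, y] G = c * ∏ s, ((1 - κ * τ s) * y - τ s * x) := by
    rw [eval_eq_pow_mul_eval_dehom hG hl, h]
    simp only [Polynomial.eval_mul, Polynomial.eval_C, Polynomial.eval_prod, Polynomial.eval_sub,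
      Polynomial.eval_X]
    have : ∀ s, (1 - κ * τ s) * y - τ s * x = (x + κ * y) * (y / (x + κ * y) - τ s) := by
      intro s
      field_simp
      ring
    simp only [this, Finset.prod_mul_distrib, Finset.prod_const, Finset.card_univ, Fintype.card_fin]
    ring
  -- The line at infinity of the chart is reached by continuity in the first variable.
  by_cases hl : x + κ * y = 0
  · have hf : Continuous fun t : ℂ => eval ![x + t, y] G :=
      continuous_iff_continuousAt.2 fun t =>
        (analyticAt_eval (analyticAt_const.add analyticAt_id) analyticAt_const G).continuousAt
    have hg : Continuous fun t : ℂ => c * ∏ s, ((1 - κ * τ s) * y - τ s * (x + t)) := by fun_prop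
    have heq := Continuous.ext_on (dense_compl_singleton (0 : ℂ)) hf hg (fun t ht => by
      refine hne ?_
      rw [show x + t + κ * y = t by linear_combination hl]
      exact ht)
    simpa using congrFun heq 0
  · exact hne hl

lemma eval_derivative_dehom (κ τ : ℂ) (G : MvPolynomial (Fin 2) ℂ) :
    (dehom κ G).derivative.eval τ =
      -κ * eval ![1 - κ * τ, τ] (pderiv 0 G) + eval ![1 - κ * τ, τ] (pderiv 1 G) := by
  induction G using MvPolynomial.induction_on with
  | C c => simp
  | add p q hp hq =>
    simp only [dehom_add, Polynomial.eval_add, hp, hq, map_add]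
    ring
  | mul_X p i hp =>
    simp only [dehom_mul, Polynomial.derivative_mul, Polynomial.eval_add, Polynomial.eval_mul, hp,
      pderiv_mul, map_add, map_mul, eval_dehom, eval_X]
    fin_cases i <;> simp [dehom] <;> ring

lemma euler_eval (hG : G.IsHomogeneous d) (x y : ℂ) :
    x * eval ![x, y] (pderiv 0 G) + y * eval ![x, y] (pderiv 1 G) = d * eval ![x, y] G := by
  have h := congrArg (eval ![x, y]) hG.sum_X_mul_pderiv
  simpa [Fin.sum_univ_two] using h

/-- The extra factor `c` replaces the exponent `d - 1` by `d`, so that `d = 0` is not an exception.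
-/
lemma eval_mul_pderiv (hG : G.IsHomogeneous d) (c x y : ℂ) (i : Fin 2) :
    c * eval ![c * x, c * y] (pderiv i G) = c ^ d * eval ![x, y] (pderiv i G) := by
  rcases d with _ | d
  · rw [← totalDegree_zero_iff_isHomogeneous, totalDegree_eq_zero_iff_eq_C] at hG
    rw [hG, pderiv_C]
    simp
  · rw [eval_mul_of_isHomogeneous hG.pderiv]
    simp
    ring

end Dehom

/-! ### The polynomials `P` and `Q` -/

section PolyPQ

variable {A B P : MvPolynomial (Fin 2) ℂ} {d ν : ℕ} {a b p₀ : ℂ}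

/-- At a fibre point `A(b, a) = -p₀ B(b, a)`, so the second column of the determinant is
proportional to `(-p₀, 1)`. Thus `polyP` is, up to a constant, the cofactor of the linear form in `A
+ p₀ B`. -/
lemma numP_eq (h : eval ![b, a] (A + C p₀ * B) = 0) :
    numP A B a b = C (eval ![b, a] B) * (A + C p₀ * B) := by
  have : eval ![b, a] A = -(p₀ * eval ![b, a] B) := by
    simp only [map_add, map_mul, eval_C] at h
    linear_combination h
  rw [numP, Matrix.det_fin_two_of, this]
  simp only [map_neg, map_mul]
  ring

lemma polyP_eq (hab : ![a, b] ≠ 0) (h : eval ![b, a] (A + C p₀ * B) = 0)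
    (hP : A + C p₀ * B = lineForm a b ^ ν * P) :
    polyP A B a b ν = C (eval ![b, a] B) * P := by
  have h1 : numP A B a b = lineForm a b ^ ν * (C (eval ![b, a] B) * P) := by
    rw [numP_eq h, hP]
    ring
  have hdvd : lineForm a b ^ ν ∣ numP A B a b := ⟨_, h1⟩
  rw [polyP, dif_pos hdvd]
  exact mul_left_cancel₀ (pow_ne_zero _ (lineForm_ne_zero hab))
    (hdvd.choose_spec.symm.trans h1)

lemma polyQ_isHomogeneous (hA : A.IsHomogeneous d) (hB : B.IsHomogeneous d) (hd : 1 ≤ d)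
    (hν : ν ≤ d) (hP : (polyP A B a b ν).IsHomogeneous (d - ν)) :
    (polyQ A B a b ν).IsHomogeneous (2 * d - ν - 1) := by
  unfold polyQ
  rw [mul_assoc]
  refine IsHomogeneous.add (IsHomogeneous.C_mul ?_ _) (IsHomogeneous.C_mul ?_ _)
  · rw [show 2 * d - ν - 1 = (d - 1) + (d - ν) by omega]
    exact (hB.pderiv.sub hA.pderiv).mul hP
  · rw [Matrix.det_fin_two_of]
    -- For `ν = d` the truncated degree `d - ν - 1` would be wrong, but `P` is then constant and the
    -- determinant vanishes.
    rcases hν.eq_or_lt with rfl | hlt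
    · rw [Nat.sub_self, ← totalDegree_zero_iff_isHomogeneous, totalDegree_eq_zero_iff_eq_C] at hP
      rw [hP, pderiv_C, pderiv_C, zero_mul, mul_zero, sub_zero]
      exact isHomogeneous_zero _ _ _
    · refine IsHomogeneous.sub ?_ ?_
      · rw [show 2 * d - ν - 1 = (d - ν - 1) + d by omega]
        exact hP.pderiv.mul hB
      · rw [show 2 * d - ν - 1 = d + (d - ν - 1) by omega]
        exact hA.mul hP.pderiv

/-- The coefficient of `(τ - ρ)⁻¹` in the polar part at `ρ` that a fibre point `ρ` of
multiplicity `ν` contributes to the curvature. -/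
noncomputable def polarCoeff (d ν : ℕ) (κ p₀ : ℂ) (𝓑 P : Polynomial ℂ) (ρ : ℂ) : ℂ :=
  (p₀ * (1 - κ * ρ) - ρ) * (ν - 1) / (6 * ν) *
    (2 * ν * (ν - 2) * (-κ * p₀ - 1) - 3 * ν * (d - 2) * (-κ * p₀ - 1) +
      (p₀ * (1 - κ * ρ) - ρ) * (2 * (ν + 1) * (P.derivative.eval ρ / P.eval ρ) +
        (ν - 2) * (𝓑.derivative.eval ρ / 𝓑.eval ρ)))

lemma eval_derivative_div_eval_dehom {G : MvPolynomial (Fin 2) ℂ} {κ : ℂ} (hG : G.IsHomogeneous d)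
    (hl : b + κ * a ≠ 0) :
    (dehom κ G).derivative.eval (a / (b + κ * a)) / (dehom κ G).eval (a / (b + κ * a)) =
      (b + κ * a) * (-κ * eval ![b, a] (pderiv 0 G) + eval ![b, a] (pderiv 1 G)) /
        eval ![b, a] G := by
  have h1 : 1 - κ * (a / (b + κ * a)) = b / (b + κ * a) := by
    field_simp
    ring
  have hb : (b + κ * a) * (b / (b + κ * a)) = b := by field_simp
  have ha : (b + κ * a) * (a / (b + κ * a)) = a := by field_simp
  rw [eval_derivative_dehom, eval_dehom, h1]
  have e0 := eval_mul_pderiv hG (b + κ * a) (b / (b + κ * a)) (a / (b + κ * a)) 0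
  have e1 := eval_mul_pderiv hG (b + κ * a) (b / (b + κ * a)) (a / (b + κ * a)) 1
  have e := eval_mul_of_isHomogeneous hG (b + κ * a) (b / (b + κ * a)) (a / (b + κ * a))
  rw [hb, ha] at e0 e1 e
  rw [mul_add, mul_left_comm, e0, e1, e, mul_left_comm, ← mul_add,
    mul_div_mul_left _ _ (pow_ne_zero _ hl)]

/-- Both sides involve only values and first derivatives at `(b, a)`. For `ν = 1` both vanish. The
constant `c` is the normalization of the affine cofactor, invisible in its logarithmic derivative.
-/
lemma term_eq_polarCoeff {κ : ℂ} (hB : B.IsHomogeneous d)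
    (hab : ![a, b] ≠ 0) (hν1 : 1 ≤ ν) (hν : ν ≤ d) (hP : P.IsHomogeneous (d - ν))
    (h : A + C p₀ * B = lineForm a b ^ ν * P) (hP0 : eval ![b, a] P ≠ 0)
    (hB0 : eval ![b, a] B ≠ 0) (hl : b + κ * a ≠ 0) (c : ℂ) (hc : c ≠ 0) :
    (1 - 1 / (ν : ℂ)) * ((p₀ * b - a) * eval ![b, a] (polyQ A B a b ν) /
        (eval ![b, a] (polyP A B a b ν) * eval ![b, a] B)) =
      6 * polarCoeff d ν κ p₀ (dehom κ B) (Polynomial.C c * dehom κ P) (a / (b + κ * a)) := by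
  rcases hν1.eq_or_lt with rfl | hν2
  · simp [polarCoeff]
  have hl0 : eval ![b, a] (lineForm a b) = 0 := by
    rw [eval_lineForm]
    ring
  have hG : eval ![b, a] (A + C p₀ * B) = 0 := by
    rw [h, map_mul, map_pow, hl0, zero_pow (by omega), zero_mul]
  have hA0 : eval ![b, a] A = -(p₀ * eval ![b, a] B) := by
    simp only [map_add, map_mul, eval_C] at hG
    linear_combination hG
  -- As `ν ≥ 2`, the derivatives of `A + p₀ B` vanish at the fibre point too.
  have hAy : eval ![b, a] (pderiv 1 A) = -(p₀ * eval ![b, a] (pderiv 1 B)) := by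
    have h1 := congrArg (fun F => eval ![b, a] (pderiv 1 F)) h
    simp only [map_add, map_mul, eval_C, pderiv_C, zero_add, pderiv_mul, pderiv_pow, map_pow, hl0,
      zero_pow (show ν ≠ 0 by omega), zero_pow (show ν - 1 ≠ 0 by omega), mul_zero, zero_mul,
      add_zero] at h1
    linear_combination h1
  have hE := euler_eval hB b a
  have hEP := euler_eval hP b a
  rw [Nat.cast_sub hν] at hEP
  have hratio : (Polynomial.C c * dehom κ P).derivative.eval (a / (b + κ * a)) /
      (Polynomial.C c * dehom κ P).eval (a / (b + κ * a)) =
      (b + κ * a) * (-κ * eval ![b, a] (pderiv 0 P) + eval ![b, a] (pderiv 1 P)) /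
        eval ![b, a] P := by
    rw [Polynomial.derivative_C_mul, Polynomial.eval_mul, Polynomial.eval_mul, Polynomial.eval_C,
      mul_div_mul_left _ _ hc, eval_derivative_div_eval_dehom hP hl]
  have hM : p₀ * (1 - κ * (a / (b + κ * a))) - a / (b + κ * a) = (p₀ * b - a) / (b + κ * a) := by
    field_simp
    ring
  rw [polarCoeff, hratio, eval_derivative_div_eval_dehom hB hl, hM, polyQ, polyP_eq hab hG h]
  simp only [Matrix.det_fin_two_of, map_add, map_sub, map_mul, eval_C, pderiv_C_mul, hA0, hAy]
  have hν0 : (ν : ℂ) ≠ 0 := by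
    exact_mod_cast (show ν ≠ 0 by omega)
  generalize eval ![b, a] B = Bv at *
  generalize eval ![b, a] P = Pv at *
  generalize eval ![b, a] (pderiv 0 B) = Bx at *
  generalize eval ![b, a] (pderiv 1 B) = By at *
  generalize eval ![b, a] (pderiv 0 P) = Px at *
  generalize eval ![b, a] (pderiv 1 P) = Py at *
  -- The direction `(1, p₀)` is split into the radial one, where Euler's relation applies, and that
  -- of the chart: `(b + κ a) (1, p₀) = (κ p₀ + 1) (b, a) + (p₀ b - a) (-κ, 1)`.
  have k1 : Bx + p₀ * By = ((κ * p₀ + 1) * d * Bv + (p₀ * b - a) * (-κ * Bx + By)) / (b + κ * a) := by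
    rw [eq_div_iff hl]
    linear_combination (κ * p₀ + 1) * hE
  have k2 : Px + p₀ * Py =
      ((κ * p₀ + 1) * (d - ν) * Pv + (p₀ * b - a) * (-κ * Px + Py)) / (b + κ * a) := by
    rw [eq_div_iff hl]
    linear_combination (κ * p₀ + 1) * hEP
  have hQ : (ν - 2 : ℂ) * (Bx - -(p₀ * By)) * (Bv * Pv) +
      2 * (ν + 1) * (Bv * Px * Bv - -(p₀ * Bv) * (Bv * Py)) =
      Bv * ((ν - 2) * (Bx + p₀ * By) * Pv + 2 * (ν + 1) * Bv * (Px + p₀ * Py)) := by ring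
  rw [hQ, k1, k2]
  clear hQ k1 k2 hratio hM hE hEP hG hA0 hAy
  generalize b + κ * a = l at *
  generalize p₀ * b - a = M at *
  field_simp
  ring

end PolyPQ

/-! ### Fundamental forms of 3-webs that are homogeneous in `q` -/

section ThreeWeb

/-- The `1`-form `(p x - y) dq - q x dp` with `(x, y) = (1 - κ τ, τ)`, `τ = τ(p)`. -/
def liftForm (κ : ℂ) (τ : ℂ → ℂ) : OneForm := fun z =>
  (-z.2 * (1 - κ * τ z.1), z.1 * (1 - κ * τ z.1) - τ z.1)

lemma wedge_liftForm (κ : ℂ) (τ₁ τ₂ : ℂ → ℂ) (z : ℂ × ℂ) :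
    wedge (liftForm κ τ₁ z) (liftForm κ τ₂ z) = z.2 * (τ₂ z.1 - τ₁ z.1) := by
  simp only [wedge, liftForm]
  ring

lemma wedge_smul_left (c : ℂ) (α β : ℂ × ℂ) : wedge (c • α) β = c * wedge α β := by
  simp only [wedge, Prod.smul_fst, Prod.smul_snd, smul_eq_mul]
  ring

lemma wedge_smul_right (c : ℂ) (α β : ℂ × ℂ) : wedge α (c • β) = c * wedge α β := by
  simp only [wedge, Prod.smul_fst, Prod.smul_snd, smul_eq_mul]
  ring

lemma extD_congr {α β : OneForm} {z : ℂ × ℂ} (h : α =ᶠ[nhds z] β) : extD α z = extD β z := by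
  have h₁ : (fun w => (α w).1) =ᶠ[nhds z] fun w => (β w).1 := h.fun_comp Prod.fst
  have h₂ : (fun w => (α w).2) =ᶠ[nhds z] fun w => (β w).2 := h.fun_comp Prod.snd
  rw [extD, extD, h₁.fderiv_eq, h₂.fderiv_eq]

lemma extD_eq_of_hasFDerivAt {α : OneForm} {z : ℂ × ℂ} {D₁ D₂ : ℂ × ℂ →L[ℂ] ℂ}
    (h₁ : HasFDerivAt (fun w => (α w).1) D₁ z) (h₂ : HasFDerivAt (fun w => (α w).2) D₂ z) :
    extD α z = D₂ (1, 0) - D₁ (0, 1) := by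
  rw [extD, h₁.fderiv, h₂.fderiv]

/-- The equations of the fundamental form of a `3`-web at one point. -/
def TripleAt (ω₁ ω₂ ω₃ : OneForm) (θ z : ℂ × ℂ) : Prop :=
  extD (fun w => wedge (ω₂ w) (ω₃ w) • ω₁ w) z = wedge θ (wedge (ω₂ z) (ω₃ z) • ω₁ z) ∧
  extD (fun w => wedge (ω₃ w) (ω₁ w) • ω₂ w) z = wedge θ (wedge (ω₃ z) (ω₁ z) • ω₂ z) ∧
  extD (fun w => wedge (ω₁ w) (ω₂ w) • ω₃ w) z = wedge θ (wedge (ω₁ z) (ω₂ z) • ω₃ z)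

/-- Two of the three equations give the wedge products of `θ` with two independent covectors, and
these determine `θ`. -/
lemma TripleAt.unique {ω₁ ω₂ ω₃ : OneForm} {θ θ' z : ℂ × ℂ} (h : TripleAt ω₁ ω₂ ω₃ θ z)
    (h' : TripleAt ω₁ ω₂ ω₃ θ' z) (h₁₂ : wedge (ω₁ z) (ω₂ z) ≠ 0) (h₂₃ : wedge (ω₂ z) (ω₃ z) ≠ 0)
    (h₃₁ : wedge (ω₃ z) (ω₁ z) ≠ 0) : θ = θ' := by
  have e₁ := h.1.symm.trans h'.1
  have e₂ := h.2.1.symm.trans h'.2.1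
  rw [wedge_smul_right, wedge_smul_right] at e₁ e₂
  have e₁ := mul_left_cancel₀ h₂₃ e₁
  have e₂ := mul_left_cancel₀ h₃₁ e₂
  simp only [wedge] at e₁ e₂ h₁₂
  ext
  · apply mul_right_cancel₀ h₁₂
    linear_combination (ω₁ z).1 * e₂ - (ω₂ z).1 * e₁
  · apply mul_right_cancel₀ h₁₂
    linear_combination (ω₁ z).2 * e₂ - (ω₂ z).2 * e₁

/-- With `g` the product of the three scaling factors, this one computation serves all three
equations of the fundamental form, by cyclic permutation of the branches. -/
lemma extD_smul_liftForm {κ : ℂ} {τ₁ τ₂ τ₃ : ℂ → ℂ} {s₁ s₂ s₃ : ℂ} {z : ℂ × ℂ}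
    (h₁ : HasDerivAt τ₁ s₁ z.1) (h₂ : HasDerivAt τ₂ s₂ z.1) (h₃ : HasDerivAt τ₃ s₃ z.1)
    {g : ℂ × ℂ → ℂ} {g' : ℂ × ℂ →L[ℂ] ℂ} (hg : HasFDerivAt g g' z) :
    extD (fun w => (g w * (w.2 * (τ₃ w.1 - τ₂ w.1))) • liftForm κ τ₁ w) z =
      z.2 * ((τ₃ z.1 - τ₂ z.1) * (g' (1, 0) * (z.1 * (1 - κ * τ₁ z.1) - τ₁ z.1) +
          g' (0, 1) * z.2 * (1 - κ * τ₁ z.1)) +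
        g z * ((s₃ - s₂) * (z.1 * (1 - κ * τ₁ z.1) - τ₁ z.1) +
          (τ₃ z.1 - τ₂ z.1) * (3 * (1 - κ * τ₁ z.1) + s₁ * (-κ * z.1 - 1)))) := by
  have f₁ : HasFDerivAt (fun w : ℂ × ℂ => τ₁ w.1) (s₁ • ContinuousLinearMap.fst ℂ ℂ ℂ) z :=
    h₁.comp_hasFDerivAt z hasFDerivAt_fst
  have f₂ : HasFDerivAt (fun w : ℂ × ℂ => τ₂ w.1) (s₂ • ContinuousLinearMap.fst ℂ ℂ ℂ) z :=
    h₂.comp_hasFDerivAt z hasFDerivAt_fst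
  have f₃ : HasFDerivAt (fun w : ℂ × ℂ => τ₃ w.1) (s₃ • ContinuousLinearMap.fst ℂ ℂ ℂ) z :=
    h₃.comp_hasFDerivAt z hasFDerivAt_fst
  have hp : HasFDerivAt (fun w : ℂ × ℂ => w.1) _ z := hasFDerivAt_fst (𝕜 := ℂ)
  have hq : HasFDerivAt (fun w : ℂ × ℂ => w.2) _ z := hasFDerivAt_snd (𝕜 := ℂ)
  have hk := hg.mul (hq.mul (f₃.sub f₂))
  have hx := (f₁.const_mul κ).const_sub 1
  rw [extD_eq_of_hasFDerivAt (hk.mul (hq.neg.mul hx)) (hk.mul ((hp.mul hx).sub f₁))]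
  simp
  ring

/-- The coefficient of `dq / q` in the fundamental form of the `3`-web given by three
forms `liftForm κ τᵢ`. -/
noncomputable def tripleCoeff (κ p t₁ t₂ t₃ s₁ s₂ s₃ : ℂ) : ℂ :=
  3 - (s₁ * (p * (1 - κ * t₂) - t₂) * (p * (1 - κ * t₃) - t₃) / ((t₁ - t₂) * (t₁ - t₃)) +
    s₂ * (p * (1 - κ * t₁) - t₁) * (p * (1 - κ * t₃) - t₃) / ((t₂ - t₁) * (t₂ - t₃)) +
    s₃ * (p * (1 - κ * t₁) - t₁) * (p * (1 - κ * t₂) - t₂) / ((t₃ - t₁) * (t₃ - t₂)))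

/-- The coefficient of `dp` in the fundamental form of the `3`-web given by three
forms `liftForm κ τᵢ`. -/
noncomputable def tripleCoeffP (κ p t₁ t₂ t₃ s₁ s₂ s₃ : ℂ) : ℂ :=
  -κ * (3 * (1 - κ * t₁) + s₁ * (-κ * p - 1) +
      (p * (1 - κ * t₁) - t₁) * ((s₃ - s₂) / (t₃ - t₂))) +
  (κ * t₁ - 1) * ((3 * (1 - κ * t₁) + s₁ * (-κ * p - 1) +
      (p * (1 - κ * t₁) - t₁) * ((s₃ - s₂) / (t₃ - t₂)) -
    (3 * (1 - κ * t₂) + s₂ * (-κ * p - 1) +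
      (p * (1 - κ * t₂) - t₂) * ((s₁ - s₃) / (t₁ - t₃)))) / (t₁ - t₂))

section
variable {κ p t₁ t₂ t₃ s₁ s₂ s₃ : ℂ}

/-- This is the first equation of the fundamental form for unscaled forms, divided by `q`, with `θ =
tripleCoeffP dp + tripleCoeff dq / q`. -/
lemma tripleCoeff_eq₁ (h₁₂ : t₁ ≠ t₂) (h₂₃ : t₂ ≠ t₃) (h₃₁ : t₃ ≠ t₁) :
    (t₃ - t₂) * (tripleCoeffP κ p t₁ t₂ t₃ s₁ s₂ s₃ * (p * (1 - κ * t₁) - t₁) +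
      tripleCoeff κ p t₁ t₂ t₃ s₁ s₂ s₃ * (1 - κ * t₁)) =
    (s₃ - s₂) * (p * (1 - κ * t₁) - t₁) +
      (t₃ - t₂) * (3 * (1 - κ * t₁) + s₁ * (-κ * p - 1)) := by
  have h₁ := sub_ne_zero.2 h₁₂
  have h₂ := sub_ne_zero.2 h₂₃
  have h₃ := sub_ne_zero.2 h₃₁
  have h₁' := sub_ne_zero.2 h₁₂.symm
  have h₂' := sub_ne_zero.2 h₂₃.symm
  have h₃' := sub_ne_zero.2 h₃₁.symm
  unfold tripleCoeff tripleCoeffP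
  rw [show t₂ - t₁ = -(t₁ - t₂) by ring, show t₃ - t₂ = -(t₂ - t₃) by ring,
    show t₁ - t₃ = -(t₃ - t₁) by ring]
  field_simp
  ring

lemma tripleCoeff_eq₂ (h₁₂ : t₁ ≠ t₂) (h₂₃ : t₂ ≠ t₃) (h₃₁ : t₃ ≠ t₁) :
    (t₁ - t₃) * (tripleCoeffP κ p t₁ t₂ t₃ s₁ s₂ s₃ * (p * (1 - κ * t₂) - t₂) +
      tripleCoeff κ p t₁ t₂ t₃ s₁ s₂ s₃ * (1 - κ * t₂)) =
    (s₁ - s₃) * (p * (1 - κ * t₂) - t₂) +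
      (t₁ - t₃) * (3 * (1 - κ * t₂) + s₂ * (-κ * p - 1)) := by
  have h₁ := sub_ne_zero.2 h₁₂
  have h₂ := sub_ne_zero.2 h₂₃
  have h₃ := sub_ne_zero.2 h₃₁
  unfold tripleCoeff tripleCoeffP
  rw [show t₂ - t₁ = -(t₁ - t₂) by ring, show t₃ - t₂ = -(t₂ - t₃) by ring,
    show t₁ - t₃ = -(t₃ - t₁) by ring]
  field_simp
  ring

/-- The forms `δ₂₃ ω₁`, `δ₃₁ ω₂`, `δ₁₂ ω₃` add up to zero, so the third equation follows from the
other two. -/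
lemma tripleCoeff_eq₃ (h₁₂ : t₁ ≠ t₂) (h₂₃ : t₂ ≠ t₃) (h₃₁ : t₃ ≠ t₁) :
    (t₂ - t₁) * (tripleCoeffP κ p t₁ t₂ t₃ s₁ s₂ s₃ * (p * (1 - κ * t₃) - t₃) +
      tripleCoeff κ p t₁ t₂ t₃ s₁ s₂ s₃ * (1 - κ * t₃)) =
    (s₂ - s₁) * (p * (1 - κ * t₃) - t₃) +
      (t₂ - t₁) * (3 * (1 - κ * t₃) + s₃ * (-κ * p - 1)) := by
  have e₁ := tripleCoeff_eq₁ (κ := κ) (p := p) (s₁ := s₁) (s₂ := s₂) (s₃ := s₃) h₁₂ h₂₃ h₃₁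
  have e₂ := tripleCoeff_eq₂ (κ := κ) (p := p) (s₁ := s₁) (s₂ := s₂) (s₃ := s₃) h₁₂ h₂₃ h₃₁
  linear_combination -e₁ - e₂
end

/-- The fundamental form of the `3`-web given by forms proportional to three forms
`liftForm κ τᵢ`. -/
lemma tripleAt_liftForm {κ : ℂ} {τ₁ τ₂ τ₃ : ℂ → ℂ} {s₁ s₂ s₃ : ℂ} {z : ℂ × ℂ}
    (h₁ : HasDerivAt τ₁ s₁ z.1) (h₂ : HasDerivAt τ₂ s₂ z.1) (h₃ : HasDerivAt τ₃ s₃ z.1)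
    (h₁₂ : τ₁ z.1 ≠ τ₂ z.1) (h₂₃ : τ₂ z.1 ≠ τ₃ z.1) (h₃₁ : τ₃ z.1 ≠ τ₁ z.1) (hz : z.2 ≠ 0)
    {f₁ f₂ f₃ : ℂ × ℂ → ℂ} {ω₁ ω₂ ω₃ : OneForm}
    (hf₁ : DifferentiableAt ℂ f₁ z) (hf₂ : DifferentiableAt ℂ f₂ z)
    (hf₃ : DifferentiableAt ℂ f₃ z) (n₁ : f₁ z ≠ 0) (n₂ : f₂ z ≠ 0) (n₃ : f₃ z ≠ 0)
    (e₁ : ∀ᶠ w in nhds z, ω₁ w = f₁ w • liftForm κ τ₁ w)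
    (e₂ : ∀ᶠ w in nhds z, ω₂ w = f₂ w • liftForm κ τ₂ w)
    (e₃ : ∀ᶠ w in nhds z, ω₃ w = f₃ w • liftForm κ τ₃ w) :
    TripleAt ω₁ ω₂ ω₃
      (tripleCoeffP κ z.1 (τ₁ z.1) (τ₂ z.1) (τ₃ z.1) s₁ s₂ s₃ +
        (fderiv ℂ f₁ z (1, 0) / f₁ z + fderiv ℂ f₂ z (1, 0) / f₂ z + fderiv ℂ f₃ z (1, 0) / f₃ z),
       tripleCoeff κ z.1 (τ₁ z.1) (τ₂ z.1) (τ₃ z.1) s₁ s₂ s₃ / z.2 +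
        (fderiv ℂ f₁ z (0, 1) / f₁ z + fderiv ℂ f₂ z (0, 1) / f₂ z + fderiv ℂ f₃ z (0, 1) / f₃ z))
      z := by
  -- All three forms `δ_jk ω_i` acquire the same factor `f₁ f₂ f₃`, so `θ` only gains its
  -- logarithmic differential.
  have hg := (hf₁.hasFDerivAt.mul hf₂.hasFDerivAt).mul hf₃.hasFDerivAt
  refine ⟨?_, ?_, ?_⟩
  · have he : (fun w => wedge (ω₂ w) (ω₃ w) • ω₁ w) =ᶠ[nhds z] fun w =>
        ((f₁ * f₂ * f₃) w * (w.2 * (τ₃ w.1 - τ₂ w.1))) • liftForm κ τ₁ w := by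
      filter_upwards [e₁, e₂, e₃] with w w₁ w₂ w₃
      rw [w₁, w₂, w₃, wedge_smul_left, wedge_smul_right, wedge_liftForm, smul_smul]
      simp only [Pi.mul_apply]
      congr 1
      ring
    rw [show wedge (ω₂ z) (ω₃ z) • ω₁ z = _ from he.self_of_nhds, extD_congr he,
      extD_smul_liftForm h₁ h₂ h₃ hg]
    have key := tripleCoeff_eq₁ (κ := κ) (p := z.1) (s₁ := s₁) (s₂ := s₂) (s₃ := s₃) h₁₂ h₂₃ h₃₁
    simp only [wedge, liftForm, Pi.mul_apply, Prod.smul_fst, Prod.smul_snd, smul_eq_mul,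
      add_apply, smul_apply]
    field_simp
    linear_combination (-f₁ z * f₂ z * f₃ z) * key
  · have he : (fun w => wedge (ω₃ w) (ω₁ w) • ω₂ w) =ᶠ[nhds z] fun w =>
        ((f₁ * f₂ * f₃) w * (w.2 * (τ₁ w.1 - τ₃ w.1))) • liftForm κ τ₂ w := by
      filter_upwards [e₁, e₂, e₃] with w w₁ w₂ w₃
      rw [w₁, w₂, w₃, wedge_smul_left, wedge_smul_right, wedge_liftForm, smul_smul]
      simp only [Pi.mul_apply]
      congr 1
      ring
    rw [show wedge (ω₃ z) (ω₁ z) • ω₂ z = _ from he.self_of_nhds, extD_congr he,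
      extD_smul_liftForm h₂ h₃ h₁ hg]
    have key := tripleCoeff_eq₂ (κ := κ) (p := z.1) (s₁ := s₁) (s₂ := s₂) (s₃ := s₃) h₁₂ h₂₃ h₃₁
    simp only [wedge, liftForm, Pi.mul_apply, Prod.smul_fst, Prod.smul_snd, smul_eq_mul,
      add_apply, smul_apply]
    field_simp
    linear_combination (-f₁ z * f₂ z * f₃ z) * key
  · have he : (fun w => wedge (ω₁ w) (ω₂ w) • ω₃ w) =ᶠ[nhds z] fun w =>
        ((f₁ * f₂ * f₃) w * (w.2 * (τ₂ w.1 - τ₁ w.1))) • liftForm κ τ₃ w := by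
      filter_upwards [e₁, e₂, e₃] with w w₁ w₂ w₃
      rw [w₁, w₂, w₃, wedge_smul_left, wedge_smul_right, wedge_liftForm, smul_smul]
      simp only [Pi.mul_apply]
      congr 1
      ring
    rw [show wedge (ω₁ z) (ω₂ z) • ω₃ z = _ from he.self_of_nhds, extD_congr he,
      extD_smul_liftForm h₃ h₁ h₂ hg]
    have key := tripleCoeff_eq₃ (κ := κ) (p := z.1) (s₁ := s₁) (s₂ := s₂) (s₃ := s₃) h₁₂ h₂₃ h₃₁
    simp only [wedge, liftForm, Pi.mul_apply, Prod.smul_fst, Prod.smul_snd, smul_eq_mul,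
      add_apply, smul_apply]
    field_simp
    linear_combination (-f₁ z * f₂ z * f₃ z) * key

end ThreeWeb

/-! ### Sums over triples of indices -/

section TripleSums

variable {d : ℕ}

/-- The sum over all triples of pairwise distinct indices. -/
noncomputable def distinctSum (S : Fin d → Fin d → Fin d → ℂ) : ℂ :=
  ∑ r, ∑ s ∈ Finset.univ.erase r, ∑ t ∈ (Finset.univ.erase r).erase s, S r s t

lemma distinctSum_eq_ite (S : Fin d → Fin d → Fin d → ℂ) :
    distinctSum S = ∑ r, ∑ s, ∑ t, if s ≠ r ∧ t ≠ s ∧ t ≠ r then S r s t else 0 := by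
  refine Finset.sum_congr rfl fun r _ => ?_
  rw [← Finset.filter_ne' Finset.univ r, Finset.sum_filter]
  refine Finset.sum_congr rfl fun s _ => ?_
  split_ifs with h
  · rw [← Finset.filter_ne' _ s, Finset.filter_filter, Finset.sum_filter]
    refine Finset.sum_congr rfl fun t _ => ?_
    simp [h, and_comm]
  · simp [h]

lemma distinctSum_congr {S T : Fin d → Fin d → Fin d → ℂ}
    (h : ∀ r s t, s ≠ r → t ≠ s → t ≠ r → S r s t = T r s t) : distinctSum S = distinctSum T := by
  rw [distinctSum_eq_ite, distinctSum_eq_ite]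
  refine Finset.sum_congr rfl fun r _ => Finset.sum_congr rfl fun s _ =>
    Finset.sum_congr rfl fun t _ => ?_
  split_ifs with hd
  · exact h r s t hd.1 hd.2.1 hd.2.2
  · rfl

lemma distinctSum_add (S T : Fin d → Fin d → Fin d → ℂ) :
    distinctSum (fun r s t => S r s t + T r s t) = distinctSum S + distinctSum T := by
  simp only [distinctSum, Finset.sum_add_distrib]

lemma distinctSum_rotate (S : Fin d → Fin d → Fin d → ℂ) :
    distinctSum (fun r s t => S s t r) = distinctSum S := by
  rw [distinctSum_eq_ite, distinctSum_eq_ite, Finset.sum_comm]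
  refine Finset.sum_congr rfl fun s _ => ?_
  rw [Finset.sum_comm]
  refine Finset.sum_congr rfl fun t _ => Finset.sum_congr rfl fun r _ => ?_
  refine if_congr ?_ rfl rfl
  constructor
  · rintro ⟨h1, h2, h3⟩
    exact ⟨h2, h3.symm, h1.symm⟩
  · rintro ⟨h1, h2, h3⟩
    exact ⟨h3.symm, h1, h2.symm⟩

lemma distinctSum_perm (σ : Equiv.Perm (Fin d)) (S : Fin d → Fin d → Fin d → ℂ) :
    distinctSum (fun r s t => S (σ r) (σ s) (σ t)) = distinctSum S := by
  rw [distinctSum_eq_ite, distinctSum_eq_ite,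
    ← Equiv.sum_comp σ fun r => ∑ s, ∑ t, if s ≠ r ∧ t ≠ s ∧ t ≠ r then S r s t else 0]
  refine Finset.sum_congr rfl fun r _ => ?_
  rw [← Equiv.sum_comp σ fun s => ∑ t, if s ≠ σ r ∧ t ≠ s ∧ t ≠ σ r then S (σ r) s t else 0]
  refine Finset.sum_congr rfl fun s _ => ?_
  rw [← Equiv.sum_comp σ fun t => if σ s ≠ σ r ∧ t ≠ σ s ∧ t ≠ σ r then S (σ r) (σ s) t else 0]
  refine Finset.sum_congr rfl fun t _ => ?_
  simp only [ne_eq, EmbeddingLike.apply_eq_iff_eq]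

lemma distinctSum_fst (hd : 2 ≤ d) (φ : Fin d → ℂ) :
    distinctSum (fun r _ _ => φ r) = (d - 1) * (d - 2) * ∑ r, φ r := by
  rw [distinctSum, Finset.mul_sum]
  refine Finset.sum_congr rfl fun r _ => ?_
  have : ∀ s ∈ Finset.univ.erase r, ∑ t ∈ (Finset.univ.erase r).erase s, φ r = (d - 2) * φ r := by
    intro s hs
    rw [Finset.sum_const, Finset.card_erase_of_mem hs, Finset.card_erase_of_mem (Finset.mem_univ _),
      Finset.card_univ, Fintype.card_fin, nsmul_eq_mul, Nat.sub_sub, Nat.cast_sub hd]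
    norm_num
  rw [Finset.sum_congr rfl this, Finset.sum_const, Finset.card_erase_of_mem (Finset.mem_univ _),
      Finset.card_univ, Fintype.card_fin, nsmul_eq_mul, Nat.cast_sub (by omega)]
  push_cast
  ring

lemma sum_Ioi_eq_ite (S : Fin d → Fin d → Fin d → ℂ) :
    ∑ r, ∑ s ∈ Finset.Ioi r, ∑ t ∈ Finset.Ioi s, S r s t =
      ∑ r, ∑ s, ∑ t, if r < s ∧ s < t then S r s t else 0 := by
  refine Finset.sum_congr rfl fun r _ => ?_
  rw [← Finset.filter_lt_eq_Ioi, Finset.sum_filter]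
  refine Finset.sum_congr rfl fun s _ => ?_
  split_ifs with h
  · rw [← Finset.filter_lt_eq_Ioi, Finset.sum_filter]
    simp [h]
  · simp [h]

/-- The two symmetries generate all permutations of the arguments, and a triple of distinct indices
has exactly one of six orders. -/
lemma six_mul_sum_Ioi {S : Fin d → Fin d → Fin d → ℂ} (h₁ : ∀ r s t, S r s t = S s t r)
    (h₂ : ∀ r s t, S r s t = S s r t) :
    6 * ∑ r, ∑ s ∈ Finset.Ioi r, ∑ t ∈ Finset.Ioi s, S r s t = distinctSum S := by
  rw [sum_Ioi_eq_ite, distinctSum_eq_ite]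
  set T : Fin d → Fin d → Fin d → ℂ := fun r s t => if r < s ∧ s < t then S r s t else 0 with hT
  have hpt : ∀ r s t, (if s ≠ r ∧ t ≠ s ∧ t ≠ r then S r s t else 0) =
      T r s t + T s t r + T t r s + T s r t + T r t s + T t s r := by
    intro r s t
    have a1 : S s t r = S r s t := (h₁ r s t).symm
    have a2 : S t r s = S r s t := (h₁ t r s)
    have a3 : S s r t = S r s t := (h₂ r s t).symm
    have a4 : S r t s = S r s t := by rw [← a3, h₁ s r t]
    have a5 : S t s r = S r s t := by rw [← a3, ← h₁ t s r]
    simp only [hT, a1, a2, a3, a4, a5]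
    generalize S r s t = x
    rcases lt_trichotomy r s with h | h | h <;> rcases lt_trichotomy s t with h' | h' | h' <;>
      rcases lt_trichotomy r t with h'' | h'' | h'' <;> grind
  simp only [hpt, Finset.sum_add_distrib]
  have c3 (U : Fin d → Fin d → Fin d → ℂ) :
      ∑ r, ∑ s, ∑ t, U s r t = ∑ r, ∑ s, ∑ t, U r s t := Finset.sum_comm
  have c4 (U : Fin d → Fin d → Fin d → ℂ) :
      ∑ r, ∑ s, ∑ t, U r t s = ∑ r, ∑ s, ∑ t, U r s t :=
    Finset.sum_congr rfl fun r _ => Finset.sum_comm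
  have c1 : ∑ r, ∑ s, ∑ t, T s t r = ∑ r, ∑ s, ∑ t, T r s t :=
    (c3 fun r s t => T r t s).trans (c4 T)
  have c2 : ∑ r, ∑ s, ∑ t, T t r s = ∑ r, ∑ s, ∑ t, T r s t :=
    (c4 fun r s t => T s r t).trans (c3 T)
  have c5 : ∑ r, ∑ s, ∑ t, T t s r = ∑ r, ∑ s, ∑ t, T r s t :=
    ((c3 fun r s t => T t r s)).trans c2
  rw [c1, c2, c3 T, c4 T, c5]
  ring

end TripleSums

/-! ### The curvature in terms of the branches -/

/-- The functions `τ i` are, over the open set `V`, the branches of the roots of the polynomial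
`𝓐 + p 𝓑`, which are simple. -/
structure IsBranches (d : ℕ) (𝓐 𝓑 : Polynomial ℂ) (V : Set ℂ) (τ : Fin d → ℂ → ℂ) : Prop where
  isOpen : IsOpen V
  differentiableOn : ∀ i, DifferentiableOn ℂ (τ i) V
  injective : ∀ p ∈ V, Function.Injective fun i => τ i p
  lead_ne : ∀ p ∈ V, 𝓐.coeff d + p * 𝓑.coeff d ≠ 0
  factor : ∀ p ∈ V, 𝓐 + Polynomial.C p * 𝓑 = Polynomial.C (𝓐.coeff d + p * 𝓑.coeff d) *
    ∏ i, (Polynomial.X - Polynomial.C (τ i p))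

lemma IsBranches.perm {d : ℕ} {𝓐 𝓑 : Polynomial ℂ} {V : Set ℂ} {τ : Fin d → ℂ → ℂ}
    (h : IsBranches d 𝓐 𝓑 V τ) (σ : Equiv.Perm (Fin d)) :
    IsBranches d 𝓐 𝓑 V fun i => τ (σ i) where
  isOpen := h.isOpen
  differentiableOn i := h.differentiableOn _
  injective p hp := (h.injective p hp).comp σ.injective
  lead_ne := h.lead_ne
  factor p hp := by
    rw [h.factor p hp, Equiv.prod_comp σ fun i => Polynomial.X - Polynomial.C (τ i p)]

/-- The coefficient of `dq / q` in the fundamental form, in terms of the branches. -/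
noncomputable def branchSum {d : ℕ} (κ : ℂ) (τ : Fin d → ℂ → ℂ) (p : ℂ) : ℂ :=
  distinctSum (fun r s t => tripleCoeff κ p (τ r p) (τ s p) (τ t p) (deriv (τ r) p)
    (deriv (τ s) p) (deriv (τ t) p)) / 6

/-- Branches and forms of a decomposition come without a common numbering; the symmetric sum does
not see it. -/
lemma branchSum_perm {d : ℕ} (κ : ℂ) (τ : Fin d → ℂ → ℂ) (σ : Equiv.Perm (Fin d)) :
    (branchSum κ fun i => τ (σ i)) = branchSum κ τ := by
  funext p
  exact congrArg (· / 6) (distinctSum_perm σ fun r s t => tripleCoeff κ p (τ r p) (τ s p) (τ t p)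
    (deriv (τ r) p) (deriv (τ s) p) (deriv (τ t) p))

lemma branchSum_eq_sum_Ioi {d : ℕ} (κ : ℂ) (τ : Fin d → ℂ → ℂ) (p : ℂ) :
    branchSum κ τ p = ∑ r, ∑ s ∈ Finset.Ioi r, ∑ t ∈ Finset.Ioi s,
      tripleCoeff κ p (τ r p) (τ s p) (τ t p) (deriv (τ r) p) (deriv (τ s) p)
        (deriv (τ t) p) := by
  unfold branchSum
  rw [← six_mul_sum_Ioi]
  · ring
  · intro r s t
    unfold tripleCoeff
    ring
  · intro r s t
    unfold tripleCoeff
    ring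

/-- Each index belongs to `(d - 1) (d - 2) / 2` of the increasing triples. -/
lemma sum_Ioi_add_add {d : ℕ} (hd : 2 ≤ d) (φ : Fin d → ℂ) :
    ∑ r, ∑ s ∈ Finset.Ioi r, ∑ t ∈ Finset.Ioi s, (φ r + φ s + φ t) =
      (d - 1) * (d - 2) / 2 * ∑ r, φ r := by
  have h := six_mul_sum_Ioi (S := fun r s t => φ r + φ s + φ t) (fun _ _ _ => by ring)
    (fun _ _ _ => by ring)
  have h1 := distinctSum_rotate fun r _ _ : Fin d => φ r
  have h2 := distinctSum_rotate fun _ _ r : Fin d => φ r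
  rw [distinctSum_add, distinctSum_add, h1, ← h2, distinctSum_fst hd] at h
  linear_combination h / 6

lemma IsBranches.differentiableAt {d : ℕ} {𝓐 𝓑 : Polynomial ℂ} {V : Set ℂ} {τ : Fin d → ℂ → ℂ}
    (h : IsBranches d 𝓐 𝓑 V τ) {p : ℂ} (hp : p ∈ V) (i : Fin d) : DifferentiableAt ℂ (τ i) p :=
  (h.differentiableOn i).differentiableAt (h.isOpen.mem_nhds hp)

lemma IsBranches.differentiableAt_branchSum {d : ℕ} {𝓐 𝓑 : Polynomial ℂ} {V : Set ℂ}
    {τ : Fin d → ℂ → ℂ} (h : IsBranches d 𝓐 𝓑 V τ) (κ : ℂ) {p : ℂ} (hp : p ∈ V) :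
    DifferentiableAt ℂ (branchSum κ τ) p := by
  have ht i := h.differentiableAt hp i
  have hs i : DifferentiableAt ℂ (deriv (τ i)) p :=
    ((h.differentiableOn i).deriv h.isOpen).differentiableAt (h.isOpen.mem_nhds hp)
  have hne {i j} (hij : i ≠ j) : τ i p - τ j p ≠ 0 :=
    sub_ne_zero.2 fun e => hij (h.injective p hp e)
  have he : branchSum κ τ = fun p => ∑ r, ∑ s ∈ Finset.Ioi r, ∑ t ∈ Finset.Ioi s,
      tripleCoeff κ p (τ r p) (τ s p) (τ t p) (deriv (τ r) p) (deriv (τ s) p)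
        (deriv (τ t) p) := funext fun p => branchSum_eq_sum_Ioi κ τ p
  rw [he]
  refine DifferentiableAt.fun_sum fun r _ => DifferentiableAt.fun_sum fun s hs' =>
    DifferentiableAt.fun_sum fun t ht' => ?_
  rw [Finset.mem_Ioi] at hs' ht'
  have n1 := hne hs'.ne
  have n2 := hne ht'.ne
  have n3 := hne (hs'.trans ht').ne
  have n4 := hne hs'.ne'
  have n5 := hne ht'.ne'
  have n6 := hne (hs'.trans ht').ne'
  have hx i : DifferentiableAt ℂ (fun p => p * (1 - κ * τ i p) - τ i p) p :=
    (differentiableAt_id.mul ((ht i).const_mul κ |>.const_sub 1)).sub (ht i)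
  unfold tripleCoeff
  refine DifferentiableAt.const_sub (DifferentiableAt.add (DifferentiableAt.add ?_ ?_) ?_) 3
  · exact (((hs r).mul (hx s)).mul (hx t)).div (((ht r).sub (ht s)).mul ((ht r).sub (ht t)))
      (mul_ne_zero n1 n3)
  · exact (((hs s).mul (hx r)).mul (hx t)).div (((ht s).sub (ht r)).mul ((ht s).sub (ht t)))
      (mul_ne_zero n4 n2)
  · exact (((hs t).mul (hx r)).mul (hx s)).div (((ht t).sub (ht r)).mul ((ht t).sub (ht s)))
      (mul_ne_zero n6 n5)

/-- The default value of `fderiv` is also the right one here, so no regularity of the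
`dp`-coefficient of the fundamental form is ever needed. -/
lemma fderiv_comp_fst_vertical (F : ℂ → ℂ) (z : ℂ × ℂ) :
    fderiv ℂ (fun w : ℂ × ℂ => F w.1) z (0, 1) = 0 := by
  by_cases h : DifferentiableAt ℂ (fun w : ℂ × ℂ => F w.1) z
  · have h1 := h.hasFDerivAt.hasLineDerivAt (0, 1)
    have h2 : HasLineDerivAt ℂ (fun w : ℂ × ℂ => F w.1) 0 z (0, 1) := by
      unfold HasLineDerivAt
      simpa using hasDerivAt_const (0 : ℂ) (F z.1)
    exact HasDerivAt.unique h1 h2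
  · rw [fderiv_zero_of_not_differentiableAt h]
    rfl

lemma extD_eq_of_eventuallyEq {η : OneForm} {z : ℂ × ℂ} {F H : ℂ → ℂ}
    (hH : DifferentiableAt ℂ H z.1) (hz : z.2 ≠ 0)
    (h : ∀ᶠ w in nhds z, η w = (F w.1, H w.1 / w.2)) : extD η z = deriv H z.1 / z.2 := by
  rw [extD_congr (β := fun w => (F w.1, H w.1 / w.2)) h]
  have h1 : HasFDerivAt (fun w : ℂ × ℂ => H w.1)
      (deriv H z.1 • ContinuousLinearMap.fst ℂ ℂ ℂ) z :=
    hH.hasDerivAt.comp_hasFDerivAt z hasFDerivAt_fst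
  have h2 : HasFDerivAt (fun w : ℂ × ℂ => w.2⁻¹)
      ((-(z.2 ^ 2)⁻¹) • ContinuousLinearMap.snd ℂ ℂ ℂ) z :=
    (hasDerivAt_inv hz).comp_hasFDerivAt z hasFDerivAt_snd
  have h3 : HasFDerivAt (fun w : ℂ × ℂ => H w.1 * w.2⁻¹) _ z := h1.mul h2
  unfold extD
  rw [fderiv_comp_fst_vertical]
  simp only [div_eq_mul_inv]
  rw [h3.fderiv]
  simp [mul_comm]

section Curvature

variable {A B : MvPolynomial (Fin 2) ℂ} {d : ℕ} {κ : ℂ} {V : Set ℂ} {τ : Fin d → ℂ → ℂ}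

/-- The factor `(1 - κ τ) y - τ x` of `A + p B`, taken at `x = dq`, `y = p dq - q dp`, is `liftForm
κ τ`. -/
lemma legForm_eq_prod (hA : A.IsHomogeneous d) (hB : B.IsHomogeneous d)
    (hτ : IsBranches d (dehom κ A) (dehom κ B) V τ) {z : ℂ × ℂ} (hz : z.1 ∈ V) (v : ℂ × ℂ) :
    legForm A B z v = ((dehom κ A).coeff d + z.1 * (dehom κ B).coeff d) *
      ∏ i, pairing (liftForm κ (τ i) z) v := by
  have h := eval_eq_mul_prod (κ := κ) (τ := fun i => τ i z.1) (hA.add (hB.C_mul z.1))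
    (c := (dehom κ A).coeff d + z.1 * (dehom κ B).coeff d)
    (by rw [dehom_add, dehom_mul, dehom_C, hτ.factor _ hz]) v.2 (z.1 * v.2 - z.2 * v.1)
  rw [map_add, map_mul, eval_C] at h
  rw [legForm, h]
  congr 1
  refine Finset.prod_congr rfl fun i _ => ?_
  simp only [pairing, liftForm]
  ring

/-- On this tangent vector `x = -κ` and `y = 1`, so every `liftForm κ τ` takes the value `1`.
Pairing with it therefore reads off the scaling factor of a form proportional to a branch. -/
lemma legForm_transversal (hA : A.IsHomogeneous d) (hB : B.IsHomogeneous d) {z : ℂ × ℂ}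
    (hz : z.2 ≠ 0) : legForm A B z ((-κ * z.1 - 1) / z.2, -κ) =
      (dehom κ A).coeff d + z.1 * (dehom κ B).coeff d := by
  rw [coeff_dehom hA, coeff_dehom hB, legForm]
  have : z.1 * -κ - z.2 * ((-κ * z.1 - 1) / z.2) = 1 := by
    field_simp
    ring
  simp only [this]

lemma eq_smul_liftForm {z α : ℂ × ℂ} (hz : z.2 ≠ 0) {f : ℂ → ℂ}
    (h : wedge (liftForm κ f z) α = 0) :
    α = pairing α ((-κ * z.1 - 1) / z.2, -κ) • liftForm κ f z := by
  simp only [wedge, liftForm] at h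
  ext
  · simp only [pairing, liftForm, Prod.smul_fst, smul_eq_mul]
    field_simp
    linear_combination κ * h
  · simp only [pairing, liftForm, Prod.smul_snd, smul_eq_mul]
    field_simp
    linear_combination (-κ * z.1 - 1) * h

lemma continuousAt_liftForm {f : ℂ → ℂ} {z : ℂ × ℂ} (h : ContinuousAt f z.1) :
    ContinuousAt (liftForm κ f) z := by
  have h' : ContinuousAt (fun w : ℂ × ℂ => f w.1) z := ContinuousAt.comp (f := Prod.fst) h
    continuousAt_fst
  unfold liftForm
  fun_prop

lemma analyticOnNhd_liftForm {f : ℂ → ℂ} {U : Set (ℂ × ℂ)} (hV : IsOpen V)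
    (hf : DifferentiableOn ℂ f V) (hU : ∀ z ∈ U, z.1 ∈ V) :
    AnalyticOnNhd ℂ (liftForm κ f) U := by
  intro z hz
  have h : AnalyticAt ℂ (fun w : ℂ × ℂ => f w.1) z :=
    AnalyticAt.comp (f := Prod.fst) (hf.analyticAt (hV.mem_nhds (hU z hz))) analyticAt_fst
  exact (analyticAt_snd.neg.mul (analyticAt_const.sub (analyticAt_const.mul h))).prod
    ((analyticAt_fst.mul (analyticAt_const.sub (analyticAt_const.mul h))).sub h)

/-- The symmetric form vanishes on the kernel of `ω i`, hence so does one of its linear factors. -/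
lemma IsDecomposition.exists_wedge_eq_zero {U : Set (ℂ × ℂ)} {ω : Fin d → OneForm}
    (hA : A.IsHomogeneous d) (hB : B.IsHomogeneous d)
    (hτ : IsBranches d (dehom κ A) (dehom κ B) V τ)
    (hω : IsDecomposition d (legForm A B) U ω) {z : ℂ × ℂ} (hzU : z ∈ U) (hzV : z.1 ∈ V)
    (i : Fin d) : ∃ j, wedge (liftForm κ (τ j) z) (ω i z) = 0 := by
  have h := legForm_eq_prod hA hB hτ hzV ((ω i z).2, -(ω i z).1)
  rw [hω.factor z hzU, Finset.prod_eq_zero (Finset.mem_univ i) (by simp only [pairing]; ring)] at h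
  have h := (mul_eq_zero.1 h.symm).resolve_left (hτ.lead_ne _ hzV)
  obtain ⟨j, -, hj⟩ := Finset.prod_eq_zero_iff.1 h
  refine ⟨j, ?_⟩
  simp only [pairing, wedge] at hj ⊢
  linear_combination hj

lemma IsBranches.wedge_ne_zero (hτ : IsBranches d (dehom κ A) (dehom κ B) V τ) {z : ℂ × ℂ}
    (hz : z.2 ≠ 0) (hzV : z.1 ∈ V) {i j : Fin d} (hij : i ≠ j) :
    wedge (liftForm κ (τ i) z) (liftForm κ (τ j) z) ≠ 0 := by
  rw [wedge_liftForm]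
  exact mul_ne_zero hz (sub_ne_zero.2 fun e => hij (hτ.injective _ hzV e.symm))

lemma wedge_smul_smul_self (a b : ℂ) (α : ℂ × ℂ) : wedge (a • α) (b • α) = 0 := by
  simp only [wedge, Prod.smul_fst, Prod.smul_snd, smul_eq_mul]
  ring

/-- Near a point, the forms of a decomposition are proportional to the forms of the branches. -/
lemma IsDecomposition.eventually_eq_smul {U : Set (ℂ × ℂ)} {ω : Fin d → OneForm} (hd : 3 ≤ d)
    (hA : A.IsHomogeneous d) (hB : B.IsHomogeneous d)
    (hτ : IsBranches d (dehom κ A) (dehom κ B) V τ) (hU : IsOpen U)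
    (hω : IsDecomposition d (legForm A B) U ω) {z : ℂ × ℂ} (hzU : z ∈ U) (hzV : z.1 ∈ V)
    (hz : z.2 ≠ 0) (hm : ∀ i, wedge (liftForm κ (τ i) z) (ω i z) = 0) :
    ∀ᶠ w in nhds z, w ∈ U ∧ w.1 ∈ V ∧ w.2 ≠ 0 ∧ ∀ i,
      pairing (ω i w) ((-κ * w.1 - 1) / w.2, -κ) ≠ 0 ∧
      ω i w = pairing (ω i w) ((-κ * w.1 - 1) / w.2, -κ) • liftForm κ (τ i) w := by
  have h1 : ∀ᶠ w in nhds z, w ∈ U := hU.mem_nhds hzU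
  have h2 : ∀ᶠ w : ℂ × ℂ in nhds z, w.1 ∈ V :=
    continuousAt_fst.eventually (hτ.isOpen.mem_nhds hzV)
  have h3 : ∀ᶠ w : ℂ × ℂ in nhds z, w.2 ≠ 0 := continuousAt_snd.eventually_ne hz
  have hne {w : ℂ × ℂ} (hw : w ∈ U) (i : Fin d) : ω i w ≠ 0 := by
    intro h0
    have : Nontrivial (Fin d) := Fin.nontrivial_iff_two_le.2 (by omega)
    obtain ⟨j, hj⟩ := exists_ne i
    apply hω.transverse w hw i j hj.symm
    rw [h0]
    simp [wedge]
  -- Transversality to the wrong branches is an open condition, so the matching of forms with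
  -- branches at `z` persists nearby.
  have h4 : ∀ᶠ w in nhds z, ∀ i j, j ≠ i → wedge (liftForm κ (τ j) w) (ω i w) ≠ 0 := by
    refine Filter.eventually_all.2 fun i => Filter.eventually_all.2 fun j => ?_
    by_cases hij : j = i
    · exact Filter.Eventually.of_forall fun w h => absurd hij h
    have hc : ContinuousAt (fun w => wedge (liftForm κ (τ j) w) (ω i w)) z := by
      have c1 := continuousAt_liftForm (κ := κ) (hτ.differentiableAt hzV j).continuousAt
      have c2 := (hω.analytic i z hzU).continuousAt
      unfold wedge
      exact (c1.fst.mul c2.snd).sub (c1.snd.mul c2.fst)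
    have h0 : wedge (liftForm κ (τ j) z) (ω i z) ≠ 0 := by
      rw [eq_smul_liftForm hz (hm i), wedge_smul_right]
      refine mul_ne_zero (fun h => hne hzU i ?_) (hτ.wedge_ne_zero hz hzV hij)
      rw [eq_smul_liftForm hz (hm i), h, zero_smul]
    filter_upwards [hc.eventually_ne h0] with w hw _
    exact hw
  filter_upwards [h1, h2, h3, h4] with w w1 w2 w3 w4
  refine ⟨w1, w2, w3, fun i => ?_⟩
  obtain ⟨j, hj⟩ := hω.exists_wedge_eq_zero hA hB hτ w1 w2 i
  have hji : j = i := by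
    by_contra h
    exact w4 i j h hj
  subst hji
  have he := eq_smul_liftForm w3 hj
  refine ⟨fun h => hne w1 j ?_, he⟩
  rw [he, h, zero_smul]

lemma sum_fderiv_div {f : Fin d → ℂ × ℂ → ℂ} {z : ℂ × ℂ}
    (hf : ∀ i, DifferentiableAt ℂ (f i) z) (h0 : ∀ i, f i z ≠ 0) (v : ℂ × ℂ) :
    ∑ i, fderiv ℂ (f i) z v / f i z = fderiv ℂ (fun w => ∏ i, f i w) z v / ∏ i, f i z := by
  have h := HasFDerivAt.finsetProd (u := Finset.univ) fun i _ => (hf i).hasFDerivAt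
  rw [h.fderiv, sum_apply, Finset.sum_div]
  refine Finset.sum_congr rfl fun i _ => ?_
  rw [← Finset.mul_prod_erase _ _ (Finset.mem_univ i)]
  have := Finset.prod_ne_zero_iff.2 fun j (_ : j ∈ Finset.univ.erase i) => h0 j
  simp only [smul_apply, smul_eq_mul]
  have := h0 i
  field_simp

/-- The scaling factors contribute `(d - 1) (d - 2) / 2` times the logarithmic differential of their
product. The product depends on `p` alone, so this is a `dp`-term and does not affect the exterior
derivative. -/
lemma extD_eq_deriv_branchSum_of_forall_wedge {U : Set (ℂ × ℂ)} {ω : Fin d → OneForm}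
    {η : OneForm} (hd : 3 ≤ d)
    (hA : A.IsHomogeneous d) (hB : B.IsHomogeneous d)
    (hτ : IsBranches d (dehom κ A) (dehom κ B) V τ) (hU : IsOpen U)
    (hω : IsDecomposition d (legForm A B) U ω) (hη : IsFundamentalForm d U ω η)
    {z : ℂ × ℂ} (hzU : z ∈ U) (hzV : z.1 ∈ V)
    (hz : z.2 ≠ 0) (hm : ∀ i, wedge (liftForm κ (τ i) z) (ω i z) = 0) :
    extD η z = deriv (branchSum κ τ) z.1 / z.2 := by
  obtain ⟨θ, hθ, hηθ⟩ := hη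
  set f : Fin d → ℂ × ℂ → ℂ := fun i w => pairing (ω i w) ((-κ * w.1 - 1) / w.2, -κ) with hf
  set α := (dehom κ A).coeff d
  set β := (dehom κ B).coeff d
  have hev := hω.eventually_eq_smul hd hA hB hτ hU hzU hzV hz hm
  refine extD_eq_of_eventuallyEq (F := fun p => (∑ r, ∑ s ∈ Finset.Ioi r, ∑ t ∈ Finset.Ioi s,
      tripleCoeffP κ p (τ r p) (τ s p) (τ t p) (deriv (τ r) p) (deriv (τ s) p)
        (deriv (τ t) p)) + (d - 1) * (d - 2) / 2 * (β / (α + p * β)))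
    (hτ.differentiableAt_branchSum κ hzV) hz ?_
  filter_upwards [hev.eventually_nhds] with w hw
  obtain ⟨wU, wV, w2, wf⟩ := hw.self_of_nhds
  have hdf i : DifferentiableAt ℂ (f i) w := by
    have ha := (hω.analytic i w wU).differentiableAt
    have : DifferentiableAt ℂ (fun w : ℂ × ℂ => (-κ * w.1 - 1) / w.2) w := by
      simp only [div_eq_mul_inv]
      exact ((differentiableAt_fst.const_mul (-κ)).sub_const 1).mul (differentiableAt_snd.inv w2)
    exact (ha.fst.mul this).add (ha.snd.mul_const (-κ))
  -- Both sides are the value of the symmetric form on the vector of `legForm_transversal`.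
  have hprod : (fun w => ∏ i, f i w) =ᶠ[nhds w] fun w => α + w.1 * β := by
    filter_upwards [hw] with w' hw'
    rw [← legForm_transversal hA hB hw'.2.2.1, hω.factor _ hw'.1]
  have hsum v : ∑ i, fderiv ℂ (f i) w v / f i w =
      fderiv ℂ (fun w : ℂ × ℂ => α + w.1 * β) w v / (α + w.1 * β) := by
    rw [sum_fderiv_div hdf fun i => (wf i).1, hprod.fderiv_eq]
    congr 1
    exact hprod.self_of_nhds
  have hv : ∑ i, fderiv ℂ (f i) w (0, 1) / f i w = 0 := by
    rw [hsum, fderiv_comp_fst_vertical fun p => α + p * β, zero_div]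
  have hh : ∑ i, fderiv ℂ (f i) w (1, 0) / f i w = β / (α + w.1 * β) := by
    have hp : HasFDerivAt (fun w : ℂ × ℂ => w.1) _ w := hasFDerivAt_fst (𝕜 := ℂ)
    rw [hsum, ((hp.mul_const β).const_add α).fderiv]
    simp
  have hd1 i : HasDerivAt (τ i) (deriv (τ i) w.1) w.1 := (hτ.differentiableAt wV i).hasDerivAt
  have hne {i j} (hij : i ≠ j) : τ i w.1 ≠ τ j w.1 := fun e => hij (hτ.injective _ wV e)
  have hθ' : ∀ r s t, r < s → s < t → θ r s t w =
      (tripleCoeffP κ w.1 (τ r w.1) (τ s w.1) (τ t w.1) (deriv (τ r) w.1) (deriv (τ s) w.1)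
          (deriv (τ t) w.1) +
        (fderiv ℂ (f r) w (1, 0) / f r w + fderiv ℂ (f s) w (1, 0) / f s w +
          fderiv ℂ (f t) w (1, 0) / f t w),
       tripleCoeff κ w.1 (τ r w.1) (τ s w.1) (τ t w.1) (deriv (τ r) w.1) (deriv (τ s) w.1)
          (deriv (τ t) w.1) / w.2 +
        (fderiv ℂ (f r) w (0, 1) / f r w + fderiv ℂ (f s) w (0, 1) / f s w +
          fderiv ℂ (f t) w (0, 1) / f t w)) := by
    intro r s t hrs hst
    have hω' i : ∀ᶠ w in nhds w, ω i w = f i w • liftForm κ (τ i) w := by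
      filter_upwards [hw] with w' hw'
      exact (hw'.2.2.2 i).2
    exact TripleAt.unique (hθ r s t hrs hst w wU)
      (tripleAt_liftForm (hd1 r) (hd1 s) (hd1 t) (hne hrs.ne) (hne hst.ne)
        (hne (hrs.trans hst).ne') w2 (hdf r) (hdf s) (hdf t) (wf r).1 (wf s).1 (wf t).1
        (hω' r) (hω' s) (hω' t))
      (hω.transverse w wU _ _ hrs.ne) (hω.transverse w wU _ _ hst.ne)
      (hω.transverse w wU _ _ (hrs.trans hst).ne')
  have hη' : η w = ∑ r, ∑ s ∈ Finset.Ioi r, ∑ t ∈ Finset.Ioi s,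
      (tripleCoeffP κ w.1 (τ r w.1) (τ s w.1) (τ t w.1) (deriv (τ r) w.1) (deriv (τ s) w.1)
          (deriv (τ t) w.1) +
        (fderiv ℂ (f r) w (1, 0) / f r w + fderiv ℂ (f s) w (1, 0) / f s w +
          fderiv ℂ (f t) w (1, 0) / f t w),
       tripleCoeff κ w.1 (τ r w.1) (τ s w.1) (τ t w.1) (deriv (τ r) w.1) (deriv (τ s) w.1)
          (deriv (τ t) w.1) / w.2 +
        (fderiv ℂ (f r) w (0, 1) / f r w + fderiv ℂ (f s) w (0, 1) / f s w +
          fderiv ℂ (f t) w (0, 1) / f t w)) := by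
    rw [hηθ w wU]
    refine Finset.sum_congr rfl fun r _ => Finset.sum_congr rfl fun s hs =>
      Finset.sum_congr rfl fun t ht => ?_
    exact hθ' r s t (Finset.mem_Ioi.1 hs) (Finset.mem_Ioi.1 ht)
  rw [hη']
  ext
  · simp only [Prod.fst_sum]
    simp only [Finset.sum_add_distrib (f := fun t => tripleCoeffP _ _ _ _ _ _ _ _),
      Finset.sum_add_distrib (f := fun t => ∑ x ∈ _, tripleCoeffP _ _ _ _ _ _ _ _),
      Finset.sum_add_distrib (f := fun t => ∑ x ∈ _, ∑ y ∈ _, tripleCoeffP _ _ _ _ _ _ _ _)]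
    rw [sum_Ioi_add_add (by omega) fun i => fderiv ℂ (f i) w (1, 0) / f i w, hh]
  · simp only [Prod.snd_sum]
    rw [branchSum_eq_sum_Ioi]
    simp only [Finset.sum_div]
    rw [← sub_eq_zero]
    simp only [← Finset.sum_sub_distrib, add_sub_cancel_left]
    rw [sum_Ioi_add_add (by omega) fun i => fderiv ℂ (f i) w (0, 1) / f i w, hv, mul_zero]

/-- Off the discriminant, any choice of decomposition yields the same curvature. -/
lemma IsCurvatureAt.eq_deriv_branchSum (hd : 3 ≤ d)
    (hA : A.IsHomogeneous d) (hB : B.IsHomogeneous d)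
    (hτ : IsBranches d (dehom κ A) (dehom κ B) V τ) {z : ℂ × ℂ} (hzV : z.1 ∈ V)
    (hz : z.2 ≠ 0) {k : ℂ} (hk : IsCurvatureAt d (legForm A B) z k) :
    k = deriv (branchSum κ τ) z.1 / z.2 := by
  obtain ⟨U, hU, hzU, ω, η, hω, hη, rfl⟩ := hk
  -- Two forms matched with the same branch would be proportional, so transversality makes `σ` a
  -- permutation.
  choose σ hσ using fun i => hω.exists_wedge_eq_zero hA hB hτ hzU hzV i
  have hinj : Function.Injective σ := by
    intro i j hij
    by_contra hne
    apply hω.transverse z hzU i j hne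
    have hj := hσ j
    rw [← hij] at hj
    rw [eq_smul_liftForm hz (hσ i), eq_smul_liftForm hz hj]
    exact wedge_smul_smul_self _ _ _
  let e : Equiv.Perm (Fin d) := Equiv.ofBijective σ (Finite.injective_iff_bijective.1 hinj)
  rw [← branchSum_perm κ τ e]
  exact extD_eq_deriv_branchSum_of_forall_wedge hd hA hB (hτ.perm e) hU hω hη hzU hzV hz hσ

lemma exists_isDecomposition (hd : 3 ≤ d)
    (hA : A.IsHomogeneous d) (hB : B.IsHomogeneous d)
    (hτ : IsBranches d (dehom κ A) (dehom κ B) V τ) :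
    ∃ f : Fin d → ℂ × ℂ → ℂ, (∀ i w, w.1 ∈ V → f i w ≠ 0 ∧ DifferentiableAt ℂ (f i) w) ∧
      IsDecomposition d (legForm A B) {w | w.1 ∈ V ∧ w.2 ≠ 0}
        fun i w => f i w • liftForm κ (τ i) w := by
  set α := (dehom κ A).coeff d
  set β := (dehom κ B).coeff d
  -- The leading coefficient has to go into one of the `d` factors; the first one is chosen.
  let i₀ : Fin d := ⟨0, by omega⟩
  have hne : ∀ i (w : ℂ × ℂ), w.1 ∈ V → (if i = i₀ then α + w.1 * β else 1) ≠ 0 := by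
    intro i w hw
    split_ifs
    · exact hτ.lead_ne _ hw
    · exact one_ne_zero
  have han : ∀ i (w : ℂ × ℂ),
      AnalyticAt ℂ (fun w : ℂ × ℂ => if i = i₀ then α + w.1 * β else 1) w := by
    intro i w
    split_ifs
    · exact analyticAt_const.add (analyticAt_fst.mul analyticAt_const)
    · exact analyticAt_const
  refine ⟨fun i w => if i = i₀ then α + w.1 * β else 1,
    fun i w hw => ⟨hne i w hw, (han i w).differentiableAt⟩, ?_, ?_, ?_⟩
  · intro i w hw
    exact (han i w).smul (analyticOnNhd_liftForm hτ.isOpen (hτ.differentiableOn i)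
      (fun z hz => hz.1) w hw)
  · intro z hz i j hij
    rw [wedge_smul_left, wedge_smul_right]
    exact mul_ne_zero (hne i z hz.1) (mul_ne_zero (hne j z hz.1) (hτ.wedge_ne_zero hz.2 hz.1 hij))
  · intro z hz v
    rw [legForm_eq_prod hA hB hτ hz.1]
    have : ∀ (c : ℂ) (x : ℂ × ℂ), pairing (c • x) v = c * pairing x v := by
      intro c x
      simp only [pairing, Prod.smul_fst, Prod.smul_snd, smul_eq_mul]
      ring
    simp only [this, Finset.prod_mul_distrib]
    rw [Finset.prod_ite_eq' Finset.univ i₀ fun _ => α + z.1 * β, if_pos (Finset.mem_univ _)]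

lemma isCurvatureAt_deriv_branchSum (hd : 3 ≤ d)
    (hA : A.IsHomogeneous d) (hB : B.IsHomogeneous d)
    (hτ : IsBranches d (dehom κ A) (dehom κ B) V τ) {z : ℂ × ℂ} (hzV : z.1 ∈ V)
    (hz : z.2 ≠ 0) : IsCurvatureAt d (legForm A B) z (deriv (branchSum κ τ) z.1 / z.2) := by
  obtain ⟨f, hf, hω⟩ := exists_isDecomposition hd hA hB hτ
  have hU : IsOpen {w : ℂ × ℂ | w.1 ∈ V ∧ w.2 ≠ 0} :=
    (hτ.isOpen.preimage continuous_fst).inter (isOpen_ne.preimage continuous_snd)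
  have hzU : z ∈ {w : ℂ × ℂ | w.1 ∈ V ∧ w.2 ≠ 0} := ⟨hzV, hz⟩
  have hθ : ∀ r s t, r < s → s < t → ∀ w : ℂ × ℂ, w.1 ∈ V ∧ w.2 ≠ 0 → ∃ θ : ℂ × ℂ,
      TripleAt (fun w => f r w • liftForm κ (τ r) w) (fun w => f s w • liftForm κ (τ s) w)
        (fun w => f t w • liftForm κ (τ t) w) θ w := by
    intro r s t hrs hst w hw
    have hd1 i := (hτ.differentiableAt hw.1 i).hasDerivAt
    have hne {i j} (hij : i ≠ j) : τ i w.1 ≠ τ j w.1 := fun e => hij (hτ.injective _ hw.1 e)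
    exact ⟨_, tripleAt_liftForm (hd1 r) (hd1 s) (hd1 t) (hne hrs.ne) (hne hst.ne)
        (hne (hrs.trans hst).ne') hw.2 (hf r w hw.1).2 (hf s w hw.1).2 (hf t w hw.1).2
        (hf r w hw.1).1 (hf s w hw.1).1 (hf t w hw.1).1
        (Filter.Eventually.of_forall fun _ => rfl) (Filter.Eventually.of_forall fun _ => rfl)
        (Filter.Eventually.of_forall fun _ => rfl)⟩
  -- The defining equations are pointwise in `θ`, so a choice at each point is enough.
  choose! θ hθ using hθ
  refine ⟨_, hU, hzU, _, fun w => ∑ r, ∑ s ∈ Finset.Ioi r, ∑ t ∈ Finset.Ioi s, θ r s t w, hω,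
    ⟨θ, hθ, fun _ _ => rfl⟩, ?_⟩
  refine (extD_eq_deriv_branchSum_of_forall_wedge hd hA hB hτ hU hω
    ⟨θ, hθ, fun _ _ => rfl⟩ hzU hzV hz fun i => ?_).symm
  have := wedge_smul_smul_self 1 (f i z) (liftForm κ (τ i) z)
  rwa [one_smul] at this

lemma notMem_discriminantLocus (hd : 3 ≤ d)
    (hA : A.IsHomogeneous d) (hB : B.IsHomogeneous d)
    (hτ : IsBranches d (dehom κ A) (dehom κ B) V τ) {z : ℂ × ℂ} (hzV : z.1 ∈ V)
    (hz : z.2 ≠ 0) : z ∉ discriminantLocus d (legForm A B) := by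
  obtain ⟨f, hf, hω⟩ := exists_isDecomposition hd hA hB hτ
  exact not_not.2 ⟨_, hω.transverse z ⟨hzV, hz⟩, hω.factor z ⟨hzV, hz⟩⟩

end Curvature

/-! ### The curvature as a sum over the roots -/

section RootSums

variable {ι : Type*} [DecidableEq ι] {τ : ι → ℂ}

lemma eval_derivative_prod_X_sub_C (S : Finset ι) {x : ℂ} (hx : ∀ s ∈ S, x ≠ τ s) :
    (Polynomial.derivative (∏ s ∈ S, (Polynomial.X - Polynomial.C (τ s)))).eval x =
      (∏ s ∈ S, (x - τ s)) * ∑ s ∈ S, (x - τ s)⁻¹ := by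
  rw [Polynomial.derivative_prod_finset]
  simp only [Polynomial.derivative_X_sub_C, mul_one, Polynomial.eval_finsetSum,
    Polynomial.eval_prod, Polynomial.eval_sub, Polynomial.eval_X, Polynomial.eval_C,
    Finset.mul_sum]
  refine Finset.sum_congr rfl fun s hs => ?_
  have := sub_ne_zero.2 (hx s hs)
  rw [← Finset.mul_prod_erase S _ hs]
  field_simp

lemma eval_derivative_derivative_prod_X_sub_C (S : Finset ι) {x : ℂ} (hx : ∀ s ∈ S, x ≠ τ s) :
    (Polynomial.derivative (Polynomial.derivative
      (∏ s ∈ S, (Polynomial.X - Polynomial.C (τ s))))).eval x =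
      (∏ s ∈ S, (x - τ s)) * ∑ s ∈ S, ∑ t ∈ S.erase s, (x - τ s)⁻¹ * (x - τ t)⁻¹ := by
  rw [Polynomial.derivative_prod_finset]
  simp only [Polynomial.derivative_X_sub_C, mul_one, Polynomial.derivative_sum,
    Polynomial.eval_finsetSum, Finset.mul_sum]
  refine Finset.sum_congr rfl fun s hs => ?_
  rw [eval_derivative_prod_X_sub_C (S.erase s) fun t ht => hx t (Finset.mem_of_mem_erase ht),
    Finset.mul_sum]
  refine Finset.sum_congr rfl fun t ht => ?_
  have := sub_ne_zero.2 (hx s hs)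
  rw [← Finset.mul_prod_erase S _ hs]
  field_simp

variable [Fintype ι] {c : ℂ} {f : Polynomial ℂ}

/-- Writing `f = c (X - τ_r) g`, the first three derivatives at `τ_r` are `c g`, `2 c g'` and `3 c
g''`. -/
lemma eval_derivatives_at_root (hτ : Function.Injective τ) (hc : c ≠ 0)
    (hf : f = Polynomial.C c * ∏ s, (Polynomial.X - Polynomial.C (τ s))) (r : ι) :
    f.derivative.eval (τ r) ≠ 0 ∧
    f.derivative.derivative.eval (τ r) =
      f.derivative.eval (τ r) * (2 * ∑ s ∈ Finset.univ.erase r, (τ r - τ s)⁻¹) ∧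
    f.derivative.derivative.derivative.eval (τ r) =
      f.derivative.eval (τ r) * (3 * ∑ s ∈ Finset.univ.erase r,
        ∑ t ∈ (Finset.univ.erase r).erase s, (τ r - τ s)⁻¹ * (τ r - τ t)⁻¹) := by
  set g := ∏ s ∈ Finset.univ.erase r, (Polynomial.X - Polynomial.C (τ s)) with hg
  have hx : ∀ s ∈ Finset.univ.erase r, τ r ≠ τ s :=
    fun s hs e => (Finset.ne_of_mem_erase hs) (hτ e.symm)
  have h1 := eval_derivative_prod_X_sub_C (τ := τ) _ hx
  have h2 := eval_derivative_derivative_prod_X_sub_C (τ := τ) _ hx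
  rw [← hg] at h1 h2
  have hgr : g.eval (τ r) = ∏ s ∈ Finset.univ.erase r, (τ r - τ s) := by
    simp [hg, Polynomial.eval_prod]
  rw [← hgr] at h1 h2
  have hg0 : g.eval (τ r) ≠ 0 := by
    rw [hgr]
    exact Finset.prod_ne_zero_iff.2 fun s hs => sub_ne_zero.2 (hx s hs)
  have hfg : f = Polynomial.C c * ((Polynomial.X - Polynomial.C (τ r)) * g) := by
    rw [hf, hg, Finset.mul_prod_erase Finset.univ (fun s => Polynomial.X - Polynomial.C (τ s))
      (Finset.mem_univ r)]
  have e1 : f.derivative.eval (τ r) = c * g.eval (τ r) := by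
    simp [hfg]
  have e2 : f.derivative.derivative.eval (τ r) = c * (2 * g.derivative.eval (τ r)) := by
    rw [hfg]
    simp only [Polynomial.derivative_mul, Polynomial.derivative_C, Polynomial.derivative_X_sub_C,
      Polynomial.derivative_add, Polynomial.derivative_one, Polynomial.derivative_zero,
      Polynomial.eval_add, Polynomial.eval_mul, Polynomial.eval_sub, Polynomial.eval_C,
      Polynomial.eval_X, Polynomial.eval_one, Polynomial.eval_zero]
    ring
  have e3 : f.derivative.derivative.derivative.eval (τ r) =
      c * (3 * g.derivative.derivative.eval (τ r)) := by
    rw [hfg]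
    simp only [Polynomial.derivative_mul, Polynomial.derivative_C, Polynomial.derivative_X_sub_C,
      Polynomial.derivative_add, Polynomial.derivative_one, Polynomial.derivative_zero,
      Polynomial.eval_add, Polynomial.eval_mul, Polynomial.eval_sub, Polynomial.eval_C,
      Polynomial.eval_X, Polynomial.eval_one, Polynomial.eval_zero]
    ring
  refine ⟨?_, ?_, ?_⟩
  · rw [e1]
    exact mul_ne_zero hc hg0
  · rw [e2, e1, h1]
    ring
  · rw [e3, e1, h2]
    ring

end RootSums

/-- Half the sum of `(m_s / (t - s)) (m_{s'} / (t - s'))` over the pairs of distinct roots `s, s'`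
of `f` other than the root `t`, where `m_s = p (1 - κ s) - s`. -/
noncomputable def rootTerm (d : ℕ) (κ p : ℂ) (f : Polynomial ℂ) (t : ℂ) : ℂ :=
  (p * (1 - κ * t) - t) ^ 2 * f.derivative.derivative.derivative.eval t /
      (6 * f.derivative.eval t) -
    (d - 2) * (-κ * p - 1) * (p * (1 - κ * t) - t) * f.derivative.derivative.eval t /
      (2 * f.derivative.eval t) +
    (d - 1) * (d - 2) / 2 * (-κ * p - 1) ^ 2

/-- With `m` and `y_s` as in the proof, the numerator is affine in the root with slope `v = -κ p -
1`, so each factor is `m y_s - v`. The sums of `y_s` and of `y_s y_t` are `f'' / (2 f')` and `f''' /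
(3 f')`. -/
lemma sum_sum_eq_rootTerm {d : ℕ} (hd : 2 ≤ d) (κ p : ℂ) {τ : Fin d → ℂ} {c : ℂ}
    {f : Polynomial ℂ} (hτ : Function.Injective τ) (hc : c ≠ 0)
    (hf : f = Polynomial.C c * ∏ s, (Polynomial.X - Polynomial.C (τ s))) (r : Fin d) :
    ∑ s ∈ Finset.univ.erase r, ∑ t ∈ (Finset.univ.erase r).erase s,
      (p * (1 - κ * τ s) - τ s) * (p * (1 - κ * τ t) - τ t) /
        ((τ r - τ s) * (τ r - τ t)) = 2 * rootTerm d κ p f (τ r) := by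
  obtain ⟨h1, h2, h3⟩ := eval_derivatives_at_root hτ hc hf r
  set m := p * (1 - κ * τ r) - τ r
  set v := -κ * p - 1
  set y : Fin d → ℂ := fun s => (τ r - τ s)⁻¹
  have hterm : ∀ s ∈ Finset.univ.erase r, ∀ t ∈ (Finset.univ.erase r).erase s,
      (p * (1 - κ * τ s) - τ s) * (p * (1 - κ * τ t) - τ t) / ((τ r - τ s) * (τ r - τ t)) =
        m ^ 2 * (y s * y t) - m * v * y s - m * v * y t + v ^ 2 := by
    intro s hs t ht
    have n1 : τ r - τ s ≠ 0 := sub_ne_zero.2 fun e => (Finset.ne_of_mem_erase hs) (hτ e.symm)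
    have n2 : τ r - τ t ≠ 0 := sub_ne_zero.2 fun e =>
      (Finset.ne_of_mem_erase (Finset.mem_of_mem_erase ht)) (hτ e.symm)
    simp only [m, v, y]
    field_simp
    ring
  have hcard1 : ((Finset.univ.erase r).card : ℂ) = d - 1 := by
    rw [Finset.card_erase_of_mem (Finset.mem_univ _), Finset.card_univ, Fintype.card_fin,
      Nat.cast_sub (by omega), Nat.cast_one]
  have hcard2 : ∀ s ∈ Finset.univ.erase r, (((Finset.univ.erase r).erase s).card : ℂ) = d - 2 := by
    intro s hs
    rw [Finset.card_erase_of_mem hs, Finset.card_erase_of_mem (Finset.mem_univ _),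
      Finset.card_univ, Fintype.card_fin, Nat.sub_sub, Nat.cast_sub (by omega)]
    norm_num
  have hS : ∀ s ∈ Finset.univ.erase r, ∑ t ∈ (Finset.univ.erase r).erase s,
      (p * (1 - κ * τ s) - τ s) * (p * (1 - κ * τ t) - τ t) / ((τ r - τ s) * (τ r - τ t)) =
      m ^ 2 * ∑ t ∈ (Finset.univ.erase r).erase s, y s * y t - (d - 2) * (m * v * y s) -
        m * v * (∑ t ∈ Finset.univ.erase r, y t - y s) + (d - 2) * v ^ 2 := by
    intro s hs
    rw [Finset.sum_congr rfl (hterm s hs), Finset.sum_add_distrib, Finset.sum_sub_distrib,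
      Finset.sum_sub_distrib, Finset.sum_const, Finset.sum_const, nsmul_eq_mul, nsmul_eq_mul,
      hcard2 s hs, ← Finset.mul_sum, ← Finset.mul_sum, ← Finset.mul_sum,
      ← Finset.add_sum_erase _ y hs]
    ring
  rw [Finset.sum_congr rfl hS, Finset.sum_add_distrib, Finset.sum_sub_distrib,
    Finset.sum_sub_distrib, Finset.sum_const, ← Finset.mul_sum, ← Finset.mul_sum, ← Finset.mul_sum,
    ← Finset.mul_sum, Finset.sum_sub_distrib, Finset.sum_const, nsmul_eq_mul, nsmul_eq_mul, hcard1]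
  have h3' : f.derivative.derivative.derivative.eval (τ r) =
      f.derivative.eval (τ r) * (3 * ∑ s ∈ Finset.univ.erase r,
        ∑ t ∈ (Finset.univ.erase r).erase s, y s * y t) := h3
  have hR : rootTerm d κ p f (τ r) =
      m ^ 2 * f.derivative.derivative.derivative.eval (τ r) / (6 * f.derivative.eval (τ r)) -
      (d - 2) * v * m * f.derivative.derivative.eval (τ r) / (2 * f.derivative.eval (τ r)) +
      (d - 1) * (d - 2) / 2 * v ^ 2 := rfl
  rw [hR, h2, h3']
  clear_value m v y
  field_simp
  ring

section

variable {d : ℕ} {κ : ℂ} {𝓐 𝓑 : Polynomial ℂ} {V : Set ℂ} {τ : Fin d → ℂ → ℂ}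

lemma IsBranches.eval_derivative_ne_zero (h : IsBranches d 𝓐 𝓑 V τ) {p : ℂ} (hp : p ∈ V)
    (i : Fin d) : (𝓐 + Polynomial.C p * 𝓑).derivative.eval (τ i p) ≠ 0 :=
  (eval_derivatives_at_root (h.injective p hp) (h.lead_ne p hp) (h.factor p hp) i).1

lemma IsBranches.eval_eq_zero (h : IsBranches d 𝓐 𝓑 V τ) {p : ℂ} (hp : p ∈ V) (i : Fin d) :
    𝓐.eval (τ i p) + p * 𝓑.eval (τ i p) = 0 := by
  have := congrArg (Polynomial.eval (τ i p)) (h.factor p hp)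
  rw [Polynomial.eval_mul, Polynomial.eval_prod, Finset.prod_eq_zero (Finset.mem_univ i) (by simp),
    mul_zero] at this
  simpa using this

lemma IsBranches.deriv_eq (h : IsBranches d 𝓐 𝓑 V τ) {p : ℂ} (hp : p ∈ V) (i : Fin d) :
    deriv (τ i) p = -𝓑.eval (τ i p) / (𝓐 + Polynomial.C p * 𝓑).derivative.eval (τ i p) := by
  have h0 := h.eval_derivative_ne_zero hp i
  have hd := (h.differentiableAt hp i).hasDerivAt
  have h1 : HasDerivAt (fun p => 𝓐.eval (τ i p) + p * 𝓑.eval (τ i p)) _ p :=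
    ((𝓐.hasDerivAt _).comp p hd).add ((hasDerivAt_id p).mul ((𝓑.hasDerivAt _).comp p hd))
  have h2 : (fun p => 𝓐.eval (τ i p) + p * 𝓑.eval (τ i p)) =ᶠ[nhds p] fun _ => 0 := by
    filter_upwards [h.isOpen.mem_nhds hp] with p' hp'
    exact h.eval_eq_zero hp' i
  have h3 := h1.unique ((hasDerivAt_const p (0 : ℂ)).congr_of_eventuallyEq h2)
  rw [eq_div_iff h0]
  simp only [Polynomial.derivative_add, Polynomial.derivative_C_mul, Polynomial.eval_add,
    Polynomial.eval_mul, Polynomial.eval_C, id] at h3 ⊢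
  linear_combination h3

/-- The sum over the roots of `𝓐 + p 𝓑` to which the curvature is the derivative, up to
sign and to the factor `1 / q`. -/
noncomputable def rootSum (d : ℕ) (κ : ℂ) (𝓐 𝓑 : Polynomial ℂ) (p : ℂ) : ℂ :=
  ∑ t ∈ (𝓐 + Polynomial.C p * 𝓑).roots.toFinset,
    -𝓑.eval t / (𝓐 + Polynomial.C p * 𝓑).derivative.eval t *
      rootTerm d κ p (𝓐 + Polynomial.C p * 𝓑) t

lemma sum_roots_eq {f : Polynomial ℂ} {c : ℂ} {t : Fin d → ℂ} (ht : Function.Injective t)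
    (hc : c ≠ 0) (hf : f = Polynomial.C c * ∏ s, (Polynomial.X - Polynomial.C (t s)))
    (g : ℂ → ℂ) : ∑ x ∈ f.roots.toFinset, g x = ∑ i, g (t i) := by
  have : f.roots.toFinset = Finset.univ.image t := by
    ext x
    rw [Multiset.mem_toFinset, hf, Polynomial.roots_C_mul _ hc, Polynomial.roots_prod]
    · simp [eq_comm]
    · exact Finset.prod_ne_zero_iff.2 fun i _ => Polynomial.X_sub_C_ne_zero _
  rw [this, Finset.sum_image ht.injOn]

/-- The three fractions in `tripleCoeff` are rotations of a single one, so each has the same sum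
over distinct triples, namely twice `rootSum`. -/
lemma IsBranches.branchSum_eq (hd : 2 ≤ d) (h : IsBranches d 𝓐 𝓑 V τ) {p : ℂ} (hp : p ∈ V) :
    branchSum κ τ p = d * (d - 1) * (d - 2) / 2 - rootSum d κ 𝓐 𝓑 p := by
  have hinj := h.injective p hp
  set G : Fin d → Fin d → Fin d → ℂ := fun r s t => deriv (τ r) p *
    (((p * (1 - κ * τ s p) - τ s p) * (p * (1 - κ * τ t p) - τ t p)) /
      ((τ r p - τ s p) * (τ r p - τ t p))) with hG
  have h1 : branchSum κ τ p = distinctSum (fun r s t => 3 +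
      ((-G r s t + -G s t r) + -G t r s)) / 6 := by
    unfold branchSum
    congr 1
    refine distinctSum_congr fun r s t hsr hts htr => ?_
    have n1 : τ r p - τ s p ≠ 0 := sub_ne_zero.2 fun e => hsr (hinj e.symm)
    have n2 : τ s p - τ t p ≠ 0 := sub_ne_zero.2 fun e => hts (hinj e.symm)
    have n3 : τ r p - τ t p ≠ 0 := sub_ne_zero.2 fun e => htr (hinj e.symm)
    simp only [tripleCoeff, hG]
    ring
  rw [h1, distinctSum_add, distinctSum_add, distinctSum_add,
    distinctSum_rotate fun r s t => -G r s t]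
  have h2 := distinctSum_rotate fun r s t => -G t r s
  rw [← h2]
  have h3 : distinctSum (fun _ _ _ : Fin d => (3 : ℂ)) = 3 * d * (d - 1) * (d - 2) := by
    rw [distinctSum_fst hd fun _ => (3 : ℂ)]
    simp
    ring
  have h4 : distinctSum (fun r s t => -G r s t) = -(2 * rootSum d κ 𝓐 𝓑 p) := by
    rw [rootSum, sum_roots_eq hinj (h.lead_ne p hp) (h.factor p hp), distinctSum]
    simp only [Finset.sum_neg_distrib]
    congr 1
    rw [Finset.mul_sum]
    refine Finset.sum_congr rfl fun r _ => ?_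
    simp only [hG, ← Finset.mul_sum]
    rw [sum_sum_eq_rootTerm hd κ p hinj (h.lead_ne p hp) (h.factor p hp) r, h.deriv_eq hp]
    ring
  rw [h3, h4]
  ring

end

/-! ### Local analysis at a point of the fibre -/

section Local

/-- The factor `X - ρ` keeps the exponent `ν` through repeated differentiation, so small `ν` needs
no separate treatment. -/
lemma X_sub_C_mul_derivative_pow_mul (ρ : ℂ) (ν : ℕ) (Q : Polynomial ℂ) :
    (Polynomial.X - Polynomial.C ρ) *
        Polynomial.derivative ((Polynomial.X - Polynomial.C ρ) ^ ν * Q) =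
      (Polynomial.X - Polynomial.C ρ) ^ ν *
        (Polynomial.C (ν : ℂ) * Q + (Polynomial.X - Polynomial.C ρ) * Q.derivative) := by
  rw [Polynomial.derivative_mul, Polynomial.derivative_X_sub_C_pow]
  rcases ν with _ | ν
  · simp
  · simp only [Nat.add_sub_cancel]
    ring

/-- `eulerOp ρ c Q = c Q + (X - ρ) Q'`. -/
noncomputable def eulerOp (ρ c : ℂ) (Q : Polynomial ℂ) : Polynomial ℂ :=
  Polynomial.C c * Q + (Polynomial.X - Polynomial.C ρ) * Q.derivative

lemma eval_eulerOp (ρ c : ℂ) (Q : Polynomial ℂ) : (eulerOp ρ c Q).eval ρ = c * Q.eval ρ := by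
  simp [eulerOp]

lemma eval_derivative_eulerOp (ρ c : ℂ) (Q : Polynomial ℂ) :
    (eulerOp ρ c Q).derivative.eval ρ = (c + 1) * Q.derivative.eval ρ := by
  simp [eulerOp]
  ring

variable {ρ : ℂ} {ν : ℕ} {P F : Polynomial ℂ}

lemma X_sub_C_mul_derivative (hF : F = (Polynomial.X - Polynomial.C ρ) ^ ν * P) :
    (Polynomial.X - Polynomial.C ρ) * F.derivative =
      (Polynomial.X - Polynomial.C ρ) ^ ν * eulerOp ρ ν P := by
  rw [hF, X_sub_C_mul_derivative_pow_mul]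
  rfl

lemma X_sub_C_sq_mul_derivative (hF : F = (Polynomial.X - Polynomial.C ρ) ^ ν * P) :
    (Polynomial.X - Polynomial.C ρ) ^ 2 * F.derivative.derivative =
      (Polynomial.X - Polynomial.C ρ) ^ ν * eulerOp ρ (ν - 1) (eulerOp ρ ν P) := by
  have h1 := X_sub_C_mul_derivative hF
  have h2 := congrArg (fun G => (Polynomial.X - Polynomial.C ρ) * Polynomial.derivative G) h1
  simp only [X_sub_C_mul_derivative_pow_mul] at h2
  rw [Polynomial.derivative_mul, Polynomial.derivative_X_sub_C] at h2
  rw [eulerOp, Polynomial.C_sub, Polynomial.C_1]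
  linear_combination h2 - h1

lemma X_sub_C_cube_mul_derivative (hF : F = (Polynomial.X - Polynomial.C ρ) ^ ν * P) :
    (Polynomial.X - Polynomial.C ρ) ^ 3 * F.derivative.derivative.derivative =
      (Polynomial.X - Polynomial.C ρ) ^ ν *
        eulerOp ρ (ν - 2) (eulerOp ρ (ν - 1) (eulerOp ρ ν P)) := by
  have h1 := X_sub_C_sq_mul_derivative hF
  have h2 := congrArg (fun G => (Polynomial.X - Polynomial.C ρ) * Polynomial.derivative G) h1
  simp only [X_sub_C_mul_derivative_pow_mul] at h2
  rw [Nat.cast_ofNat, show Polynomial.C (2 : ℂ) = 2 from rfl] at h2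
  rw [eulerOp, Polynomial.C_sub, show Polynomial.C (2 : ℂ) = 2 from rfl]
  linear_combination h2 - 2 * h1

/-- Taylor expansion to second order, the remainder being an iterated `dslope`. -/
lemma exists_eq_add_mul_add {W : ℂ → ℂ} {α β : ℂ} (hW : AnalyticAt ℂ W ρ) (h0 : W ρ = α)
    (h1 : HasDerivAt W β ρ) : ∃ h : ℂ → ℂ, ContinuousAt h ρ ∧
      ∀ t, t ≠ ρ → W t / (t - ρ) ^ 2 = α / (t - ρ) ^ 2 + β / (t - ρ) + h t := by
  obtain ⟨p, hp⟩ := hW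
  have hp1 := hp.has_fpower_series_dslope_fslope
  have hp2 := hp1.has_fpower_series_dslope_fslope
  refine ⟨dslope (dslope W ρ) ρ, hp2.analyticAt.continuousAt, fun t ht => ?_⟩
  have := sub_ne_zero.2 ht
  rw [dslope_of_ne _ ht, slope_def_field, dslope_same, dslope_of_ne _ ht, slope_def_field,
    h1.deriv, h0]
  field_simp
  ring

variable {𝓐 𝓑 : Polynomial ℂ} {p₀ : ℂ}

/-- The value of the parameter `p` for which `t` is a root of `𝓐 + p 𝓑`. -/
noncomputable def paramOf (𝓐 𝓑 : Polynomial ℂ) (t : ℂ) : ℂ := -𝓐.eval t / 𝓑.eval t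

/-- The quotient by `(X - ρ) ^ (ν - k)` of the `k`-th derivative at `t` of `𝓐 + p 𝓑`,
`p = paramOf 𝓐 𝓑 t`. -/
noncomputable def reduced (ρ : ℂ) (P 𝓑 𝓑' : Polynomial ℂ) (k : ℕ) (Q : Polynomial ℂ) (t : ℂ) : ℂ :=
  Q.eval t - (t - ρ) ^ k * (P.eval t * 𝓑'.eval t / 𝓑.eval t)

lemma paramOf_sub (h : 𝓐 + Polynomial.C p₀ * 𝓑 = (Polynomial.X - Polynomial.C ρ) ^ ν * P) {t : ℂ}
    (ht : 𝓑.eval t ≠ 0) :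
    (paramOf 𝓐 𝓑 t - p₀) * 𝓑.eval t = -((t - ρ) ^ ν * P.eval t) := by
  have h1 := congrArg (Polynomial.eval t) h
  simp only [Polynomial.eval_add, Polynomial.eval_mul, Polynomial.eval_C, Polynomial.eval_pow,
    Polynomial.eval_sub, Polynomial.eval_X] at h1
  rw [paramOf]
  field_simp
  linear_combination -h1

/-- The parameter moves with `t`: `f_p = f_{p₀} + (p - p₀) 𝓑` with `p - p₀ = -(t - ρ) ^ ν P / 𝓑`. So
the `k`-th derivatives at `p₀` and at `p` differ by a multiple of `(t - ρ) ^ ν`. -/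
lemma reduced_eq {Q D₀ D₁ : Polynomial ℂ} {k : ℕ}
    (h : 𝓐 + Polynomial.C p₀ * 𝓑 = (Polynomial.X - Polynomial.C ρ) ^ ν * P)
    (hD : (Polynomial.X - Polynomial.C ρ) ^ k * (D₀ + Polynomial.C p₀ * D₁) =
      (Polynomial.X - Polynomial.C ρ) ^ ν * Q) {t : ℂ} (ht : 𝓑.eval t ≠ 0) :
    (t - ρ) ^ k * (D₀ + Polynomial.C (paramOf 𝓐 𝓑 t) * D₁).eval t =
      (t - ρ) ^ ν * reduced ρ P 𝓑 D₁ k Q t := by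
  have h1 := paramOf_sub h ht
  have h2 := congrArg (Polynomial.eval t) hD
  simp only [Polynomial.eval_add, Polynomial.eval_mul, Polynomial.eval_C, Polynomial.eval_pow,
    Polynomial.eval_sub, Polynomial.eval_X] at h2 ⊢
  rw [reduced]
  field_simp
  linear_combination 𝓑.eval t * h2 + (t - ρ) ^ k * D₁.eval t * h1

lemma analyticAt_polynomial_eval (f : Polynomial ℂ) (t : ℂ) : AnalyticAt ℂ (fun t => f.eval t) t :=
  f.differentiable.analyticAt t

lemma analyticAt_reduced (hB : 𝓑.eval ρ ≠ 0) (𝓑' Q : Polynomial ℂ) (k : ℕ) :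
    AnalyticAt ℂ (reduced ρ P 𝓑 𝓑' k Q) ρ :=
  (analyticAt_polynomial_eval Q ρ).sub (((analyticAt_id.sub analyticAt_const).pow k).mul
    (((analyticAt_polynomial_eval P ρ).mul (analyticAt_polynomial_eval 𝓑' ρ)).div
      (analyticAt_polynomial_eval 𝓑 ρ) hB))

lemma reduced_self {k : ℕ} (hk : k ≠ 0) (𝓑' Q : Polynomial ℂ) :
    reduced ρ P 𝓑 𝓑' k Q ρ = Q.eval ρ := by
  simp [reduced, hk]

lemma hasDerivAt_reduced (hB : 𝓑.eval ρ ≠ 0) (𝓑' Q : Polynomial ℂ) (k : ℕ) :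
    HasDerivAt (reduced ρ P 𝓑 𝓑' (k + 1) Q) (Q.derivative.eval ρ -
      (k + 1) * 0 ^ k * (P.eval ρ * 𝓑'.eval ρ / 𝓑.eval ρ)) ρ := by
  have hR : DifferentiableAt ℂ (fun t => P.eval t * 𝓑'.eval t / 𝓑.eval t) ρ :=
    (P.differentiableAt.mul 𝓑'.differentiableAt).div 𝓑.differentiableAt hB
  have h := (Q.hasDerivAt ρ).sub
    ((((hasDerivAt_id ρ).sub_const ρ).pow (k + 1)).mul hR.hasDerivAt)
  refine h.congr_deriv ?_
  simp

/-- The double pole and the residue of the summand of `rootSum` at a point of the fibre. -/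
lemma exists_rootTerm_eq (d : ℕ) (κ : ℂ) (hν : 1 ≤ ν)
    (h : 𝓐 + Polynomial.C p₀ * 𝓑 = (Polynomial.X - Polynomial.C ρ) ^ ν * P)
    (hP : P.eval ρ ≠ 0) (hB : 𝓑.eval ρ ≠ 0) :
    ∃ α : ℂ, (ν = 1 → α = 0) ∧ ∃ u : ℂ → ℂ, ContinuousAt u ρ ∧
      (∀ᶠ t in nhdsWithin ρ {ρ}ᶜ, 𝓑.eval t ≠ 0 ∧
        (𝓐 + Polynomial.C (paramOf 𝓐 𝓑 t) * 𝓑).derivative.eval t ≠ 0 ∧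
        rootTerm d κ (paramOf 𝓐 𝓑 t) (𝓐 + Polynomial.C (paramOf 𝓐 𝓑 t) * 𝓑) t =
          α / (t - ρ) ^ 2 + polarCoeff d ν κ p₀ 𝓑 P ρ / (t - ρ) + u t) ∧
      Filter.Tendsto (fun t => (paramOf 𝓐 𝓑 t - p₀) * (-𝓑.eval t /
        (𝓐 + Polynomial.C (paramOf 𝓐 𝓑 t) * 𝓑).derivative.eval t))
        (nhdsWithin ρ {ρ}ᶜ) (nhds 0) := by
  have hν0 : (ν : ℂ) ≠ 0 := by exact_mod_cast (show ν ≠ 0 by omega)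
  set Q₁ := eulerOp ρ ν P with hQ₁
  set Q₂ := eulerOp ρ (ν - 1) Q₁ with hQ₂
  set Q₃ := eulerOp ρ (ν - 2) Q₂ with hQ₃
  set n₁ := reduced ρ P 𝓑 𝓑.derivative 1 Q₁ with hn₁
  set n₂ := reduced ρ P 𝓑 𝓑.derivative.derivative 2 Q₂ with hn₂
  set n₃ := reduced ρ P 𝓑 𝓑.derivative.derivative.derivative 3 Q₃ with hn₃
  set g := paramOf 𝓐 𝓑 with hg
  set m : ℂ → ℂ := fun t => g t * (1 - κ * t) - t with hm
  set v : ℂ → ℂ := fun t => -κ * g t - 1 with hv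
  -- `W` is the analytic extension of `(t - ρ)² rootTerm`; its value and derivative at `ρ` are the
  -- two polar coefficients.
  set W : ℂ → ℂ := fun t => m t ^ 2 * n₃ t / (6 * n₁ t) -
    (d - 2) * v t * m t * ((t - ρ) * n₂ t) / (2 * n₁ t) +
    (d - 1) * (d - 2) / 2 * v t ^ 2 * (t - ρ) ^ 2 with hW
  have e₁ (t : ℂ) (ht : 𝓑.eval t ≠ 0) :
      (t - ρ) ^ 1 * (𝓐 + Polynomial.C (g t) * 𝓑).derivative.eval t = (t - ρ) ^ ν * n₁ t := by
    have := reduced_eq (k := 1) (D₀ := 𝓐.derivative) (D₁ := 𝓑.derivative) (Q := Q₁) h (by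
      rw [pow_one, ← X_sub_C_mul_derivative h]
      simp) ht
    simpa using this
  have e₂ (t : ℂ) (ht : 𝓑.eval t ≠ 0) :
      (t - ρ) ^ 2 * (𝓐 + Polynomial.C (g t) * 𝓑).derivative.derivative.eval t =
        (t - ρ) ^ ν * n₂ t := by
    have := reduced_eq (k := 2) (D₀ := 𝓐.derivative.derivative) (D₁ := 𝓑.derivative.derivative)
      (Q := Q₂) h (by
      rw [← X_sub_C_sq_mul_derivative h]
      simp) ht
    simpa using this
  have e₃ (t : ℂ) (ht : 𝓑.eval t ≠ 0) :
      (t - ρ) ^ 3 * (𝓐 + Polynomial.C (g t) * 𝓑).derivative.derivative.derivative.eval t =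
        (t - ρ) ^ ν * n₃ t := by
    have := reduced_eq (k := 3) (D₀ := 𝓐.derivative.derivative.derivative)
      (D₁ := 𝓑.derivative.derivative.derivative)
      (Q := Q₃) h (by
      rw [← X_sub_C_cube_mul_derivative h]
      simp) ht
    simpa using this
  have v₁ : n₁ ρ = ν * P.eval ρ := by
    rw [hn₁, reduced_self one_ne_zero, hQ₁, eval_eulerOp]
  have v₂ : n₂ ρ = (ν - 1) * (ν * P.eval ρ) := by
    rw [hn₂, reduced_self two_ne_zero, hQ₂, eval_eulerOp, hQ₁, eval_eulerOp]
  have v₃ : n₃ ρ = (ν - 2) * ((ν - 1) * (ν * P.eval ρ)) := by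
    rw [hn₃, reduced_self three_ne_zero, hQ₃, eval_eulerOp, hQ₂, eval_eulerOp, hQ₁, eval_eulerOp]
  have d₁ : HasDerivAt n₁ ((ν + 1) * P.derivative.eval ρ -
      P.eval ρ * 𝓑.derivative.eval ρ / 𝓑.eval ρ) ρ := by
    refine (hasDerivAt_reduced hB _ _ 0).congr_deriv ?_
    rw [hQ₁, eval_derivative_eulerOp]
    simp
  have d₂ : HasDerivAt n₂ (ν * ((ν + 1) * P.derivative.eval ρ)) ρ := by
    refine (hasDerivAt_reduced hB _ _ 1).congr_deriv ?_
    rw [hQ₂, eval_derivative_eulerOp, hQ₁, eval_derivative_eulerOp]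
    simp
  have d₃ : HasDerivAt n₃ ((ν - 1) * (ν * ((ν + 1) * P.derivative.eval ρ))) ρ := by
    refine (hasDerivAt_reduced hB _ _ 2).congr_deriv ?_
    rw [hQ₃, eval_derivative_eulerOp, hQ₂, eval_derivative_eulerOp, hQ₁, eval_derivative_eulerOp]
    rw [zero_pow two_ne_zero]
    ring
  have hn0 : n₁ ρ ≠ 0 := by
    rw [v₁]
    exact mul_ne_zero hν0 hP
  have hgan : AnalyticAt ℂ g ρ :=
    (analyticAt_polynomial_eval 𝓐 ρ).neg.div (analyticAt_polynomial_eval 𝓑 ρ) hB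
  have hgρ : g ρ = p₀ := by
    have := paramOf_sub h hB
    rw [sub_self, zero_pow (by omega), zero_mul, neg_zero] at this
    exact sub_eq_zero.1 ((mul_eq_zero.1 this).resolve_right hB)
  -- For `ν ≥ 2` the function `p(t)` is critical at `ρ`. For `ν = 1` it is not, but `g'` enters the
  -- derivative of `W` only through a multiple of `ν - 1`.
  obtain ⟨g', hg', hg'0⟩ : ∃ g', HasDerivAt g g' ρ ∧ g' * (ν - 1) = 0 := by
    refine ⟨deriv g ρ, hgan.differentiableAt.hasDerivAt, ?_⟩
    rcases hν.eq_or_lt with rfl | hν2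
    · simp
    · have hev : (fun t => (g t - p₀) * 𝓑.eval t) =ᶠ[nhds ρ]
          fun t => -((t - ρ) ^ ν * P.eval t) := by
        filter_upwards [(analyticAt_polynomial_eval 𝓑 ρ).continuousAt.eventually_ne hB] with t ht
        exact paramOf_sub h ht
      have d1 : HasDerivAt (fun t => (g t - p₀) * 𝓑.eval t) _ ρ :=
        (hgan.differentiableAt.hasDerivAt.sub_const p₀).mul (𝓑.hasDerivAt ρ)
      have d2 : HasDerivAt (fun t => -((t - ρ) ^ ν * P.eval t)) _ ρ :=
        ((((hasDerivAt_id ρ).sub_const ρ).pow ν).mul (P.hasDerivAt ρ)).neg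
      have := d1.unique (d2.congr_of_eventuallyEq hev)
      have hz : (0 : ℂ) ^ (ν - 1) = 0 := zero_pow (by omega)
      have hz' : (0 : ℂ) ^ ν = 0 := zero_pow (by omega)
      simp [hgρ, hz, hz', hB] at this
      simp [this]
  have hman : AnalyticAt ℂ m ρ :=
    (hgan.mul (analyticAt_const.sub (analyticAt_const.mul analyticAt_id))).sub analyticAt_id
  have hvan : AnalyticAt ℂ v ρ := (analyticAt_const.mul hgan).sub analyticAt_const
  have a₁ : AnalyticAt ℂ n₁ ρ := analyticAt_reduced hB _ _ _
  have a₂ : AnalyticAt ℂ n₂ ρ := analyticAt_reduced hB _ _ _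
  have a₃ : AnalyticAt ℂ n₃ ρ := analyticAt_reduced hB _ _ _
  have hσan : AnalyticAt ℂ (fun t : ℂ => t - ρ) ρ := analyticAt_id.sub analyticAt_const
  have hWan : AnalyticAt ℂ W ρ := by
    refine AnalyticAt.add (AnalyticAt.sub ?_ ?_) ?_
    · exact ((hman.pow 2).mul a₃).div (analyticAt_const.mul a₁) (mul_ne_zero (by norm_num) hn0)
    · exact (((analyticAt_const.mul hvan).mul hman).mul (hσan.mul a₂)).div
        (analyticAt_const.mul a₁) (mul_ne_zero two_ne_zero hn0)
    · exact (analyticAt_const.mul (hvan.pow 2)).mul (hσan.pow 2)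
  have hmd : HasDerivAt m (g' * (1 - κ * ρ) + p₀ * (-κ) - 1) ρ := by
    have h1 : HasDerivAt (fun t : ℂ => 1 - κ * t) (-κ) ρ := by
      simpa using ((hasDerivAt_id ρ).const_mul κ).const_sub 1
    have := (hg'.mul h1).sub (hasDerivAt_id ρ)
    rw [hgρ] at this
    exact this
  have hvd : HasDerivAt v (-κ * g') ρ := (hg'.const_mul (-κ)).sub_const 1
  have hσd : HasDerivAt (fun t : ℂ => t - ρ) 1 ρ := (hasDerivAt_id ρ).sub_const ρ
  have hmρ : m ρ = p₀ * (1 - κ * ρ) - ρ := by rw [hm]; simp only [hgρ]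
  have hvρ : v ρ = -κ * p₀ - 1 := by rw [hv]; simp only [hgρ]
  have hWd : HasDerivAt W (polarCoeff d ν κ p₀ 𝓑 P ρ) ρ := by
    have h6 : (6 : ℂ) * n₁ ρ ≠ 0 := mul_ne_zero (by norm_num) hn0
    have h2 : (2 : ℂ) * n₁ ρ ≠ 0 := mul_ne_zero (by norm_num) hn0
    have t1 := ((hmd.pow 2).mul d₃).div (d₁.const_mul 6) h6
    have t2 := (((hvd.const_mul ((d : ℂ) - 2)).mul hmd).mul (hσd.mul d₂)).div (d₁.const_mul 2) h2
    have t3 := ((hvd.pow 2).const_mul (((d : ℂ) - 1) * (d - 2) / 2)).mul (hσd.pow 2)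
    refine ((t1.sub t2).add t3).congr_deriv ?_
    simp only [Pi.mul_apply, Pi.pow_apply, sub_self, v₁, v₂, v₃, hmρ, hvρ, polarCoeff]
    have hg1 : g' * (ν - 1) = 0 := hg'0
    generalize p₀ * (1 - κ * ρ) - ρ = M
    generalize P.eval ρ = P0 at *
    generalize P.derivative.eval ρ = P1
    generalize 𝓑.eval ρ = B0 at *
    generalize 𝓑.derivative.eval ρ = B1
    clear_value n₁ n₂ n₃
    simp only [zero_mul, mul_zero, Nat.cast_ofNat, Nat.add_one_sub_one, pow_one, ne_eq,
      OfNat.ofNat_ne_zero, not_false_eq_true, zero_pow, add_zero, zero_add, sub_zero, one_mul]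
    field_simp
    linear_combination (4 * M * (1 - κ * ρ) * ν * (ν - 2) * P0 * B0) * hg1
  obtain ⟨u, hu, hWu⟩ := exists_eq_add_mul_add hWan rfl hWd
  have hne : ∀ᶠ t in nhdsWithin ρ {ρ}ᶜ, t ≠ ρ ∧ 𝓑.eval t ≠ 0 ∧ n₁ t ≠ 0 := by
    filter_upwards [self_mem_nhdsWithin, nhdsWithin_le_nhds
      ((analyticAt_polynomial_eval 𝓑 ρ).continuousAt.eventually_ne hB),
      nhdsWithin_le_nhds (a₁.continuousAt.eventually_ne hn0)] with t h1 h2 h3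
    exact ⟨h1, h2, h3⟩
  have hder {t : ℂ} (h1 : t ≠ ρ) (h2 : 𝓑.eval t ≠ 0) (h3 : n₁ t ≠ 0) :
      (𝓐 + Polynomial.C (g t) * 𝓑).derivative.eval t ≠ 0 := fun h0 => by
    have := e₁ t h2
    rw [h0, mul_zero] at this
    exact mul_ne_zero (pow_ne_zero ν (sub_ne_zero.2 h1)) h3 this.symm
  refine ⟨W ρ, ?_, u, hu, ?_, ?_⟩
  · rintro rfl
    simp [hW, v₂, v₃]
  · filter_upwards [hne] with t ht
    obtain ⟨h1, h2, h3⟩ := ht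
    refine ⟨h2, hder h1 h2 h3, ?_⟩
    rw [← hWu t h1]
    have hs := sub_ne_zero.2 h1
    have hD := hder h1 h2 h3
    have hE := e₁ t h2
    have hF := e₂ t h2
    have hG := e₃ t h2
    simp only [rootTerm, hW, hm, hv]
    generalize (𝓐 + Polynomial.C (g t) * 𝓑).derivative.derivative.derivative.eval t = D₃ at *
    generalize (𝓐 + Polynomial.C (g t) * 𝓑).derivative.derivative.eval t = D₂ at *
    generalize (𝓐 + Polynomial.C (g t) * 𝓑).derivative.eval t = D₁ at *
    have hp := pow_ne_zero ν hs
    have r2 : (t - ρ) * D₂ / D₁ = n₂ t / n₁ t := by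
      rw [div_eq_div_iff hD h3]
      refine mul_left_cancel₀ (mul_ne_zero hp hs) ?_
      linear_combination (t - ρ) ^ ν * n₁ t * hF - (t - ρ) ^ ν * n₂ t * hE
    have r3 : (t - ρ) ^ 2 * D₃ / D₁ = n₃ t / n₁ t := by
      rw [div_eq_div_iff hD h3]
      refine mul_left_cancel₀ (mul_ne_zero hp hs) ?_
      linear_combination (t - ρ) ^ ν * n₁ t * hG - (t - ρ) ^ ν * n₃ t * hE
    rw [eq_div_iff (pow_ne_zero 2 hs)]
    linear_combination (g t * (1 - κ * t) - t) ^ 2 / 6 * r3 -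
      (t - ρ) * (d - 2) * (-κ * g t - 1) * (g t * (1 - κ * t) - t) / 2 * r2
  -- The product `(p - p₀) (-𝓑 / f_p')` equals `(t - ρ) P / n₁`, and `n₁` does not vanish at `ρ`.
  · have hlim : Filter.Tendsto (fun t => (t - ρ) * P.eval t / n₁ t) (nhdsWithin ρ {ρ}ᶜ)
        (nhds ((ρ - ρ) * P.eval ρ / n₁ ρ)) :=
      (((hσan.mul (analyticAt_polynomial_eval P ρ)).div a₁ hn0).continuousAt.tendsto).mono_left
        nhdsWithin_le_nhds
    rw [sub_self, zero_mul, zero_div] at hlim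
    refine hlim.congr' ?_
    filter_upwards [hne] with t ht
    obtain ⟨h1, h2, h3⟩ := ht
    have hs := sub_ne_zero.2 h1
    have hD := hder h1 h2 h3
    have hE := e₁ t h2
    have hp := paramOf_sub h h2
    rw [← hg] at hp
    rw [mul_div_assoc', div_eq_div_iff h3 hD]
    linear_combination P.eval t * hE + n₁ t * hp

end Local

/-! ### Partial fractions and localization of the roots -/

section Roots

variable {d : ℕ} {f g : Polynomial ℂ}

lemma exists_eq_C_mul_prod (hf : f.natDegree ≤ d) (hc : f.coeff d ≠ 0) :
    ∃ w : Fin d → ℂ, f = Polynomial.C (f.coeff d) *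
      ∏ s, (Polynomial.X - Polynomial.C (w s)) := by
  have hd : f.natDegree = d := le_antisymm hf (Polynomial.le_natDegree_of_ne_zero hc)
  have hs := IsAlgClosed.splits f
  have hcard : f.roots.toList.length = d := by
    rw [Multiset.length_toList, ← hd, hs.natDegree_eq_card_roots]
  subst hcard
  refine ⟨fun s => f.roots.toList.get s, ?_⟩
  have h := hs.eq_prod_roots
  rw [Polynomial.leadingCoeff, hd] at h
  conv_lhs => rw [h]
  congr 1
  have hl : (List.ofFn fun s => Polynomial.X - Polynomial.C (f.roots.toList.get s)) =
      f.roots.toList.map fun a => Polynomial.X - Polynomial.C a := by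
    conv_rhs => rw [← List.ofFn_get f.roots.toList, List.map_ofFn]
    rfl
  rw [← List.prod_ofFn, hl, ← Multiset.prod_coe, ← Multiset.map_coe, Multiset.coe_toList]

lemma eq_C_mul_prod_of_eval_eq_zero (hf : f.natDegree ≤ d) {t : Fin d → ℂ}
    (ht : Function.Injective t) (h0 : ∀ s, f.eval (t s) = 0) :
    f = Polynomial.C (f.coeff d) * ∏ s, (Polynomial.X - Polynomial.C (t s)) := by
  have hm : (∏ s, (Polynomial.X - Polynomial.C (t s))).Monic :=
    Polynomial.monic_prod_of_monic _ _ fun s _ => Polynomial.monic_X_sub_C _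
  have hdeg : (∏ s, (Polynomial.X - Polynomial.C (t s))).natDegree = d := by
    rw [Polynomial.natDegree_prod_of_monic _ _ fun s _ => Polynomial.monic_X_sub_C _]
    simp
  rw [← sub_eq_zero]
  refine Polynomial.eq_zero_of_degree_lt_of_eval_index_eq_zero (s := Finset.univ) (v := t)
    ht.injOn ?_ fun s _ => ?_
  · rw [Finset.card_univ, Fintype.card_fin]
    refine Polynomial.degree_lt_iff_coeff_zero _ _ |>.2 fun k hk => ?_
    rw [Polynomial.coeff_sub, Polynomial.coeff_C_mul]
    rcases hk.eq_or_lt with rfl | hk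
    · have := hm.coeff_natDegree
      rw [hdeg] at this
      rw [this, mul_one, sub_self]
    · rw [Polynomial.coeff_eq_zero_of_natDegree_lt (hf.trans_lt hk),
        Polynomial.coeff_eq_zero_of_natDegree_lt (hdeg.trans_lt hk), mul_zero, sub_zero]
  · rw [Polynomial.eval_sub, h0, Polynomial.eval_mul, Polynomial.eval_prod,
      Finset.prod_eq_zero (Finset.mem_univ s) (by simp), mul_zero, sub_zero]

/-- Partial fractions of `g / f`. Subtracting `g.coeff d` times the nodal polynomial brings the
degree below `d`, so Lagrange interpolation at the roots is exact. -/
lemma sum_div_eq (hg : g.natDegree ≤ d) {c : ℂ} (hc : c ≠ 0) {t : Fin d → ℂ}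
    (ht : Function.Injective t)
    (hf : f = Polynomial.C c * ∏ s, (Polynomial.X - Polynomial.C (t s))) {x : ℂ}
    (hx : f.eval x ≠ 0) :
    ∑ r, g.eval (t r) / f.derivative.eval (t r) / (x - t r) =
      g.eval x / f.eval x - g.coeff d / c := by
  have hf' : f = Polynomial.C c * Lagrange.nodal Finset.univ t := hf
  have hm : (Lagrange.nodal Finset.univ t).Monic := Lagrange.nodal_monic
  have hdeg : (Lagrange.nodal (Finset.univ : Finset (Fin d)) t).natDegree = d := by
    rw [Lagrange.natDegree_nodal]
    simp
  have hcoeff : (Lagrange.nodal (Finset.univ : Finset (Fin d)) t).coeff d = 1 := by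
    have := hm.coeff_natDegree
    rwa [hdeg] at this
  set R := g - Polynomial.C (g.coeff d) * Lagrange.nodal Finset.univ t with hR
  have hRdeg : R.degree < (Finset.univ : Finset (Fin d)).card := by
    rw [Finset.card_univ, Fintype.card_fin]
    refine Polynomial.degree_lt_iff_coeff_zero _ _ |>.2 fun k hk => ?_
    rw [hR, Polynomial.coeff_sub, Polynomial.coeff_C_mul]
    rcases hk.eq_or_lt with rfl | hk
    · rw [hcoeff, mul_one, sub_self]
    · rw [Polynomial.coeff_eq_zero_of_natDegree_lt (hg.trans_lt hk),
        Polynomial.coeff_eq_zero_of_natDegree_lt (hdeg.trans_lt hk), mul_zero, sub_zero]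
  have hRt (r : Fin d) : R.eval (t r) = g.eval (t r) := by
    rw [hR, Polynomial.eval_sub, Polynomial.eval_mul,
      Lagrange.eval_nodal_at_node (Finset.mem_univ r), mul_zero, sub_zero]
  have hN : (Lagrange.nodal Finset.univ t).eval x ≠ 0 := fun h => hx (by
    rw [hf', Polynomial.eval_mul, h, mul_zero])
  have hxt : ∀ r ∈ (Finset.univ : Finset (Fin d)), x ≠ t r := fun r hr h => hN (by
    rw [h, Lagrange.eval_nodal_at_node hr])
  have h1 := congrArg (Polynomial.eval x) (Lagrange.eq_interpolate ht.injOn hRdeg)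
  rw [Lagrange.eval_interpolate_not_at_node _ hxt] at h1
  have h2 : R.eval x = g.eval x - g.coeff d * (Lagrange.nodal Finset.univ t).eval x := by
    rw [hR, Polynomial.eval_sub, Polynomial.eval_mul, Polynomial.eval_C]
  have h3 : ∑ r, g.eval (t r) / f.derivative.eval (t r) / (x - t r) =
      (∑ r, Lagrange.nodalWeight Finset.univ t r * (x - t r)⁻¹ * R.eval (t r)) / c := by
    rw [Finset.sum_div]
    refine Finset.sum_congr rfl fun r _ => ?_
    rw [hRt, Lagrange.nodalWeight_eq_eval_derivative_nodal (Finset.mem_univ r), hf',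
      Polynomial.derivative_C_mul, Polynomial.eval_mul, Polynomial.eval_C]
    simp only [div_eq_mul_inv, mul_inv]
    ring
  rw [h3, hf', Polynomial.eval_mul, Polynomial.eval_C]
  rw [h2] at h1
  generalize ∑ r, Lagrange.nodalWeight Finset.univ t r * (x - t r)⁻¹ * R.eval (t r) = S at *
  field_simp
  linear_combination -h1

end Roots

/-- The points `ρ i` are the distinct roots of `𝓐 + p₀ 𝓑`, with multiplicities `ν i`. -/
structure IsFibre (d : ℕ) {n : ℕ} (𝓐 𝓑 : Polynomial ℂ) (p₀ : ℂ) (ρ : Fin n → ℂ)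
    (ν : Fin n → ℕ) (P : Fin n → Polynomial ℂ) : Prop where
  natDegree_left : 𝓐.natDegree ≤ d
  natDegree_right : 𝓑.natDegree ≤ d
  lead_ne : 𝓐.coeff d + p₀ * 𝓑.coeff d ≠ 0
  injective : Function.Injective ρ
  one_le : ∀ i, 1 ≤ ν i
  factor : ∀ i, 𝓐 + Polynomial.C p₀ * 𝓑 =
    (Polynomial.X - Polynomial.C (ρ i)) ^ ν i * P i
  eval_ne : ∀ i, (P i).eval (ρ i) ≠ 0
  eval_right_ne : ∀ i, 𝓑.eval (ρ i) ≠ 0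
  mem_range : ∀ t, (𝓐 + Polynomial.C p₀ * 𝓑).eval t = 0 → t ∈ Set.range ρ

section Fibre

variable {d n : ℕ} {𝓐 𝓑 : Polynomial ℂ} {p₀ : ℂ} {ρ : Fin n → ℂ} {ν : Fin n → ℕ}
  {P : Fin n → Polynomial ℂ}

lemma coeff_add_C_mul (p : ℂ) :
    (𝓐 + Polynomial.C p * 𝓑).coeff d = 𝓐.coeff d + p * 𝓑.coeff d := by
  rw [Polynomial.coeff_add, Polynomial.coeff_C_mul]

lemma eval_add_C_mul (p t : ℂ) :
    (𝓐 + Polynomial.C p * 𝓑).eval t = 𝓐.eval t + p * 𝓑.eval t := by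
  rw [Polynomial.eval_add, Polynomial.eval_mul, Polynomial.eval_C]

lemma paramOf_eq_of_eval_eq_zero {p t : ℂ} (h : (𝓐 + Polynomial.C p * 𝓑).eval t = 0)
    (ht : 𝓑.eval t ≠ 0) : paramOf 𝓐 𝓑 t = p := by
  rw [eval_add_C_mul] at h
  rw [paramOf, div_eq_iff ht]
  linear_combination -h

namespace IsFibre

lemma eval_point (h : IsFibre d 𝓐 𝓑 p₀ ρ ν P) (i : Fin n) (p : ℂ) :
    (𝓐 + Polynomial.C p * 𝓑).eval (ρ i) = (p - p₀) * 𝓑.eval (ρ i) := by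
  have h1 := congrArg (Polynomial.eval (ρ i)) (h.factor i)
  have h2 := h.one_le i
  rw [eval_add_C_mul, Polynomial.eval_mul, Polynomial.eval_pow, Polynomial.eval_sub,
    Polynomial.eval_X, Polynomial.eval_C, sub_self, zero_pow (by omega), zero_mul] at h1
  rw [eval_add_C_mul]
  linear_combination h1

lemma natDegree_le (h : IsFibre d 𝓐 𝓑 p₀ ρ ν P) (p : ℂ) :
    (𝓐 + Polynomial.C p * 𝓑).natDegree ≤ d :=
  Polynomial.natDegree_add_le_of_degree_le h.natDegree_left
    ((Polynomial.natDegree_C_mul_le _ _).trans h.natDegree_right)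

lemma eventually_lead_ne (h : IsFibre d 𝓐 𝓑 p₀ ρ ν P) :
    ∀ᶠ p in nhds p₀, 𝓐.coeff d + p * 𝓑.coeff d ≠ 0 :=
  ContinuousAt.eventually_ne (by fun_prop) h.lead_ne

/-- Partial fractions of `𝓑 / f_p` at `ρ i`, where `f_p = (p - p₀) 𝓑`. -/
lemma sum_div_sub (h : IsFibre d 𝓐 𝓑 p₀ ρ ν P) {p : ℂ} (hp : p ≠ p₀)
    (hc : 𝓐.coeff d + p * 𝓑.coeff d ≠ 0) {t : Fin d → ℂ} (ht : Function.Injective t)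
    (hf : 𝓐 + Polynomial.C p * 𝓑 = Polynomial.C (𝓐.coeff d + p * 𝓑.coeff d) *
      ∏ s, (Polynomial.X - Polynomial.C (t s))) (i : Fin n) :
    ∑ r, -𝓑.eval (t r) / (𝓐 + Polynomial.C p * 𝓑).derivative.eval (t r) / (t r - ρ i) =
      1 / (p - p₀) - 𝓑.coeff d / (𝓐.coeff d + p * 𝓑.coeff d) := by
  have hB := h.eval_right_ne i
  have hp' := sub_ne_zero.2 hp
  have h1 := sum_div_eq h.natDegree_right hc ht hf (x := ρ i) (by
    rw [h.eval_point i]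
    exact mul_ne_zero hp' hB)
  rw [h.eval_point i] at h1
  rw [show 1 / (p - p₀) = 𝓑.eval (ρ i) / ((p - p₀) * 𝓑.eval (ρ i)) by field_simp, ← h1]
  refine Finset.sum_congr rfl fun r _ => ?_
  rw [← neg_sub (ρ i) (t r), neg_div, neg_div_neg_eq]

/-- The sum is the derivative of `𝓑 / f_p` at `ρ i`. For `ν i ≥ 2` both the value and the derivative
of `f_p` there are `p - p₀` times those of `𝓑`, so it vanishes. -/
lemma sum_div_sub_sq (h : IsFibre d 𝓐 𝓑 p₀ ρ ν P) {p : ℂ} (hp : p ≠ p₀)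
    (hc : 𝓐.coeff d + p * 𝓑.coeff d ≠ 0) {t : Fin d → ℂ} (ht : Function.Injective t)
    (hf : 𝓐 + Polynomial.C p * 𝓑 = Polynomial.C (𝓐.coeff d + p * 𝓑.coeff d) *
      ∏ s, (Polynomial.X - Polynomial.C (t s))) {i : Fin n} (hi : ν i ≠ 1) :
    ∑ r, -𝓑.eval (t r) / (𝓐 + Polynomial.C p * 𝓑).derivative.eval (t r) / (t r - ρ i) ^ 2 = 0 := by
  set f := 𝓐 + Polynomial.C p * 𝓑 with hfdef
  have hB := h.eval_right_ne i
  have hp' := sub_ne_zero.2 hp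
  have hx : f.eval (ρ i) ≠ 0 := by
    rw [h.eval_point i]
    exact mul_ne_zero hp' hB
  have hν : 2 ≤ ν i := by
    have := h.one_le i
    omega
  have hd : f.derivative.eval (ρ i) = (p - p₀) * 𝓑.derivative.eval (ρ i) := by
    obtain ⟨k, hk⟩ := Nat.exists_eq_add_of_le hν
    have h1 := congrArg (fun G => (Polynomial.derivative G).eval (ρ i)) (h.factor i)
    rw [hk] at h1
    simp [pow_add, Polynomial.derivative_X_sub_C_pow] at h1
    rw [hfdef]
    simp
    linear_combination h1
  have hev : (fun x => ∑ r, 𝓑.eval (t r) / f.derivative.eval (t r) / (x - t r)) =ᶠ[nhds (ρ i)]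
      fun x => 𝓑.eval x / f.eval x - 𝓑.coeff d / (𝓐.coeff d + p * 𝓑.coeff d) := by
    filter_upwards [f.continuous.continuousAt.eventually_ne hx] with x hx
    exact sum_div_eq h.natDegree_right hc ht hf hx
  have hne (r : Fin d) : ρ i - t r ≠ 0 := fun h0 => hx (by
    rw [hf, Polynomial.eval_mul, Polynomial.eval_prod, Finset.prod_eq_zero (Finset.mem_univ r)
      (by simpa using h0), mul_zero])
  have d1 : HasDerivAt (fun x => ∑ r, 𝓑.eval (t r) / f.derivative.eval (t r) / (x - t r))
      (∑ r, -𝓑.eval (t r) / f.derivative.eval (t r) / (t r - ρ i) ^ 2) (ρ i) := by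
    refine HasDerivAt.fun_sum fun r _ => ?_
    refine ((hasDerivAt_const (ρ i) (𝓑.eval (t r) / f.derivative.eval (t r))).div
      ((hasDerivAt_id (ρ i)).sub_const (t r)) (hne r)).congr_deriv ?_
    simp only [id]
    rw [← neg_sub (ρ i) (t r), neg_sq]
    ring
  have d2 := ((𝓑.hasDerivAt (ρ i)).div (f.hasDerivAt (ρ i)) hx).sub_const
    (𝓑.coeff d / (𝓐.coeff d + p * 𝓑.coeff d))
  rw [d1.unique (d2.congr_of_eventuallyEq hev), hd, h.eval_point i]
  simp only [div_eq_zero_iff]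
  left
  ring

/-- The roots of `𝓐 + p 𝓑` tend to the roots of `𝓐 + p₀ 𝓑` as `p` tends to `p₀`. -/
lemma eventually_roots (h : IsFibre d 𝓐 𝓑 p₀ ρ ν P) {good : ℂ → Prop}
    (hgood : ∀ i, ∀ᶠ t in nhds (ρ i), good t) :
    ∀ᶠ p in nhds p₀, ∀ t, (𝓐 + Polynomial.C p * 𝓑).eval t = 0 → good t := by
  obtain ⟨w, hw⟩ := exists_eq_C_mul_prod (h.natDegree_le p₀)
    (by rw [coeff_add_C_mul]; exact h.lead_ne)
  rw [coeff_add_C_mul] at hw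
  set c := 𝓐.coeff d + p₀ * 𝓑.coeff d with hcdef
  have hwr (s : Fin d) : w s ∈ Set.range ρ := h.mem_range _ (by
    rw [hw, Polynomial.eval_mul, Polynomial.eval_prod, Finset.prod_eq_zero (Finset.mem_univ s)
      (by simp), mul_zero])
  have hgood' : ∀ s, ∀ᶠ t in nhds (w s), good t := fun s => by
    obtain ⟨i, hi⟩ := hwr s
    rw [← hi]
    exact hgood i
  choose δ hδ hball using fun s => Metric.eventually_nhds_iff_ball.1 (hgood' s)
  -- Outside the disc about `w s`, `1 + ‖t‖` is at most a constant times `‖t - w s‖`, up to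
  -- infinity. Hence away from all the discs `f_{p₀}` dominates `(1 + ‖t‖) ^ d`, and the
  -- perturbation `(p - p₀) 𝓑` cannot create a root.
  choose L hL1 hL using fun s => show ∃ L : ℝ, 0 ≤ L ∧ ∀ t, t ∉ Metric.ball (w s) (δ s) →
      1 + ‖t‖ ≤ L * ‖t - w s‖ from by
    refine ⟨(1 + ‖w s‖) / δ s + 1, by have := hδ s; positivity, fun t ht => ?_⟩
    have h1 : δ s ≤ ‖t - w s‖ := by
      rw [Metric.mem_ball, not_lt, dist_eq_norm] at ht
      exact ht
    have h2 : ‖t‖ ≤ ‖t - w s‖ + ‖w s‖ := by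
      simpa using norm_add_le (t - w s) (w s)
    have h3 : 1 + ‖w s‖ ≤ (1 + ‖w s‖) / δ s * ‖t - w s‖ := by
      rw [div_mul_eq_mul_div, le_div_iff₀ (hδ s)]
      gcongr
    linarith
  set K := ∑ k ∈ Finset.range (d + 1), ‖𝓑.coeff k‖ with hK
  have hBK (t : ℂ) : ‖𝓑.eval t‖ ≤ K * (1 + ‖t‖) ^ d := by
    rw [Polynomial.eval_eq_sum_range' (Nat.lt_succ_of_le h.natDegree_right), hK, Finset.sum_mul]
    refine (norm_sum_le _ _).trans (Finset.sum_le_sum fun k hk => ?_)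
    rw [norm_mul, norm_pow]
    have hk' : k ≤ d := Nat.lt_succ_iff.1 (Finset.mem_range.1 hk)
    gcongr
    calc ‖t‖ ^ k ≤ (1 + ‖t‖) ^ k := by gcongr; linarith
      _ ≤ (1 + ‖t‖) ^ d := pow_le_pow_right₀ (by linarith [norm_nonneg t]) hk'
  have hc : 0 < ‖c‖ := norm_pos_iff.2 h.lead_ne
  have hsmall : ∀ᶠ p in nhds p₀, ‖p - p₀‖ * (K * ∏ s, L s) < ‖c‖ := by
    have : ContinuousAt (fun p : ℂ => ‖p - p₀‖ * (K * ∏ s, L s)) p₀ := by fun_prop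
    refine this.eventually_lt continuousAt_const ?_
    simpa using hc
  filter_upwards [hsmall] with p hp t ht
  by_contra hng
  have hL' : (1 + ‖t‖) ^ d ≤ ∏ s, (L s * ‖t - w s‖) := by
    calc (1 + ‖t‖) ^ d = ∏ _s : Fin d, (1 + ‖t‖) := by simp
      _ ≤ _ := Finset.prod_le_prod (fun _ _ => by positivity) fun s _ =>
        hL s t fun hm => hng (hball s t hm)
  have h0 : (𝓐 + Polynomial.C p₀ * 𝓑).eval t = -((p - p₀) * 𝓑.eval t) := by
    rw [eval_add_C_mul] at ht ⊢
    linear_combination ht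
  have h1 : ‖c‖ * ∏ s, ‖t - w s‖ = ‖p - p₀‖ * ‖𝓑.eval t‖ := by
    rw [← norm_mul, ← norm_neg ((p - p₀) * _), ← h0, hw, Polynomial.eval_mul,
      Polynomial.eval_prod, norm_mul, norm_prod, Polynomial.eval_C]
    simp
  have hpos : 0 < ∏ s, ‖t - w s‖ := by
    refine Finset.prod_pos fun s _ => norm_pos_iff.2 (sub_ne_zero.2 ?_)
    rintro rfl
    exact hng (hball s _ (Metric.mem_ball_self (hδ s)))
  rw [Finset.prod_mul_distrib] at hL'
  have hKn : 0 ≤ K := Finset.sum_nonneg fun _ _ => norm_nonneg _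
  have h2 : ‖p - p₀‖ * ‖𝓑.eval t‖ ≤
      ‖p - p₀‖ * (K * ∏ s, L s) * ∏ s, ‖t - w s‖ := by
    calc ‖p - p₀‖ * ‖𝓑.eval t‖ ≤ ‖p - p₀‖ * (K * ((∏ s, L s) * ∏ s, ‖t - w s‖)) := by
          gcongr
          exact (hBK t).trans (by gcongr)
      _ = _ := by ring
  have h3 := mul_lt_mul_of_pos_right hp hpos
  linarith

/-- For `p` close to `p₀`, `𝓐 + p 𝓑` has `d` simple roots, close to the roots of `𝓐 + p₀ 𝓑`. -/
lemma eventually_simple_roots (h : IsFibre d 𝓐 𝓑 p₀ ρ ν P) {good : ℂ → Prop}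
    (hne : ∀ i, ∀ᶠ t in nhdsWithin (ρ i) {ρ i}ᶜ, 𝓑.eval t ≠ 0 ∧
      (𝓐 + Polynomial.C (paramOf 𝓐 𝓑 t) * 𝓑).derivative.eval t ≠ 0)
    (hgood : ∀ i, ∀ᶠ t in nhdsWithin (ρ i) {ρ i}ᶜ, good t) :
    ∀ᶠ p in nhdsWithin p₀ {p₀}ᶜ, p ≠ p₀ ∧ 𝓐.coeff d + p * 𝓑.coeff d ≠ 0 ∧ ∃ t : Fin d → ℂ,
      Function.Injective t ∧
      𝓐 + Polynomial.C p * 𝓑 = Polynomial.C (𝓐.coeff d + p * 𝓑.coeff d) *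
        ∏ s, (Polynomial.X - Polynomial.C (t s)) ∧
      ∀ r, 𝓑.eval (t r) ≠ 0 ∧ paramOf 𝓐 𝓑 (t r) = p ∧
        (𝓐 + Polynomial.C p * 𝓑).derivative.eval (t r) ≠ 0 ∧
        t r ∉ Set.range ρ ∧ good (t r) := by
  have h1 := h.eventually_roots (good := fun t => t ∈ Set.range ρ ∨ (𝓑.eval t ≠ 0 ∧
      (𝓐 + Polynomial.C (paramOf 𝓐 𝓑 t) * 𝓑).derivative.eval t ≠ 0) ∧ good t) fun i => by
    have := (hne i).and (hgood i)
    rw [eventually_nhdsWithin_iff] at this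
    filter_upwards [this] with t ht
    by_cases hti : t = ρ i
    · exact Or.inl ⟨i, hti.symm⟩
    · exact Or.inr (ht hti)
  filter_upwards [nhdsWithin_le_nhds h1, nhdsWithin_le_nhds h.eventually_lead_ne,
    self_mem_nhdsWithin] with p hp hc hpp
  refine ⟨hpp, hc, ?_⟩
  obtain ⟨t, ht⟩ := exists_eq_C_mul_prod (h.natDegree_le p) (by rwa [coeff_add_C_mul])
  rw [coeff_add_C_mul] at ht
  have hroot (r : Fin d) : (𝓐 + Polynomial.C p * 𝓑).eval (t r) = 0 := by
    rw [ht, Polynomial.eval_mul, Polynomial.eval_prod, Finset.prod_eq_zero (Finset.mem_univ r)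
      (by simp), mul_zero]
  have hnr (r : Fin d) : t r ∉ Set.range ρ := by
    rintro ⟨i, hi⟩
    have := hroot r
    rw [← hi, h.eval_point i] at this
    exact mul_ne_zero (sub_ne_zero.2 hpp) (h.eval_right_ne i) this
  have hall (r : Fin d) := (hp _ (hroot r)).resolve_left (hnr r)
  have hpar (r : Fin d) : paramOf 𝓐 𝓑 (t r) = p :=
    paramOf_eq_of_eval_eq_zero (hroot r) (hall r).1.1
  have hder (r : Fin d) : (𝓐 + Polynomial.C p * 𝓑).derivative.eval (t r) ≠ 0 := by
    have := (hall r).1.2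
    rwa [hpar r] at this
  refine ⟨t, fun r s hrs => ?_, ht, fun r =>
    ⟨(hall r).1.1, hpar r, hder r, hnr r, (hall r).2⟩⟩
  -- A repeated root would annihilate the derivative.
  by_contra hne'
  refine hder r ?_
  rw [ht, ← Finset.mul_prod_erase _ _ (Finset.mem_univ r),
    ← Finset.mul_prod_erase _ _ (Finset.mem_erase.2 ⟨Ne.symm hne', Finset.mem_univ s⟩), hrs]
  simp

end IsFibre

end Fibre

/-! ### The simple pole of `rootSum` -/

section Pole

variable {d n : ℕ} {𝓐 𝓑 : Polynomial ℂ} {p₀ : ℂ} {ρ : Fin n → ℂ} {ν : Fin n → ℕ}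
  {P : Fin n → Polynomial ℂ}

/-- The root is a local inverse of `t ↦ -𝓐(t) / 𝓑(t)`, whose derivative at `t₁` is `-f' / 𝓑` there.
-/
lemma exists_analyticAt_root {p₁ t₁ : ℂ} (h0 : (𝓐 + Polynomial.C p₁ * 𝓑).eval t₁ = 0)
    (hB : 𝓑.eval t₁ ≠ 0) (h1 : (𝓐 + Polynomial.C p₁ * 𝓑).derivative.eval t₁ ≠ 0) :
    ∃ τ : ℂ → ℂ, AnalyticAt ℂ τ p₁ ∧ τ p₁ = t₁ ∧
      ∀ᶠ p in nhds p₁, (𝓐 + Polynomial.C p * 𝓑).eval (τ p) = 0 := by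
  have hg : AnalyticAt ℂ (paramOf 𝓐 𝓑) t₁ :=
    (analyticAt_polynomial_eval 𝓐 t₁).neg.div (analyticAt_polynomial_eval 𝓑 t₁) hB
  have hp : paramOf 𝓐 𝓑 t₁ = p₁ := paramOf_eq_of_eval_eq_zero h0 hB
  have hd : deriv (paramOf 𝓐 𝓑) t₁ ≠ 0 := by
    have : HasDerivAt (paramOf 𝓐 𝓑) _ t₁ := (𝓐.hasDerivAt t₁).neg.div (𝓑.hasDerivAt t₁) hB
    rw [this.deriv]
    refine div_ne_zero (fun h => h1 ?_) (pow_ne_zero 2 hB)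
    rw [eval_add_C_mul] at h0
    simp only [Polynomial.derivative_add, Polynomial.derivative_C_mul, Polynomial.eval_add,
      Polynomial.eval_mul, Polynomial.eval_C, Pi.neg_apply] at h ⊢
    refine (mul_eq_zero.1 (?_ : _ * 𝓑.eval t₁ = 0)).resolve_right hB
    linear_combination 𝓑.derivative.eval t₁ * h0 - h
  have hτ := hg.analyticAt_localInverse hd
  have hv : hg.hasStrictDerivAt.localInverse _ _ _ hd (paramOf 𝓐 𝓑 t₁) = t₁ :=
    HasStrictFDerivAt.localInverse_apply_image ..
  have hr := HasStrictDerivAt.eventually_right_inverse hg.hasStrictDerivAt hd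
  rw [hp] at hτ hv hr
  refine ⟨_, hτ, hv, ?_⟩
  have hc := hτ.continuousAt
  have hBc := (𝓑.continuous.continuousAt.comp hc).eventually_ne (by
    rw [Function.comp_apply, hv]
    exact hB)
  filter_upwards [hr, hBc] with p h2 h3
  rw [Function.comp_apply] at h3
  rw [eval_add_C_mul]
  rw [paramOf, div_eq_iff h3] at h2
  linear_combination -h2

lemma exists_isBranches (hA : 𝓐.natDegree ≤ d) (hB : 𝓑.natDegree ≤ d) {p₁ : ℂ}
    (hc : 𝓐.coeff d + p₁ * 𝓑.coeff d ≠ 0) {t : Fin d → ℂ} (ht : Function.Injective t)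
    (hf : 𝓐 + Polynomial.C p₁ * 𝓑 = Polynomial.C (𝓐.coeff d + p₁ * 𝓑.coeff d) *
      ∏ s, (Polynomial.X - Polynomial.C (t s))) (hBt : ∀ r, 𝓑.eval (t r) ≠ 0)
    (hder : ∀ r, (𝓐 + Polynomial.C p₁ * 𝓑).derivative.eval (t r) ≠ 0) :
    ∃ V τ, IsBranches d 𝓐 𝓑 V τ ∧ p₁ ∈ V := by
  have hroot (r : Fin d) : (𝓐 + Polynomial.C p₁ * 𝓑).eval (t r) = 0 := by
    rw [hf, Polynomial.eval_mul, Polynomial.eval_prod, Finset.prod_eq_zero (Finset.mem_univ r)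
      (by simp), mul_zero]
  choose τ hτ hτ0 hτr using fun r => exists_analyticAt_root (hroot r) (hBt r) (hder r)
  have hinj : ∀ᶠ p in nhds p₁, ∀ r s, r ≠ s → τ r p ≠ τ s p := by
    refine Filter.eventually_all.2 fun r => Filter.eventually_all.2 fun s => ?_
    by_cases hrs : r = s
    · exact Filter.Eventually.of_forall fun p h => absurd hrs h
    · have h1 : ContinuousAt (fun p => τ r p - τ s p) p₁ :=
        (hτ r).continuousAt.sub (hτ s).continuousAt
      have h2 : τ r p₁ - τ s p₁ ≠ 0 := by
        rw [hτ0, hτ0]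
        exact sub_ne_zero.2 (ht.ne hrs)
      filter_upwards [h1.eventually_ne h2] with p hp _
      exact sub_ne_zero.1 hp
  have hlead : ∀ᶠ p in nhds p₁, 𝓐.coeff d + p * 𝓑.coeff d ≠ 0 :=
    ContinuousAt.eventually_ne (by fun_prop) hc
  have han : ∀ᶠ p in nhds p₁, ∀ r, AnalyticAt ℂ (τ r) p :=
    Filter.eventually_all.2 fun r => (hτ r).eventually_analyticAt
  obtain ⟨V, hV, hVo, hpV⟩ := eventually_nhds_iff.1
    (((hinj.and hlead).and han).and (Filter.eventually_all.2 hτr))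
  have hinj' (p : ℂ) (hp : p ∈ V) : Function.Injective fun i => τ i p := fun r s hrs => by
    by_contra hne
    exact (hV p hp).1.1.1 r s hne hrs
  refine ⟨V, τ, ⟨hVo, fun r p hp => ((hV p hp).1.2 r).differentiableAt.differentiableWithinAt,
    hinj', fun p hp => (hV p hp).1.1.2, fun p hp => ?_⟩, hpV⟩
  have := eq_C_mul_prod_of_eval_eq_zero (f := 𝓐 + Polynomial.C p * 𝓑)
    (Polynomial.natDegree_add_le_of_degree_le hA ((Polynomial.natDegree_C_mul_le _ _).trans hB))
    (hinj' p hp) (hV p hp).2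
  rwa [coeff_add_C_mul] at this

lemma IsFibre.eventually_ne (h : IsFibre d 𝓐 𝓑 p₀ ρ ν P) (i : Fin n) :
    ∀ᶠ t in nhdsWithin (ρ i) {ρ i}ᶜ, 𝓑.eval t ≠ 0 ∧
      (𝓐 + Polynomial.C (paramOf 𝓐 𝓑 t) * 𝓑).derivative.eval t ≠ 0 := by
  obtain ⟨α, -, u, -, h1, -⟩ := exists_rootTerm_eq d 0 (h.one_le i) (h.factor i) (h.eval_ne i)
    (h.eval_right_ne i)
  exact h1.mono fun t ht => ⟨ht.1, ht.2.1⟩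

lemma IsFibre.eventually_isBranches (h : IsFibre d 𝓐 𝓑 p₀ ρ ν P) :
    ∀ᶠ p in nhdsWithin p₀ {p₀}ᶜ, ∃ V τ, IsBranches d 𝓐 𝓑 V τ ∧ p ∈ V := by
  filter_upwards [h.eventually_simple_roots (good := fun _ => True) h.eventually_ne
    fun i => Filter.Eventually.of_forall fun _ => trivial] with p hp
  obtain ⟨-, hc, t, ht, hf, hr⟩ := hp
  exact exists_isBranches h.natDegree_left h.natDegree_right hc ht hf (fun r => (hr r).1)
    fun r => (hr r).2.2.1

/-- Subtracting from `rootTerm` the polar parts at all the fibre points leaves a function bounded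
near each of them, so its weighted sum times `p - p₀` tends to zero. The polar parts themselves are
summed exactly by `sum_div_sub` and `sum_div_sub_sq`. -/
lemma IsFibre.tendsto_sub_mul_rootSum (h : IsFibre d 𝓐 𝓑 p₀ ρ ν P) (κ : ℂ) :
    Filter.Tendsto (fun p => (p - p₀) * rootSum d κ 𝓐 𝓑 p) (nhdsWithin p₀ {p₀}ᶜ)
      (nhds (∑ i, polarCoeff d (ν i) κ p₀ 𝓑 (P i) (ρ i))) := by
  choose α hα u hu hloc hlim using fun i => exists_rootTerm_eq d κ (h.one_le i) (h.factor i)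
    (h.eval_ne i) (h.eval_right_ne i)
  set β : Fin n → ℂ := fun i => polarCoeff d (ν i) κ p₀ 𝓑 (P i) (ρ i) with hβ
  set S : ℂ → ℂ := fun t => -𝓑.eval t /
    (𝓐 + Polynomial.C (paramOf 𝓐 𝓑 t) * 𝓑).derivative.eval t with hS
  set T : ℂ → ℂ := fun t => rootTerm d κ (paramOf 𝓐 𝓑 t)
    (𝓐 + Polynomial.C (paramOf 𝓐 𝓑 t) * 𝓑) t with hT
  set Q : Fin n → ℂ → ℂ := fun i t => α i / (t - ρ i) ^ 2 + β i / (t - ρ i) with hQ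
  set E : ℂ → ℂ := fun t => (paramOf 𝓐 𝓑 t - p₀) * S t * (T t - ∑ i, Q i t) with hE
  have hElim (j : Fin n) : Filter.Tendsto E (nhdsWithin (ρ j) {ρ j}ᶜ) (nhds 0) := by
    have hcont : ContinuousAt (fun t => u j t - ∑ i ∈ Finset.univ.erase j, Q i t) (ρ j) := by
      refine (hu j).sub (tendsto_finsetSum _ fun i hi => ?_)
      have hne : ρ j - ρ i ≠ 0 := sub_ne_zero.2 (h.injective.ne (Finset.ne_of_mem_erase hi).symm)
      have hne2 := pow_ne_zero 2 hne
      exact ContinuousAt.add (ContinuousAt.div (by fun_prop) (by fun_prop) hne2)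
        (ContinuousAt.div (by fun_prop) (by fun_prop) hne)
    have := (hlim j).mul (hcont.tendsto.mono_left nhdsWithin_le_nhds)
    rw [zero_mul] at this
    refine this.congr' ?_
    filter_upwards [hloc j] with t ht
    have h1 : T t = Q j t + u j t := ht.2.2
    simp only [hE]
    rw [← Finset.add_sum_erase _ _ (Finset.mem_univ j), h1]
    ring
  set M : ℂ → ℂ := fun p => ∑ i, β i * (1 - (p - p₀) * (𝓑.coeff d / (𝓐.coeff d + p * 𝓑.coeff d)))
  have hM : Filter.Tendsto M (nhdsWithin p₀ {p₀}ᶜ) (nhds (∑ i, β i)) := by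
    have hc : ContinuousAt M p₀ := by
      refine tendsto_finsetSum _ fun i _ => ?_
      have : ContinuousAt (fun p : ℂ => 𝓑.coeff d / (𝓐.coeff d + p * 𝓑.coeff d)) p₀ :=
        ContinuousAt.div (by fun_prop) (by fun_prop) h.lead_ne
      exact ContinuousAt.mul (by fun_prop)
        (ContinuousAt.sub (by fun_prop) (ContinuousAt.mul (by fun_prop) this))
    have := hc.tendsto.mono_left (nhdsWithin_le_nhds (s := {p₀}ᶜ))
    simpa [M] using this
  have herr : Filter.Tendsto (fun p => (p - p₀) * rootSum d κ 𝓐 𝓑 p - M p)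
      (nhdsWithin p₀ {p₀}ᶜ) (nhds 0) := by
    refine Metric.tendsto_nhds.2 fun ε hε => ?_
    -- The denominator `d + 1` makes the sum of `d` such bounds strictly less than `ε`.
    have hε' : 0 < ε / (d + 1) := by positivity
    filter_upwards [h.eventually_simple_roots (good := fun t => ‖E t‖ < ε / (d + 1))
      h.eventually_ne fun i => by
        simpa using Metric.tendsto_nhds.1 (hElim i) _ hε'] with p hp
    obtain ⟨hpp, hc, t, ht, hf, hr⟩ := hp
    have hsum : rootSum d κ 𝓐 𝓑 p = ∑ r, S (t r) * T (t r) := by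
      rw [rootSum, sum_roots_eq ht hc hf]
      refine Finset.sum_congr rfl fun r _ => ?_
      simp only [hS, hT, (hr r).2.1]
    have hSr (r : Fin d) : S (t r) =
        -𝓑.eval (t r) / (𝓐 + Polynomial.C p * 𝓑).derivative.eval (t r) := by
      simp only [hS, (hr r).2.1]
    have hQi (i : Fin n) : ∑ r, S (t r) * Q i (t r) =
        β i * (1 / (p - p₀) - 𝓑.coeff d / (𝓐.coeff d + p * 𝓑.coeff d)) := by
      have h1 : ∑ r, S (t r) * Q i (t r) = α i * ∑ r, S (t r) / (t r - ρ i) ^ 2 +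
          β i * ∑ r, S (t r) / (t r - ρ i) := by
        rw [Finset.mul_sum, Finset.mul_sum, ← Finset.sum_add_distrib]
        refine Finset.sum_congr rfl fun r _ => ?_
        simp only [hQ]
        ring
      rw [h1]
      simp only [hSr]
      rw [h.sum_div_sub hpp hc ht hf]
      by_cases hi : ν i = 1
      · rw [hα i hi, zero_mul, zero_add]
      · rw [h.sum_div_sub_sq hpp hc ht hf hi, mul_zero, zero_add]
    have hmain : (p - p₀) * rootSum d κ 𝓐 𝓑 p - M p = ∑ r, E (t r) := by
      have h2 : ∑ r, E (t r) = (p - p₀) * rootSum d κ 𝓐 𝓑 p -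
          (p - p₀) * ∑ i, ∑ r, S (t r) * Q i (t r) := by
        rw [Finset.sum_comm, ← mul_sub, hsum, ← Finset.sum_sub_distrib, Finset.mul_sum]
        refine Finset.sum_congr rfl fun r _ => ?_
        simp only [hE, (hr r).2.1, ← Finset.mul_sum]
        ring
      rw [h2]
      simp only [hQi, M, Finset.mul_sum]
      congr 1
      refine Finset.sum_congr rfl fun i _ => ?_
      have := sub_ne_zero.2 hpp
      rw [mul_left_comm, mul_sub (p - p₀), mul_one_div_cancel this]
    rw [hmain, dist_zero_right]
    calc ‖∑ r, E (t r)‖ ≤ ∑ r, ‖E (t r)‖ := norm_sum_le _ _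
      _ ≤ ∑ _r : Fin d, ε / (d + 1) := Finset.sum_le_sum fun r _ => (hr r).2.2.2.2.le
      _ = d * (ε / (d + 1)) := by simp
      _ < ε := by
        rw [mul_div_assoc', div_lt_iff₀ (by positivity)]
        nlinarith
  have := herr.add hM
  simpa using this

end Pole

/-! ### Holomorphy of the curvature and polar part -/

section Criterion

variable {d : ℕ} {F : SymForm} {p₀ L : ℂ} {r : ℂ → ℂ}

/-- If the curvature of a web is `-r'(p) / q dp ∧ dq` near the line `p = p₀`, contained in the
discriminant, and `r` has at most a simple pole at `p₀`, then the curvature is holomorphic along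
this line if and only if the residue of `r` at `p₀` vanishes. -/
lemma curvatureHolomorphicAlong_iff
    (hr : ∀ᶠ p in nhdsWithin p₀ {p₀}ᶜ, DifferentiableAt ℂ r p ∧ ∀ q, q ≠ 0 →
      (p, q) ∉ discriminantLocus d F ∧ ∀ k, IsCurvatureAt d F (p, q) k ↔ k = -deriv r p / q)
    (hL : Filter.Tendsto (fun p => (p - p₀) * r p) (nhdsWithin p₀ {p₀}ᶜ) (nhds L))
    (hD : {z : ℂ × ℂ | z.1 = p₀} ⊆ discriminantLocus d F) :
    CurvatureHolomorphicAlong d F {z : ℂ × ℂ | z.1 = p₀} ↔ L = 0 := by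
  classical
  set f := Function.update (fun p => (p - p₀) * r p) p₀ L with hf
  have hfne {p : ℂ} (hp : p ≠ p₀) : f p = (p - p₀) * r p := Function.update_of_ne hp _ _
  have hfp : f p₀ = L := Function.update_self ..
  have hfev {p : ℂ} (hp : p ≠ p₀) : f =ᶠ[nhds p] fun p => (p - p₀) * r p := by
    filter_upwards [isOpen_ne.mem_nhds hp] with x hx
    exact hfne hx
  -- Removable singularity theorem: `L` is the value that makes `(p - p₀) r` continuous.
  have hfan : AnalyticAt ℂ f p₀ := by
    refine Complex.analyticAt_of_differentiable_on_punctured_nhds_of_continuousAt ?_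
      (continuousAt_update_same.2 hL)
    filter_upwards [hr, self_mem_nhdsWithin] with p hp hpp
    refine (DifferentiableAt.mul (by fun_prop) hp.1).congr_of_eventuallyEq (hfev hpp)
  constructor
  · intro hfin
    -- Only finitely many points of the line are exceptional, so one horizontal slice off `q = 0`
    -- meets it at a good point.
    obtain ⟨q₀, hq⟩ : ∃ q₀ : ℂ, q₀ ≠ 0 ∧ CurvatureHolomorphicAt d F (p₀, q₀) := by
      have h1 : ({q : ℂ | ¬ CurvatureHolomorphicAt d F (p₀, q)} ∪ {0}).Finite := by
        refine Set.Finite.union ?_ (Set.finite_singleton 0)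
        refine Set.Finite.of_finite_image (f := fun q => (p₀, q)) (hfin.subset ?_)
          (Function.Injective.injOn fun x y hxy => (Prod.ext_iff.1 hxy).2)
        rintro _ ⟨q, hq, rfl⟩
        exact ⟨rfl, hq⟩
      obtain ⟨q, hq⟩ := h1.infinite_compl.nonempty
      simp only [Set.mem_compl_iff, Set.mem_union, Set.mem_ofPred_eq, Set.mem_singleton_iff,
        not_or, not_not] at hq
      exact ⟨q, hq.2, hq.1⟩
    obtain ⟨hq0, N, hN, hmN, g, hg, hcurv⟩ := hq
    have hcont : ContinuousAt (fun p : ℂ => (p, q₀)) p₀ := by fun_prop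
    have hgc : Filter.Tendsto (fun p => g (p, q₀)) (nhdsWithin p₀ {p₀}ᶜ) (nhds (g (p₀, q₀))) := by
      have : ContinuousAt (fun p => g (p, q₀)) p₀ :=
        ContinuousAt.comp (f := fun p : ℂ => (p, q₀)) (hg _ hmN).continuousAt hcont
      exact this.tendsto.mono_left nhdsWithin_le_nhds
    have hpN : ∀ᶠ p in nhdsWithin p₀ {p₀}ᶜ, (p, q₀) ∈ N :=
      nhdsWithin_le_nhds (hcont.eventually (hN.mem_nhds hmN))
    have hsub : Filter.Tendsto (fun p : ℂ => p - p₀) (nhdsWithin p₀ {p₀}ᶜ) (nhds 0) := by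
      have : ContinuousAt (fun p : ℂ => p - p₀) p₀ := by fun_prop
      simpa using this.tendsto.mono_left (nhdsWithin_le_nhds (s := {p₀}ᶜ))
    have hfd : Filter.Tendsto (fun p => (p - p₀) * deriv f p) (nhdsWithin p₀ {p₀}ᶜ) (nhds 0) := by
      have := hsub.mul (hfan.deriv.continuousAt.tendsto.mono_left
        (nhdsWithin_le_nhds (s := {p₀}ᶜ)))
      rwa [zero_mul] at this
    have hfl : Filter.Tendsto f (nhdsWithin p₀ {p₀}ᶜ) (nhds L) := by
      rw [← hfp]
      exact hfan.continuousAt.tendsto.mono_left nhdsWithin_le_nhds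
    have h2 : Filter.Tendsto (fun p => (p - p₀) ^ 2 * (-(q₀ * g (p, q₀))) + f p)
        (nhdsWithin p₀ {p₀}ᶜ) (nhds (0 ^ 2 * (-(q₀ * g (p₀, q₀))) + L)) :=
      ((hsub.pow 2).mul (hgc.const_mul q₀).neg).add hfl
    -- On the slice `r' = -q₀ g` stays bounded, and `(p - p₀) f' = (p - p₀)² r' + f`; letting `p`
    -- tend to `p₀` gives `0 = L`.
    have h3 : 0 ^ 2 * (-(q₀ * g (p₀, q₀))) + L = 0 := by
      refine tendsto_nhds_unique h2 (hfd.congr' ?_)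
      filter_upwards [hr, hpN, self_mem_nhdsWithin] with p hp hpN hpp
      have hk := ((hp.2 q₀ hq0).2 _).1 (hcurv _ ⟨hpN, (hp.2 q₀ hq0).1⟩)
      rw [hk, mul_div_cancel₀ _ hq0, neg_neg, (hfev hpp).deriv_eq, hfne hpp]
      have hd : HasDerivAt (fun p => (p - p₀) * r p) _ p :=
        ((hasDerivAt_id p).sub_const p₀).mul hp.1.hasDerivAt
      rw [hd.deriv]
      simp only [id]
      ring
    simpa using h3
  · rintro rfl
    have hran : AnalyticAt ℂ (dslope f p₀) p₀ := by
      obtain ⟨s, hs⟩ := hfan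
      exact hs.has_fpower_series_dslope_fslope.analyticAt
    have hreq {p : ℂ} (hp : p ≠ p₀) : dslope f p₀ p = r p := by
      rw [dslope_of_ne _ hp, slope_def_field, hfp, sub_zero, hfne hp,
        mul_div_cancel_left₀ _ (sub_ne_zero.2 hp)]
    rw [eventually_nhdsWithin_iff] at hr
    obtain ⟨U, hU, hUo, hpU⟩ := eventually_nhds_iff.1 (hr.and hran.eventually_analyticAt)
    -- With zero residue `r` extends holomorphically, and `-r' / q` can fail only where `q = 0`.
    refine (Set.finite_singleton ((p₀, 0) : ℂ × ℂ)).subset ?_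
    rintro ⟨p, q⟩ ⟨hp, hnot⟩
    obtain rfl : p = p₀ := hp
    by_contra hne
    have hq : q ≠ 0 := fun h0 => hne (by rw [h0]; rfl)
    refine hnot ⟨{z | z.1 ∈ U ∧ z.2 ≠ 0}, ?_, ⟨hpU, hq⟩,
      fun z => -deriv (dslope f p) z.1 / z.2, ?_, ?_⟩
    · exact (hUo.preimage continuous_fst).inter (isOpen_ne.preimage continuous_snd)
    · intro z hz
      have h1 : AnalyticAt ℂ (fun z : ℂ × ℂ => deriv (dslope f p) z.1) z :=
        AnalyticAt.fun_comp (f := fun z : ℂ × ℂ => z.1) (hU _ hz.1).2.deriv analyticAt_fst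
      exact h1.neg.div analyticAt_snd hz.2
    · rintro ⟨x, y⟩ ⟨⟨hx, hy⟩, hdisc⟩
      -- The line lies in the discriminant, so the extension has to be the curvature only off the
      -- line.
      have hxp : x ≠ p := fun h0 => hdisc (hD h0)
      refine ((((hU x hx).1 hxp).2 y hy).2 _).2 ?_
      have : dslope f p =ᶠ[nhds x] r := by
        filter_upwards [isOpen_ne.mem_nhds hxp] with w hw
        exact hreq hw
      simp only [this.deriv_eq]

end Criterion

/-! ### The curvature of the Legendre transform near the line `p = p₀`. -/

section Legendre

variable {A B : MvPolynomial (Fin 2) ℂ} {d n : ℕ} {p₀ κ : ℂ} {ρ : Fin n → ℂ} {ν : Fin n → ℕ}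
  {P : Fin n → Polynomial ℂ}

lemma IsFibre.eventually_isCurvatureAt_iff (hd : 3 ≤ d) (hA : A.IsHomogeneous d)
    (hB : B.IsHomogeneous d) (h : IsFibre d (dehom κ A) (dehom κ B) p₀ ρ ν P) :
    ∀ᶠ p in nhdsWithin p₀ {p₀}ᶜ,
      DifferentiableAt ℂ (rootSum d κ (dehom κ A) (dehom κ B)) p ∧ ∀ q, q ≠ 0 →
      (p, q) ∉ discriminantLocus d (legForm A B) ∧ ∀ k, IsCurvatureAt d (legForm A B) (p, q) k ↔
        k = -deriv (rootSum d κ (dehom κ A) (dehom κ B)) p / q := by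
  filter_upwards [h.eventually_isBranches] with p hp
  obtain ⟨V, τ, hτ, hpV⟩ := hp
  have hev : rootSum d κ (dehom κ A) (dehom κ B) =ᶠ[nhds p]
      fun p => (d * (d - 1) * (d - 2) / 2 : ℂ) - branchSum κ τ p := by
    filter_upwards [hτ.isOpen.mem_nhds hpV] with x hx
    rw [hτ.branchSum_eq (by omega) hx]
    ring
  have hder : -deriv (rootSum d κ (dehom κ A) (dehom κ B)) p = deriv (branchSum κ τ) p := by
    rw [hev.deriv_eq, deriv_const_sub, neg_neg]
  refine ⟨((hτ.differentiableAt_branchSum κ hpV).const_sub _).congr_of_eventuallyEq hev,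
    fun q hq => ⟨notMem_discriminantLocus hd hA hB hτ hpV hq, fun k => ?_⟩⟩
  rw [hder]
  refine ⟨fun hk => hk.eq_deriv_branchSum hd hA hB hτ hpV hq, ?_⟩
  rintro rfl
  exact isCurvatureAt_deriv_branchSum hd hA hB hτ (z := (p, q)) hpV hq

end Legendre

/-! ### An affine chart containing the whole fibre. -/

lemma exists_forall_add_mul_ne_zero {n : ℕ} {a b : Fin n → ℂ} (hab : ∀ i, ![a i, b i] ≠ 0) :
    ∃ κ : ℂ, ∀ i, b i + κ * a i ≠ 0 := by
  have h : (⋃ i, {κ : ℂ | b i + κ * a i = 0}).Finite := by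
    refine Set.finite_iUnion fun i => Set.Subsingleton.finite fun x hx y hy => ?_
    simp only [Set.mem_ofPred_eq] at hx hy
    have ha : a i ≠ 0 := fun ha => hab i (by
      rw [ha, mul_zero, add_zero] at hx
      rw [ha, hx]
      simp)
    exact mul_right_cancel₀ ha (by linear_combination hx - hy)
  obtain ⟨κ, hκ⟩ := h.infinite_compl.nonempty
  simp only [Set.mem_compl_iff, Set.mem_iUnion, Set.mem_ofPred_eq, not_exists] at hκ
  exact ⟨κ, hκ⟩

section Fibre

variable {A B : MvPolynomial (Fin 2) ℂ} {d n : ℕ} {p₀ κ : ℂ} {a b : Fin n → ℂ} {ν : Fin n → ℕ}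
  {P : Fin n → MvPolynomial (Fin 2) ℂ}

/-- In the chart, `b y - a x` becomes `(b + κ a) (X - ρ)`; the constant `(b + κ a) ^ ν` is moved
into the cofactor. -/
lemma isFibre_dehom (hA : A.IsHomogeneous d) (hB : B.IsHomogeneous d)
    (hab : ∀ i, ![a i, b i] ≠ 0)
    (hinj : Function.Injective fun i => Projectivization.mk ℂ ![a i, b i] (hab i))
    (hmem : ∀ {x y : ℂ} (hxy : ![x, y] ≠ 0), eval ![y, x] (A + C p₀ * B) = 0 →
      ∃ i, Projectivization.mk ℂ ![a i, b i] (hab i) = Projectivization.mk ℂ ![x, y] hxy)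
    (hν : ∀ i, 1 ≤ ν i) (hP : ∀ i, (P i).IsHomogeneous (d - ν i))
    (hPe : ∀ i, A + C p₀ * B = lineForm (a i) (b i) ^ ν i * P i)
    (hP0 : ∀ i, eval ![b i, a i] (P i) ≠ 0) (hB0 : ∀ i, eval ![b i, a i] B ≠ 0)
    (hκ : ∀ i, b i + κ * a i ≠ 0) :
    IsFibre d (dehom κ A) (dehom κ B) p₀ (fun i => a i / (b i + κ * a i)) ν
      fun i => Polynomial.C ((b i + κ * a i) ^ ν i) * dehom κ (P i) where
  natDegree_left := natDegree_dehom_le hA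
  natDegree_right := natDegree_dehom_le hB
  -- A vanishing leading coefficient would put the point at infinity `(x, y) = (-κ, 1)` in the
  -- fibre, against the choice of `κ`.
  lead_ne h0 := by
    rw [coeff_dehom hA, coeff_dehom hB] at h0
    obtain ⟨i, hi⟩ := hmem (x := 1) (y := -κ) (vec_right_ne _) (by simpa using h0)
    obtain ⟨u, hu⟩ := (Projectivization.mk_eq_mk_iff' _ _ _ _ _).1 hi
    have h1 := congrFun hu 0
    have h2 := congrFun hu 1
    simp at h1 h2
    exact hκ i (by rw [← h1, ← h2]; ring)
  injective i j hij := hinj (by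
    refine (Projectivization.mk_eq_mk_iff' _ _ _ _ _).2
      ⟨(b i + κ * a i) / (b j + κ * a j), ?_⟩
    have hi := hκ i
    have hj := hκ j
    have h1 : a i * (b j + κ * a j) = a j * (b i + κ * a i) := (div_eq_div_iff hi hj).1 hij
    ext k
    fin_cases k
    · simp
      field_simp
      linear_combination -h1
    · simp
      field_simp
      linear_combination κ * h1)
  one_le := hν
  factor i := by
    have h1 := congrArg (dehom κ) (hPe i)
    rw [dehom_add, dehom_mul, dehom_mul, dehom_pow, dehom_C, dehom_lineForm] at h1
    have h2 : Polynomial.C (b i + κ * a i) * Polynomial.X - Polynomial.C (a i) =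
        Polynomial.C (b i + κ * a i) *
          (Polynomial.X - Polynomial.C (a i / (b i + κ * a i))) := by
      rw [mul_sub, ← Polynomial.C_mul, mul_div_cancel₀ _ (hκ i)]
    rw [h1, h2, mul_pow, Polynomial.C_pow]
    ring
  eval_ne i := by
    have := hP0 i
    rw [eval_eq_pow_mul_eval_dehom (hP i) (hκ i)] at this
    rw [Polynomial.eval_mul, Polynomial.eval_C]
    exact mul_ne_zero (pow_ne_zero _ (hκ i)) (right_ne_zero_of_mul this)
  eval_right_ne i := by
    have := hB0 i
    rw [eval_eq_pow_mul_eval_dehom hB (hκ i)] at this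
    exact right_ne_zero_of_mul this
  mem_range t ht := by
    have hv : ![t, 1 - κ * t] ≠ 0 := fun h0 => by
      have h1 := congrFun h0 0
      have h2 := congrFun h0 1
      simp at h1 h2
      simp [h1] at h2
    rw [← dehom_C κ, ← dehom_mul, ← dehom_add, eval_dehom] at ht
    obtain ⟨i, hi⟩ := hmem hv ht
    obtain ⟨u, hu⟩ := (Projectivization.mk_eq_mk_iff' _ _ _ _ _).1 hi
    have h1 := congrFun hu 0
    have h2 := congrFun hu 1
    simp at h1 h2
    refine ⟨i, ?_⟩
    have hk := hκ i
    simp only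
    rw [div_eq_iff hk, ← h1, ← h2]
    ring

end Fibre

end HomogeneousWeb

/-! ### The criterion. -/

open HomogeneousWeb in
theorem theorem3p1 (d : ℕ) (hd : 3 ≤ d)
    (A B : MvPolynomial (Fin 2) ℂ) (hA : A.IsHomogeneous d) (hB : B.IsHomogeneous d)
    (hAB : IsRelPrime A B)
    (p₀ : ℂ) (hD : {z : ℂ × ℂ | z.1 = p₀} ⊆ discriminantLocus d (legForm A B))
    (n : ℕ) (a b : Fin n → ℂ) (hab : ∀ i, ![a i, b i] ≠ 0)
    (hinj : Function.Injective fun i => Projectivization.mk ℂ ![a i, b i] (hab i))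
    (hfiber : gMap A B ⁻¹' {P1.ofAffine p₀} =
      Set.range fun i => Projectivization.mk ℂ ![a i, b i] (hab i))
    (ν : Fin n → ℕ)
    (hν : ∀ i, ν i = ramificationIndex (gMap A B) (Projectivization.mk ℂ ![a i, b i] (hab i))) :
    (∀ i, 1 ≤ ν i ∧ ν i ≤ d ∧
      polyP A B (a i) (b i) (ν i) * lineForm (a i) (b i) ^ ν i = numP A B (a i) (b i) ∧
      (polyP A B (a i) (b i) (ν i)).IsHomogeneous (d - ν i) ∧
      (polyQ A B (a i) (b i) (ν i)).IsHomogeneous (2 * d - ν i - 1) ∧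
      MvPolynomial.eval ![b i, a i] (polyP A B (a i) (b i) (ν i)) ≠ 0 ∧
      MvPolynomial.eval ![b i, a i] B ≠ 0) ∧
    (CurvatureHolomorphicAlong d (legForm A B) {z : ℂ × ℂ | z.1 = p₀} ↔
      ∑ i, (1 - 1 / (ν i : ℂ)) *
        ((p₀ * b i - a i) * MvPolynomial.eval ![b i, a i] (polyQ A B (a i) (b i) (ν i)) /
          (MvPolynomial.eval ![b i, a i] (polyP A B (a i) (b i) (ν i)) *
            MvPolynomial.eval ![b i, a i] B)) = 0) := by
  have hgi (i : Fin n) : gMap A B (Projectivization.mk ℂ ![a i, b i] (hab i)) =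
      P1.ofAffine p₀ := by
    have : Projectivization.mk ℂ ![a i, b i] (hab i) ∈ gMap A B ⁻¹' {P1.ofAffine p₀} := by
      rw [hfiber]
      exact ⟨i, rfl⟩
    exact this
  have hzero (i : Fin n) : eval ![b i, a i] (A + C p₀ * B) = 0 :=
    (gMap_eq_ofAffine_iff hA hB hAB (hab i) p₀).1 (hgi i)
  have hB0 (i : Fin n) : eval ![b i, a i] B ≠ 0 := fun h0 => by
    have h1 := hzero i
    rw [map_add, map_mul, h0, mul_zero, add_zero] at h1
    exact not_common_zero hA hB hAB (hab i) h1 h0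
  have hG : (A + C p₀ * B).IsHomogeneous d := hA.add (by simpa using hB.C_mul p₀)
  have hfac (i : Fin n) : 1 ≤ ν i ∧ ν i ≤ d ∧ ∃ P, P.IsHomogeneous (d - ν i) ∧
      A + C p₀ * B = lineForm (a i) (b i) ^ ν i * P ∧ eval ![b i, a i] P ≠ 0 := by
    obtain ⟨m, hm, P, hP, hPe, hP0⟩ := exists_eq_lineForm_pow_mul hG
      (add_C_mul_ne_zero (by omega) hB hAB p₀) (hab i)
    obtain rfl : ν i = m := by
      rw [hν i]
      exact ramificationIndex_eq hA hB hAB (hab i) (hgi i) (hB0 i) hP hPe hP0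
    refine ⟨Nat.one_le_iff_ne_zero.2 fun h0 => hP0 ?_, hm, P, hP, hPe, hP0⟩
    have := hzero i
    rwa [hPe, h0, pow_zero, one_mul] at this
  choose hν1 hνd P hP hPe hP0 using hfac
  have hpolyP (i : Fin n) : polyP A B (a i) (b i) (ν i) = C (eval ![b i, a i] B) * P i :=
    polyP_eq (hab i) (hzero i) (hPe i)
  have hpolyPh (i : Fin n) : (polyP A B (a i) (b i) (ν i)).IsHomogeneous (d - ν i) := by
    rw [hpolyP]
    exact (hP i).C_mul _
  refine ⟨fun i => ⟨hν1 i, hνd i, ?_, hpolyPh i,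
    polyQ_isHomogeneous hA hB (by omega) (hνd i) (hpolyPh i), ?_, hB0 i⟩, ?_⟩
  · rw [hpolyP, numP_eq (hzero i), hPe i]
    ring
  · rw [hpolyP, map_mul, eval_C]
    exact mul_ne_zero (hB0 i) (hP0 i)
  obtain ⟨κ, hκ⟩ := exists_forall_add_mul_ne_zero hab
  have hF := isFibre_dehom (p₀ := p₀) (κ := κ) hA hB hab hinj (fun {x y} hxy h0 => by
    have : Projectivization.mk ℂ ![x, y] hxy ∈ gMap A B ⁻¹' {P1.ofAffine p₀} :=
      (gMap_eq_ofAffine_iff hA hB hAB hxy p₀).2 h0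
    rwa [hfiber] at this) hν1 hP hPe hP0 hB0 hκ
  -- The sum in the criterion is six times the residue of `rootSum`.
  rw [curvatureHolomorphicAlong_iff (hF.eventually_isCurvatureAt_iff hd hA hB)
    (hF.tendsto_sub_mul_rootSum κ) hD, Finset.sum_congr rfl fun i _ =>
      term_eq_polarCoeff hB (hab i) (hν1 i) (hνd i) (hP i) (hPe i) (hP0 i) (hB0 i) (hκ i) _
        (pow_ne_zero (ν i) (hκ i)), ← Finset.mul_sum]
  simp
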